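/- **Setting.** Let $n\ge 1$. For $u,v\in\{0,1\}^n$ let $d_H(u,v)=\frac1n|\{i:u_i\ne v_i\}|$; for distributions $P,Q$ over $\{0,1\}^n$ let $d(P,Q)=\min_T \mathrm{E}_{(u,v)\sim T}[d_H(u,v)]$ (earth mover's distance; $T$ ranges over all couplings of $P$ and $Q$), and let $d(P,\mathcal P)=\inf_{Q\in\mathcal P}d(P,Q)$. Let $\mathcal S_m$ be the set of distributions over $\{0,1\}^n$ supported by at most $m$ elements. An algorithm in the Huge Object model for an unknown $P$ may toss coins, draw new independent samples from $P$ (which it does not see), and query single coordinates of samples already drawn, adaptively. It is a one-sided $\varepsilon$-test of $\mathcal P$ if it accepts every $P\in\mathcal P$ with probability $1$ and rejects every $P$ with $d(P,\mathcal P)>\varepsilon$ with probability higher than $\frac23$. All logarithms are in base $2$; $x|_J$ is the restriction of $x$ to the indices in $J$. Index sets are chosen uniformly and independently, with repetitions. Two samples are *distinguished* if some index was queried in both, with different answers. **Non-adaptive test.** Let $L=\lceil\log\varepsilon^{-1}\rceil$. Choose indices $i_1,i_2,\dots,i_{\lceil 2^{L+2}\log(m+1)\rceil}$ and for $0\le a\le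 L$ let $I_a=\{i_1,\dots,i_{\lceil 2^{a+2}\log(m+1)\rceil}\}$. Take a sample $u$ and query it at $I_L$. For all $1\le k\le 2m$, $0\le a\le L$ take a sequence $S_{a,k}$ of $2^{3-a}2^{L}$ new samples and query them at $I_a$. Reject iff there are $u_2,\dots,u_{m+1}\in\bigcup_{a,k}S_{a,k}$ such that $u,u_2,\dots,u_{m+1}$ are pairwise distinguished. **Fishing expedition** (goal $k\ge1$, threshold $p$, confidence $q$, subroutine $\mathcal A$ that succeeds or fails). Let $t_{\max}=\lfloor\log k+2\rfloor$, $N_1=0$ and $N_t=\lceil p^{-1}\max\{2^t,5(\log q^{-1}+\log(\log k+1))\}\rceil$ for $2\le t\le t_{\max}$. Execute $\mathcal A$ repeatedly; stop as soon as the number $H$ of successes is $k$, and stop after the $N_t$-th execution ($2\le t\le t_{\max}$) if $H<\frac12pN_t$ at that point. **Batch** with scale $a$ and set $A$ of samples: choose a set $J$ of $\lceil2^{a+2}\log m\rceil$ indices, query all members of $A$ at $J$, take $\lceil2^{2-a}\varepsilon^{-1}\log m\rceil$ new samples and query them at $J$. If some new sample $Y$ has $Y|_J\ne X|_J$ for all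 $X\in A$, add (the first such) $Y$ to $A$ and succeed; otherwise fail. **Adaptive test.** If $\varepsilon\ge\frac1{m^2}$, run the non-adaptive test and return its answer. Otherwise take a sample $u$ and let $A=\{u\}$. *First phase:* for $a=0,1,\dots,\lceil\log m\rceil$ run the fishing expedition with $k=m+1-|A|$, $p=\frac13$, $q=\frac1{4\lceil\log m+1\rceil}$ and the batch with scale $a$ as subroutine; reject if then $|A|\ge m+1$. *Decision tree:* build a query decision tree $\mathcal T$ whose leaves correspond to the members of $A$, by inserting these one after another: run the tree on the new member $y$, let $x$ be the member at the leaf that is reached, and replace this leaf by a node that queries an index at which $x,y$ have both been queried with different answers, with children $x$ and $y$. *Second phase:* repeat $\lceil48\varepsilon^{-1}\rceil$ times: draw a new sample $Y$, choose a set $J$ of $m$ indices, find by $\mathcal T$ the $X\in A$ with $\mathcal T(Y)=\mathcal T(X)$, query $X$ and $Y$ at $J$; if $Y|_J\ne X|_J$, add $Y$ to $A$ and insert it into $\mathcal T$ using an index of $J$ at which they differ; if then $|A|\ge m+1$, reject. Accept after the last repetition. **Theorem.** There is an absolute constant $C>0$ such that for all $n\ge1$, $m\ge2$ and $0<\varepsilon\le1$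 the adaptive test is a one-sided $\varepsilon$-test of $\mathcal S_m$, and on every input distribution it always makes at most $$C\,\varepsilon^{-1}\,m\log m\cdot\min\{\max\{1,\log\varepsilon^{-1}\},\log m\}$$ queries. (For $\varepsilon\le\frac12$ the last factor is $\min\{\log\varepsilon^{-1},\log m\}$.) -/

import Mathlib

noncomputable section

namespace HugeObject

/-! ### Distributions over strings, distances and the bounded support property -/

/-- Strings in `{0,1}^n`. -/
abbrev Str (n : ℕ) : Type := Fin n → Bool

/-- Normalized Hamming distance between two strings. -/
def strDist {n : ℕ} (u v : Str n) : ℝ := (hammingDist u v : ℝ) / (n : ℝ)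

/-- `T` is a transfer distribution (a coupling) from `P` to `Q`. -/
def IsTransfer {n : ℕ} (P Q : PMF (Str n)) (T : PMF (Str n × Str n)) : Prop :=
  T.map Prod.fst = P ∧ T.map Prod.snd = Q

/-- The expected distance `E_{(u,v) ∼ T} [d_H(u,v)]`. -/
def transferCost {n : ℕ} (T : PMF (Str n × Str n)) : ℝ :=
  ∑ w : Str n × Str n, (T w).toReal * strDist w.1 w.2

/-- Earth mover's distance with respect to the normalized Hamming distance. -/
def emd {n : ℕ} (P Q : PMF (Str n)) : ℝ :=
  sInf {c : ℝ | ∃ T : PMF (Str n × Str n), IsTransfer P Q T ∧ c = transferCost T}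

/-- Distance of a distribution from a property (a set of distributions). -/
def distToProperty {n : ℕ} (P : PMF (Str n)) (𝒬 : Set (PMF (Str n))) : ℝ :=
  sInf {c : ℝ | ∃ Q ∈ 𝒬, c = emd P Q}

/-- The property `S_m` at length `n`: distributions supported by at most `m` elements. -/
def boundedSupport (n m : ℕ) : Set (PMF (Str n)) := {P | P.support.ncard ≤ m}

/-! ### Probabilistic algorithms in the Huge Object model -/

/-- Algorithms in the Huge Object model with output in `α`. Samples are not visible: drawing a
sample only returns a handle (its serial number), and querying a coordinate of an earlier sample
returns one bit. `toss` is an internal random choice. -/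
inductive Alg (n : ℕ) (α : Type) : Type 1
  | done (a : α) : Alg n α
  | draw (next : ℕ → Alg n α) : Alg n α
  | query (i : ℕ) (j : Fin n) (next : Bool → Alg n α) : Alg n α
  | toss {β : Type} (p : PMF β) (next : β → Alg n α) : Alg n α

namespace Alg

/-- Sequential composition. -/
def andThen {n : ℕ} {α β : Type} : Alg n α → (α → Alg n β) → Alg n β
  | done a, f => f a
  | draw k, f => draw fun i => andThen (k i) f
  | query i j k, f => query i j fun b => andThen (k b) f
  | toss p k, f => toss p fun b => andThen (k b) f

instance instMonadAlg {n : ℕ} : Monad (Alg n) where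
  pure := done
  bind := andThen

/-- Execution on the input distribution `P`, when the samples in the list `S` have already been
drawn: the joint distribution of the output and of the number of queries that are made. -/
def run {n : ℕ} {α : Type} (P : PMF (Str n)) : Alg n α → List (Str n) → PMF (α × ℕ)
  | done a, _ => PMF.pure (a, 0)
  | draw k, S => P.bind fun x => run P (k S.length) (S ++ [x])
  | query i j k, S =>
      (run P (k ((S.getD i fun _ => false) j)) S).map fun o => (o.1, o.2 + 1)
  | toss p k, S => p.bind fun b => run P (k b) S

/-- The distribution of the output on the input distribution `P`. -/
def output {n : ℕ} {α : Type} (𝒜 : Alg n α) (P : PMF (Str n)) : PMF α :=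
  (run P 𝒜 []).map Prod.fst

/-- On every input distribution, every run makes at most `q` queries. -/
def MakesAtMost {n : ℕ} {α : Type} (𝒜 : Alg n α) (q : ℝ) : Prop :=
  ∀ P : PMF (Str n), ∀ o ∈ (run P 𝒜 []).support, (o.2 : ℝ) ≤ q

/-- `𝒜` (with output `true` for accept) is a one-sided `ε`-test of the property `𝒬`. -/
def IsOneSidedTest {n : ℕ} (𝒜 : Alg n Bool) (ε : ℝ) (𝒬 : Set (PMF (Str n))) : Prop :=
  (∀ P ∈ 𝒬, 𝒜.output P true = 1) ∧
  ∀ P : PMF (Str n), ε < distToProperty P 𝒬 → 2 / 3 < 𝒜.output P false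

end Alg

/-! ### Elementary subroutines -/

/-- Logarithm in base two. -/
def lg (x : ℝ) : ℝ := Real.logb 2 x

/-- A sequence of `N` indices, chosen uniformly and independently, with repetitions. -/
def chooseIndices (n : ℕ) [NeZero n] : ℕ → Alg n (List (Fin n))
  | 0 => pure []
  | N + 1 => do
      let j ← Alg.toss (PMF.uniformOfFintype (Fin n)) Alg.done
      let J ← chooseIndices n N
      pure (j :: J)

/-- Query the sample with handle `i` at all indices of `J`; the result is the restriction of the
sample to `J`, as a list of pairs (index, answer). -/
def queryAt {n : ℕ} (i : ℕ) : List (Fin n) → Alg n (List (Fin n × Bool))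
  | [] => pure []
  | j :: J => do
      let b ← Alg.query i j Alg.done
      let r ← queryAt i J
      pure ((j, b) :: r)

/-- A sample as the algorithm knows it: its handle, and a list of (index, answer) pairs that have
been obtained from it. -/
structure Elem (n : ℕ) where
  handle : ℕ
  view : List (Fin n × Bool)

/-- Some index was queried in both samples, with different answers. -/
def Elem.Distinguished {n : ℕ} (x y : Elem n) : Prop :=
  ∃ (j : Fin n) (b : Bool), (j, b) ∈ x.view ∧ (j, !b) ∈ y.view

/-- Take `N` new samples and query each of them at `J`. -/
def takeSamples {n : ℕ} (J : List (Fin n)) : ℕ → Alg n (List (Elem n))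
  | 0 => pure []
  | N + 1 => do
      let i ← Alg.draw Alg.done
      let v ← queryAt i J
      let S ← takeSamples J N
      pure (⟨i, v⟩ :: S)

/-- Run `f` on all items of a list in order and concatenate the results. -/
def collect {n : ℕ} {ι β : Type} (f : ι → Alg n (List β)) : List ι → Alg n (List β)
  | [] => pure []
  | i :: l => do
      let x ← f i
      let y ← collect f l
      pure (x ++ y)

/-! ### The non-adaptive test (used for large `ε`) -/

open Classical in
/-- The non-adaptive test, with distance parameter rounded down to the power of two `2^(-L)`,
`L = ⌈log ε⁻¹⌉`. The sample `u` is queried at `I_L`, and every sample of `S_{a,k}`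
(`0 ≤ a ≤ L`, `1 ≤ k ≤ 2m`), of which there are `2^(3-a) 2^L`, is queried at `I_a`. The test
rejects if there is a distinguishable composition of size `m + 1`, namely `u` followed by `m`
elements of the union of the `S_{a,k}` such that any two members of the sequence are
distinguished by a common query. -/
def nonAdaptiveTest (n : ℕ) [NeZero n] (ε : ℝ) (m : ℕ) : Alg n Bool := do
  let L : ℕ := ⌈lg ε⁻¹⌉₊
  let idx ← chooseIndices n ⌈4 * 2 ^ L * lg (m + 1)⌉₊
  let I : ℕ → List (Fin n) := fun a => idx.take ⌈2 ^ (a + 2) * lg (m + 1)⌉₊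
  let iu ← Alg.draw Alg.done
  let vu ← queryAt iu (I L)
  let S ← collect
    (fun _ : ℕ => collect (fun a => takeSamples (I a) (2 ^ (3 + L - a))) (List.range (L + 1)))
    (List.range (2 * m))
  if ∃ c : List (Elem n), c.length = m ∧ (∀ x ∈ c, x ∈ S) ∧
      ((⟨iu, vu⟩ : Elem n) :: c).Pairwise Elem.Distinguished
  then pure false
  else pure true

/-! ### The fishing expedition -/

/-- The checkpoints `N_t` of a fishing expedition with goal `k`, threshold `p` and
confidence `q`. -/
def checkpoint (k : ℕ) (p q : ℝ) (t : ℕ) : ℕ :=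
  if t ≤ 1 then 0 else ⌈p⁻¹ * max (2 ^ t) (5 * (lg q⁻¹ + lg (lg k + 1)))⌉₊

/-- At most `N` further executions of the subroutine `𝒜`, stopping as soon as the number `H` of
successes is `k`. The subroutine acts on a state, and returns whether it succeeded. -/
def fishWhile {n : ℕ} {σ : Type} (k : ℕ) (𝒜 : σ → Alg n (Bool × σ)) :
    ℕ → ℕ × σ → Alg n (ℕ × σ)
  | 0, (H, s) => pure (H, s)
  | N + 1, (H, s) => do
      let (x, s') ← 𝒜 s
      let H' := if x then H + 1 else H
      if H' = k then pure (H', s') else fishWhile k 𝒜 N (H', s')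

/-- The iterations `t` of a fishing expedition, for `t` in the given list. -/
def fishRounds {n : ℕ} {σ : Type} (k : ℕ) (p q : ℝ) (𝒜 : σ → Alg n (Bool × σ)) :
    List ℕ → ℕ × σ → Alg n (ℕ × σ)
  | [], st => pure st
  | t :: ts, st => do
      let (H, s) ← fishWhile k 𝒜 (checkpoint k p q t - checkpoint k p q (t - 1)) st
      if H = k then pure (H, s)
      else if (H : ℝ) < 1 / 2 * p * checkpoint k p q t then pure (H, s)
      else fishRounds k p q 𝒜 ts (H, s)

/-- Fishing expedition: `𝒜` is executed until `k` executions have succeeded, or until, at one of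
the checkpoints `N_t`, `2 ≤ t ≤ t_max = ⌊log k + 2⌋`, fewer than `p N_t / 2` of them have. The
result is the number of successes together with the final state. -/
def fishing {n : ℕ} {σ : Type} (k : ℕ) (p q : ℝ) (𝒜 : σ → Alg n (Bool × σ)) (s : σ) :
    Alg n (ℕ × σ) :=
  fishRounds k p q 𝒜 (List.Ico 2 (⌊lg k + 2⌋₊ + 1)) (0, s)

/-! ### The first phase -/

/-- Query every member of `A` at `J`; the result lists the restrictions to `J`. -/
def queryEach {n : ℕ} (J : List (Fin n)) : List (Elem n) → Alg n (List (List (Fin n × Bool)))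
  | [] => pure []
  | X :: A => do
      let r ← queryAt X.handle J
      let R ← queryEach J A
      pure (r :: R)

/-- A single batch with distance scale `a`. It succeeds if some new sample `Y` differs on `J` from
all members of `A`; the first such `Y` is then added to `A`. -/
def batch (n : ℕ) [NeZero n] (ε : ℝ) (m a : ℕ) (A : List (Elem n)) :
    Alg n (Bool × List (Elem n)) := do
  let J ← chooseIndices n ⌈2 ^ (a + 2) * lg m⌉₊
  let R ← queryEach J A
  let A' := List.zipWith (fun X r => (⟨X.handle, X.view ++ r⟩ : Elem n)) A R
  let Ys ← takeSamples J ⌈4 / 2 ^ a * ε⁻¹ * lg m⌉₊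
  match Ys.find? (fun Y => decide (Y.view ∉ R)) with
  | some Y => pure (true, A' ++ [Y])
  | none => pure (false, A')

/-- The iterations `a` of the first phase, for `a` in the given list; `none` means that the
algorithm has rejected. -/
def firstPhaseRounds (n : ℕ) [NeZero n] (ε : ℝ) (m : ℕ) :
    List ℕ → List (Elem n) → Alg n (Option (List (Elem n)))
  | [], A => pure (some A)
  | a :: as, A => do
      let (_, A') ← fishing (m + 1 - A.length) (1 / 3) (1 / (4 * ⌈lg m + 1⌉₊)) (batch n ε m a) A
      if m + 1 ≤ A'.length then pure none else firstPhaseRounds n ε m as A'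

/-- The first phase: distance scales `a = 0, …, ⌈log m⌉`. -/
def firstPhase (n : ℕ) [NeZero n] (ε : ℝ) (m : ℕ) (A : List (Elem n)) :
    Alg n (Option (List (Elem n))) :=
  firstPhaseRounds n ε m (List.range (⌈lg m⌉₊ + 1)) A

/-! ### Decision trees -/

/-- Query-based decision trees whose leaves correspond to samples. At `node j l r` coordinate `j`
is queried; `l` is followed on answer `0` and `r` on answer `1`. -/
inductive DTree (n : ℕ) : Type
  | leaf (x : Elem n) : DTree n
  | node (j : Fin n) (l r : DTree n) : DTree n

namespace DTree

/-- Use a decision tree: find the member `x` that shares its leaf with the sample with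
handle `i`. -/
def walk {n : ℕ} (i : ℕ) : DTree n → Alg n (Elem n)
  | leaf x => pure x
  | node j l r => do
      let b ← Alg.query i j Alg.done
      if b then walk i r else walk i l

/-- Update a decision tree: the leaf of `x` is replaced by a node that queries `j`, at which `y`
has the bit `b` and `x` the other bit, with children `x` and `y`. -/
def insert {n : ℕ} (x y : Elem n) (j : Fin n) (b : Bool) : DTree n → DTree n
  | leaf z =>
      if z.handle = x.handle then
        (if b then node j (leaf z) (leaf y) else node j (leaf y) (leaf z))
      else leaf z
  | node i l r => node i (insert x y j b l) (insert x y j b r)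

/-- Insert the members of a list one after another into a decision tree. Each is separated from
the member found at its leaf by an index at which both were queried with different answers (which
exists for sets of distinguishable samples). -/
def extend {n : ℕ} : List (Elem n) → DTree n → Alg n (DTree n)
  | [], T => pure T
  | y :: ys, T => do
      let x ← walk y.handle T
      match y.view.find? (fun jb => decide ((jb.1, !jb.2) ∈ x.view)) with
      | some jb => extend ys (insert x y jb.1 jb.2 T)
      | none => extend ys T

end DTree

/-! ### The second phase and the complete algorithm -/

/-- A single iteration of the second phase with the new sample `Y` (given by its handle `iY`). -/
def secondPhaseIteration (n : ℕ) [NeZero n] (m iY : ℕ) (A : List (Elem n)) (T : DTree n) :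
    Alg n (List (Elem n) × DTree n) := do
  let J ← chooseIndices n m
  let X ← T.walk iY
  let rX ← queryAt X.handle J
  let rY ← queryAt iY J
  match rY.find? (fun jb => decide ((jb.1, !jb.2) ∈ rX)) with
  | some jb => pure (A ++ [⟨iY, rY⟩], T.insert X ⟨iY, rY⟩ jb.1 jb.2)
  | none => pure (A, T)

/-- The second phase with `N` iterations. -/
def secondPhase (n : ℕ) [NeZero n] (m : ℕ) : ℕ → List (Elem n) → DTree n → Alg n Bool
  | 0, _, _ => pure true
  | N + 1, A, T => do
      let iY ← Alg.draw Alg.done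
      let (A', T') ← secondPhaseIteration n m iY A T
      if m + 1 ≤ A'.length then pure false else secondPhase n m N A' T'

/-- The adaptive one-sided `ε`-test of `S_m`; the output `true` means accept. -/
def adaptiveTest (n : ℕ) [NeZero n] (ε : ℝ) (m : ℕ) : Alg n Bool :=
  if 1 / (m : ℝ) ^ 2 ≤ ε then nonAdaptiveTest n ε m
  else do
    let iu ← Alg.draw Alg.done
    let res ← firstPhase n ε m [⟨iu, []⟩]
    match res with
    | none => pure false
    | some [] => pure true -- never happens
    | some (x :: A) => do
        let T ← DTree.extend A (DTree.leaf x)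
        secondPhase n m ⌈48 * ε⁻¹⌉₊ (x :: A) T

end HugeObject

end

/-!
The adaptive test is one-sided because it rejects only with `m + 1` different samples at hand. In
the first phase the members of `A` are pairwise distinguished by queried bits (`Inv`). In the second
phase every member of `A` reaches its own leaf of the decision tree, so that a new sample that
differs from the member at the leaf it reaches differs from all the others as well (`TreeInv`).

For an input `P` that is `ε`-far from `S_m`, moving every string to the closest member of a set of
at most `m` strings shows that the mean distance from such a set exceeds `ε` (`lt_mean_of_far`).
Splitting this distance into dyadic scales gives `lt_mean_min_add_sum_farProb`: samples that are
far from the set at some scale are frequent, or most of the distance comes from very close samples.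

All probabilistic estimates rest on one device, the potential `2^(-H)` for the number `H` of
successes: if every step succeeds with probability at least `p`, its expectation shrinks by the
factor `1 - p / 2`. Success probabilities only decrease as `A` grows, so an execution that ends in a
state with a large success probability had at least this probability in all earlier steps.

* Fishing expeditions (`wp_fishing_third_le`): by a union bound over the checkpoints, an expedition
  gives up while batches are still likely to succeed with probability at most `q`. So unless the
  first phase rejects, all scales are covered after it, except with probability `1/4`.
* Second phase (`wp_secondPhase_le`): once all scales are covered, the remaining distance comes
  from samples within about `1/m` of `A`. For these, `m` random indices detect a difference with a
  probability proportional to `m` times the distance, so each iteration succeeds with probability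
  of order `m * ε`, and `48 / ε` iterations find the missing members.
* Non-adaptive test (`ex_greedy_le`): the samples are exchangeable, so they may be examined in the
  order of decreasing `a`, from fine to coarse scales. A sample is kept greedily if it is far at its
  own scale from those already kept; then two kept samples share the index set of the coarser scale,
  which is the scale of the later one, and are far at this scale. More than `m` samples are kept
  with high probability, and all pairs among `m + 1` of them are then likely to be distinguished by
  the random indices (`two_mul_ex_not_pairwise_le`).

The number of queries of the first phase is bounded by charging executions of batches to successes:
an expedition that passes a checkpoint has had a constant fraction of successes, the checkpoints
grow at most by a factor of two, and there are at most `m` successes altogether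
(`always_firstPhaseRounds`).

Algorithms are analyzed with two recursive operators: `Alg.wp`, the expectation over all runs of a
function of the output and the final samples, and `Alg.Always`, which says that all runs satisfy a
postcondition that may also mention the number of queries.
-/

noncomputable section

namespace HugeObject

open scoped ENNReal

/-! ### Expectations -/

/-- Expectation of a nonnegative function under a discrete distribution. -/
def ex {α : Type*} (p : PMF α) (f : α → ℝ≥0∞) : ℝ≥0∞ := ∑' x, p x * f x

section Expectation

variable {α β : Type*}

lemma ex_pure (a : α) (f : α → ℝ≥0∞) : ex (PMF.pure a) f = f a := by
  classical
  unfold ex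
  rw [tsum_eq_single a]
  · simp
  · intro b hb
    simp [PMF.pure_apply, hb]

lemma ex_bind (p : PMF α) (q : α → PMF β) (f : β → ℝ≥0∞) :
    ex (p.bind q) f = ex p fun a => ex (q a) f := by
  unfold ex
  simp only [PMF.bind_apply, ← ENNReal.tsum_mul_right, ← ENNReal.tsum_mul_left]
  rw [ENNReal.tsum_comm]
  simp only [mul_assoc]

lemma ex_map (p : PMF α) (g : α → β) (f : β → ℝ≥0∞) :
    ex (p.map g) f = ex p fun a => f (g a) := by
  simp only [PMF.map, ex_bind, Function.comp, ex_pure]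

lemma ex_mono {p : PMF α} {f g : α → ℝ≥0∞} (h : ∀ x ∈ p.support, f x ≤ g x) :
    ex p f ≤ ex p g := by
  refine ENNReal.tsum_le_tsum fun x => ?_
  by_cases hx : x ∈ p.support
  · exact mul_le_mul_right (h x hx) _
  · simp [(PMF.apply_eq_zero_iff p x).2 hx]

lemma ex_add (p : PMF α) (f g : α → ℝ≥0∞) : ex p (fun x => f x + g x) = ex p f + ex p g := by
  simp only [ex, mul_add, ENNReal.tsum_add]

lemma ex_const_mul (p : PMF α) (c : ℝ≥0∞) (f : α → ℝ≥0∞) :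
    ex p (fun x => c * f x) = c * ex p f := by
  simp only [ex, ← ENNReal.tsum_mul_left]
  exact tsum_congr fun x => by ring

lemma ex_const (p : PMF α) (c : ℝ≥0∞) : ex p (fun _ => c) = c := by
  simp only [ex, ENNReal.tsum_mul_right, p.tsum_coe, one_mul]

lemma ex_comm (p : PMF α) (q : PMF β) (f : α → β → ℝ≥0∞) :
    ex p (fun a => ex q (f a)) = ex q fun b => ex p fun a => f a b := by
  simp only [ex, ← ENNReal.tsum_mul_left]
  rw [ENNReal.tsum_comm]
  exact tsum_congr fun b => tsum_congr fun a => by ring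

open Classical in
/-- The indicator of a proposition. -/
def ind (p : Prop) : ℝ≥0∞ := if p then 1 else 0

lemma ind_of {p : Prop} (h : p) : ind p = 1 := if_pos h

lemma ind_of_not {p : Prop} (h : ¬p) : ind p = 0 := if_neg h

lemma ind_mono {p q : Prop} (h : p → q) : ind p ≤ ind q := by
  by_cases hp : p
  · rw [ind_of hp, ind_of (h hp)]
  · simp [ind_of_not hp]

lemma ind_le_one (p : Prop) : ind p ≤ 1 := by
  by_cases hp : p <;> simp [ind_of, ind_of_not, hp]

lemma ind_or_le (p q : Prop) : ind (p ∨ q) ≤ ind p + ind q := by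
  by_cases hp : p <;> by_cases hq : q <;> simp [ind_of, ind_of_not, hp, hq]

lemma ind_exists_mem_le {ι : Type*} (s : Finset ι) (p : ι → Prop) :
    ind (∃ i ∈ s, p i) ≤ ∑ i ∈ s, ind (p i) := by
  by_cases h : ∃ i ∈ s, p i
  · obtain ⟨i, hi, hp⟩ := h
    rw [ind_of ⟨i, hi, hp⟩, ← ind_of hp]
    exact Finset.single_le_sum (f := fun i => ind (p i)) (fun _ _ => zero_le) hi
  · simp [ind_of_not h]

lemma ex_ind_eq (p : PMF α) (a : α) : ex p (fun x => ind (x = a)) = p a := by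
  unfold ex
  rw [tsum_eq_single a]
  · simp [ind_of]
  · intro b hb
    simp [ind_of_not hb]

end Expectation

/-! ### Expectations and invariants over the runs of an algorithm -/

namespace Alg

variable {n : ℕ} {α β : Type}

/-- The expectation, over the runs of an algorithm on `P` from the sample list `S`, of a function
of the output and of the final list of samples. -/
def wp (P : PMF (Str n)) : Alg n α → (α → List (Str n) → ℝ≥0∞) → List (Str n) → ℝ≥0∞
  | done a, f, S => f a S
  | draw k, f, S => ex P fun x => wp P (k S.length) f (S ++ [x])
  | query i j k, f, S => wp P (k ((S.getD i fun _ => false) j)) f S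
  | toss p k, f, S => ex p fun b => wp P (k b) f S

/-- Every run of an algorithm on `P` from the sample list `S` ends with an output, a list of
samples and a number of queries that satisfy `Q`. -/
def Always (P : PMF (Str n)) :
    Alg n α → (α → List (Str n) → ℕ → Prop) → List (Str n) → Prop
  | done a, Q, S => Q a S 0
  | draw k, Q, S => ∀ x ∈ P.support, Always P (k S.length) Q (S ++ [x])
  | query i j k, Q, S =>
      Always P (k ((S.getD i fun _ => false) j)) (fun a S' c => Q a S' (c + 1)) S
  | toss p k, Q, S => ∀ b ∈ p.support, Always P (k b) Q S

variable {P : PMF (Str n)}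

@[simp] lemma wp_pure (a : α) (f : α → List (Str n) → ℝ≥0∞) (S : List (Str n)) :
    wp P (pure a : Alg n α) f S = f a S := rfl

lemma wp_bind (𝒜 : Alg n α) (g : α → Alg n β) (f : β → List (Str n) → ℝ≥0∞)
    (S : List (Str n)) :
    wp P (𝒜 >>= g) f S = wp P 𝒜 (fun a S' => wp P (g a) f S') S := by
  change wp P (andThen 𝒜 g) f S = _
  induction 𝒜 generalizing S with
  | done a => rfl
  | draw k ih => simp only [andThen, wp, ih]
  | query i j k ih => simp only [andThen, wp, ih]
  | toss p k ih => simp only [andThen, wp, ih]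

@[simp] lemma always_pure (a : α) (Q : α → List (Str n) → ℕ → Prop) (S : List (Str n)) :
    Always P (pure a : Alg n α) Q S ↔ Q a S 0 := Iff.rfl

lemma Always.mono {𝒜 : Alg n α} {Q R : α → List (Str n) → ℕ → Prop} {S : List (Str n)}
    (h : Always P 𝒜 Q S) (hQR : ∀ a S' c, Q a S' c → R a S' c) : Always P 𝒜 R S := by
  induction 𝒜 generalizing S Q R with
  | done a => exact hQR _ _ _ h
  | draw k ih => exact fun x hx => ih _ (h x hx) hQR
  | query i j k ih => exact ih _ h fun a S' c => hQR a S' (c + 1)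
  | toss p k ih => exact fun x hx => ih _ (h x hx) hQR

lemma Always.and {𝒜 : Alg n α} {Q R : α → List (Str n) → ℕ → Prop} {S : List (Str n)}
    (h : Always P 𝒜 Q S) (h' : Always P 𝒜 R S) :
    Always P 𝒜 (fun a S' c => Q a S' c ∧ R a S' c) S := by
  induction 𝒜 generalizing S Q R with
  | done a => exact ⟨h, h'⟩
  | draw k ih => exact fun x hx => ih _ (h x hx) (h' x hx)
  | query i j k ih => exact ih _ h h'
  | toss p k ih => exact fun x hx => ih _ (h x hx) (h' x hx)

lemma always_bind {𝒜 : Alg n α} {g : α → Alg n β} {Q : β → List (Str n) → ℕ → Prop}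
    {S : List (Str n)} :
    Always P (𝒜 >>= g) Q S ↔
      Always P 𝒜 (fun a S' c => Always P (g a) (fun b S'' d => Q b S'' (c + d)) S') S := by
  change Always P (andThen 𝒜 g) Q S ↔ _
  induction 𝒜 generalizing S Q with
  | done a => simp only [andThen, Always, zero_add]
  | draw k ih => simp only [andThen, Always, ih]
  | query i j k ih =>
    simp only [andThen, Always, ih]
    have : ∀ c d : ℕ, c + d + 1 = c + 1 + d := fun c d => by omega
    simp only [this]
  | toss p k ih => simp only [andThen, Always, ih]

lemma wp_mono_of_always {𝒜 : Alg n α} {f g : α → List (Str n) → ℝ≥0∞} {S : List (Str n)}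
    (h : Always P 𝒜 (fun a S' _ => f a S' ≤ g a S') S) : wp P 𝒜 f S ≤ wp P 𝒜 g S := by
  induction 𝒜 generalizing S with
  | done a => exact h
  | draw k ih => exact ex_mono fun x hx => ih _ (h x hx)
  | query i j k ih => exact ih _ h
  | toss p k ih => exact ex_mono fun x hx => ih _ (h x hx)

lemma always_of_forall {Q : α → List (Str n) → ℕ → Prop} (h : ∀ a S c, Q a S c) (𝒜 : Alg n α)
    (S : List (Str n)) : Always P 𝒜 Q S := by
  induction 𝒜 generalizing S Q with
  | done a => exact h _ _ _
  | draw k ih => exact fun x _ => ih _ h _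
  | query i j k ih => exact ih _ (fun a S c => h a S (c + 1)) _
  | toss p k ih => exact fun x _ => ih _ h _

lemma wp_mono {𝒜 : Alg n α} {f g : α → List (Str n) → ℝ≥0∞} (S : List (Str n))
    (h : ∀ a S', f a S' ≤ g a S') : wp P 𝒜 f S ≤ wp P 𝒜 g S :=
  wp_mono_of_always (always_of_forall (fun a S' _ => h a S') _ _)

lemma wp_add (𝒜 : Alg n α) (f g : α → List (Str n) → ℝ≥0∞) (S : List (Str n)) :
    wp P 𝒜 (fun a S' => f a S' + g a S') S = wp P 𝒜 f S + wp P 𝒜 g S := by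
  induction 𝒜 generalizing S with
  | done a => rfl
  | draw k ih => simp only [wp, ih, ex_add]
  | query i j k ih => simp only [wp, ih]
  | toss p k ih => simp only [wp, ih, ex_add]

lemma wp_const_mul (𝒜 : Alg n α) (c : ℝ≥0∞) (f : α → List (Str n) → ℝ≥0∞)
    (S : List (Str n)) : wp P 𝒜 (fun a S' => c * f a S') S = c * wp P 𝒜 f S := by
  induction 𝒜 generalizing S with
  | done a => rfl
  | draw k ih => simp only [wp, ih, ex_const_mul]
  | query i j k ih => simp only [wp, ih]
  | toss p k ih => simp only [wp, ih, ex_const_mul]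

lemma wp_const (𝒜 : Alg n α) (c : ℝ≥0∞) (S : List (Str n)) :
    wp P 𝒜 (fun _ _ => c) S = c := by
  induction 𝒜 generalizing S with
  | done a => rfl
  | draw k ih => simp only [wp, ih, ex_const]
  | query i j k ih => simp only [wp, ih]
  | toss p k ih => simp only [wp, ih, ex_const]

lemma wp_le_wp_add_const {𝒜 : Alg n α} {f g : α → List (Str n) → ℝ≥0∞} {c : ℝ≥0∞}
    {S : List (Str n)} (h : Always P 𝒜 (fun a S' _ => f a S' ≤ g a S' + c) S) :
    wp P 𝒜 f S ≤ wp P 𝒜 g S + c := by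
  refine (wp_mono_of_always h).trans_eq ?_
  rw [wp_add, wp_const]

lemma ex_run (𝒜 : Alg n α) (f : α → ℝ≥0∞) (S : List (Str n)) :
    ex (run P 𝒜 S) (fun o => f o.1) = wp P 𝒜 (fun a _ => f a) S := by
  induction 𝒜 generalizing S with
  | done a => simp only [run, ex_pure, wp]
  | draw k ih => simp only [run, ex_bind, wp, ih]
  | query i j k ih => simp only [run, ex_map, wp, ih]
  | toss p k ih => simp only [run, ex_bind, wp, ih]

lemma output_apply (𝒜 : Alg n α) (a : α) :
    𝒜.output P a = wp P 𝒜 (fun b _ => ind (b = a)) [] := by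
  rw [← ex_run 𝒜 fun b => ind (b = a), output, ← ex_ind_eq, ex_map]

lemma always_run {𝒜 : Alg n α} {Q : α → ℕ → Prop} {S : List (Str n)}
    (h : Always P 𝒜 (fun a _ c => Q a c) S) : ∀ o ∈ (run P 𝒜 S).support, Q o.1 o.2 := by
  induction 𝒜 generalizing S Q with
  | done a =>
    intro o ho
    simp only [run, PMF.support_pure, Set.mem_singleton_iff] at ho
    subst ho
    exact h
  | draw k ih =>
    intro o ho
    simp only [run, PMF.mem_support_bind_iff] at ho
    obtain ⟨x, hx, ho⟩ := ho
    exact ih _ (h x hx) o ho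
  | query i j k ih =>
    intro o ho
    simp only [run, PMF.mem_support_map_iff] at ho
    obtain ⟨o', ho', rfl⟩ := ho
    exact ih _ (Q := fun a c => Q a (c + 1)) h o' ho'
  | toss p k ih =>
    intro o ho
    simp only [run, PMF.mem_support_bind_iff] at ho
    obtain ⟨x, hx, ho⟩ := ho
    exact ih _ (h x hx) o ho

/-- An algorithm is a one-sided test if a rejecting run shows that `P` is not in the property, and
the expectation of acceptance is below `1/3` for inputs that are far from it. -/
lemma isOneSidedTest_of_wp {𝒜 : Alg n Bool} {ε : ℝ} {𝒬 : Set (PMF (Str n))}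
    (h₁ : ∀ P ∈ 𝒬, Always P 𝒜 (fun b _ _ => b = true) [])
    (h₂ : ∀ P, ε < distToProperty P 𝒬 →
      wp P 𝒜 (fun b _ => ind (b = true)) [] < 1 / 3) :
    𝒜.IsOneSidedTest ε 𝒬 := by
  refine ⟨fun P hP => ?_, fun P hP => ?_⟩
  · rw [output_apply]
    refine le_antisymm ?_ ?_
    · exact (wp_mono _ fun b _ => ind_le_one _).trans_eq (wp_const 𝒜 1 [])
    · exact (wp_const 𝒜 1 []).symm.trans_le
        (wp_mono_of_always ((h₁ P hP).mono fun b _ _ hb => by simp [hb, ind_of]))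
  · rw [output_apply]
    have h := h₂ P hP
    have h1 : wp P 𝒜 (fun b _ => ind (b = true)) [] +
        wp P 𝒜 (fun b _ => ind (b = false)) [] = 1 := by
      rw [← wp_add]
      refine Eq.trans ?_ (wp_const (P := P) 𝒜 1 [])
      congr 1
      funext b _
      cases b <;> simp [ind_of, ind_of_not]
    have h3 : (1 : ℝ≥0∞) = 1 / 3 + 2 / 3 := by
      rw [← ENNReal.add_div, show (1 : ℝ≥0∞) + 2 = 3 by norm_num, ENNReal.div_self] <;> norm_num
    by_contra hcon
    rw [not_lt] at hcon
    have := ENNReal.add_lt_add_of_lt_of_le (ne_top_of_le_ne_top (by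
      exact (ENNReal.div_lt_top (by norm_num) (by norm_num)).ne) hcon) h hcon
    rw [h1, ← h3] at this
    exact lt_irrefl _ this

end Alg

/-! ### Distance from bounded support -/

section Distance

variable {n : ℕ}

/-- Expectation of a real function of a random string. -/
def mean (P : PMF (Str n)) (g : Str n → ℝ) : ℝ := ∑ v, (P v).toReal * g v

lemma sum_toReal (P : PMF (Str n)) : ∑ v, (P v).toReal = 1 := by
  rw [← ENNReal.toReal_sum fun v _ => P.apply_ne_top v, ← tsum_fintype (L := .unconditional _),
    P.tsum_coe, ENNReal.toReal_one]

lemma mean_const (P : PMF (Str n)) (c : ℝ) : mean P (fun _ => c) = c := by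
  rw [mean, ← Finset.sum_mul, sum_toReal, one_mul]

lemma mean_mono (P : PMF (Str n)) {f g : Str n → ℝ} (h : ∀ v, f v ≤ g v) :
    mean P f ≤ mean P g :=
  Finset.sum_le_sum fun v _ => mul_le_mul_of_nonneg_left (h v) ENNReal.toReal_nonneg

lemma mean_add (P : PMF (Str n)) (f g : Str n → ℝ) :
    mean P (fun v => f v + g v) = mean P f + mean P g := by
  simp only [mean, mul_add, Finset.sum_add_distrib]

lemma mean_const_mul (P : PMF (Str n)) (c : ℝ) (f : Str n → ℝ) :
    mean P (fun v => c * f v) = c * mean P f := by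
  simp only [mean, Finset.mul_sum]
  exact Finset.sum_congr rfl fun v _ => by ring

lemma mean_sum {ι : Type*} (P : PMF (Str n)) (s : Finset ι) (f : ι → Str n → ℝ) :
    mean P (fun v => ∑ i ∈ s, f i v) = ∑ i ∈ s, mean P (f i) := by
  simp only [mean, Finset.mul_sum]
  exact Finset.sum_comm

lemma ex_ofReal (P : PMF (Str n)) {g : Str n → ℝ} (hg : ∀ v, 0 ≤ g v) :
    ex P (fun v => ENNReal.ofReal (g v)) = ENNReal.ofReal (mean P g) := by
  rw [ex, tsum_fintype, mean,
    ENNReal.ofReal_sum_of_nonneg fun v _ => mul_nonneg ENNReal.toReal_nonneg (hg v)]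
  refine Finset.sum_congr rfl fun v _ => ?_
  rw [ENNReal.ofReal_mul ENNReal.toReal_nonneg, ENNReal.ofReal_toReal (P.apply_ne_top v)]

lemma strDist_nonneg (u v : Str n) : 0 ≤ strDist u v := by unfold strDist; positivity

lemma strDist_le_one (u v : Str n) : strDist u v ≤ 1 := by
  unfold strDist
  refine div_le_one_of_le₀ ?_ (by positivity)
  exact_mod_cast (hammingDist_le_card_fintype (x := u) (y := v)).trans (by simp)

lemma transferCost_nonneg (T : PMF (Str n × Str n)) : 0 ≤ transferCost T :=
  Finset.sum_nonneg fun _ _ => mul_nonneg ENNReal.toReal_nonneg (strDist_nonneg _ _)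

lemma emd_nonneg (P Q : PMF (Str n)) : 0 ≤ emd P Q :=
  Real.sInf_nonneg fun _ ⟨T, _, hc⟩ => hc ▸ transferCost_nonneg T

lemma exists_near {A : Finset (Str n)} (hA : A.Nonempty) :
    ∃ near : Str n → Str n, (∀ v, near v ∈ A) ∧
      ∀ v, ∀ x ∈ A, strDist v (near v) ≤ strDist v x := by
  have h : ∀ v, ∃ y ∈ A, ∀ x ∈ A, strDist v y ≤ strDist v x := fun v =>
    A.exists_min_image (strDist v) hA
  choose near h1 h2 using h
  exact ⟨near, h1, h2⟩

/-- Moving every string to a set of at most `m` strings costs at least the distance from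
`S_m`. -/
lemma lt_mean_of_far {P : PMF (Str n)} {m : ℕ} {ε : ℝ}
    (hP : ε < distToProperty P (boundedSupport n m)) {A : Finset (Str n)} (hA : A.card ≤ m)
    {near : Str n → Str n} (hnear : ∀ v, near v ∈ A) :
    ε < mean P fun v => strDist v (near v) := by
  refine hP.trans_le ?_
  have hQ : P.map near ∈ boundedSupport n m := by
    refine le_trans ?_ hA
    rw [← Set.ncard_coe_finset]
    refine Set.ncard_le_ncard ?_ A.finite_toSet
    rw [PMF.support_map]
    rintro _ ⟨v, -, rfl⟩
    exact hnear v
  have h1 : distToProperty P (boundedSupport n m) ≤ emd P (P.map near) :=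
    csInf_le ⟨0, by rintro _ ⟨Q, -, rfl⟩; exact emd_nonneg _ _⟩ ⟨_, hQ, rfl⟩
  refine h1.trans ?_
  have h2 : emd P (P.map near) ≤ transferCost (P.map fun v => (v, near v)) := by
    refine csInf_le ⟨0, ?_⟩ ⟨_, ⟨?_, ?_⟩, rfl⟩
    · rintro _ ⟨T, -, rfl⟩
      exact transferCost_nonneg _
    · rw [PMF.map_comp]
      exact P.map_id
    · rw [PMF.map_comp]
      rfl
  refine h2.trans (le_of_eq ?_)
  have h3 : ex (P.map fun v => (v, near v)) (fun w => ENNReal.ofReal (strDist w.1 w.2)) =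
      ENNReal.ofReal (transferCost (P.map fun v => (v, near v))) := by
    rw [ex, tsum_fintype, transferCost, ENNReal.ofReal_sum_of_nonneg fun _ _ =>
      mul_nonneg ENNReal.toReal_nonneg (strDist_nonneg _ _)]
    refine Finset.sum_congr rfl fun w _ => ?_
    rw [ENNReal.ofReal_mul ENNReal.toReal_nonneg, ENNReal.ofReal_toReal (PMF.apply_ne_top _ w)]
  rw [ex_map, ex_ofReal P fun v => strDist_nonneg _ _] at h3
  refine ((ENNReal.ofReal_eq_ofReal_iff ?_ (transferCost_nonneg _)).1 h3).symm
  exact Finset.sum_nonneg fun _ _ => mul_nonneg ENNReal.toReal_nonneg (strDist_nonneg _ _)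

/-- At scale `a`, the string `v` is far from the set `A`: its distance from every member of `A`
exceeds `2^(-a-1)`. -/
def Far (a : ℕ) (A : Finset (Str n)) (v : Str n) : Prop :=
  ∀ x ∈ A, (1 / 2 : ℝ) ^ (a + 1) < strDist v x

open Classical in
/-- The probability that a sample of `P` is far from `A` at scale `a`. -/
def farProb (P : PMF (Str n)) (a : ℕ) (A : Finset (Str n)) : ℝ :=
  mean P fun v => if Far a A v then 1 else 0

lemma farProb_nonneg (P : PMF (Str n)) (a : ℕ) (A : Finset (Str n)) : 0 ≤ farProb P a A :=
  Finset.sum_nonneg fun v _ => mul_nonneg ENNReal.toReal_nonneg (by positivity)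

lemma farProb_le_one (P : PMF (Str n)) (a : ℕ) (A : Finset (Str n)) : farProb P a A ≤ 1 := by
  refine (mean_mono P fun v => ?_).trans_eq (mean_const P 1)
  split_ifs <;> simp

lemma farProb_anti (P : PMF (Str n)) (a : ℕ) {A B : Finset (Str n)} (h : A ⊆ B) :
    farProb P a B ≤ farProb P a A := by
  refine mean_mono P fun v => ?_
  have : Far a B v → Far a A v := fun hv x hx => hv x (h hx)
  split_ifs <;> simp_all

/-- A distance is the sum of its dyadic layers above a cutoff. -/
lemma le_min_add_sum_layers {d : ℝ} (hd : d ≤ 1) (K : ℕ) :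
    d ≤ min d ((1 / 2) ^ K) +
      ∑ a ∈ Finset.range K, (1 / 2 : ℝ) ^ (a + 1) * if (1 / 2 : ℝ) ^ (a + 1) < d then 1 else 0 := by
  induction K with
  | zero => simp [hd]
  | succ K ih =>
    rw [Finset.sum_range_succ]
    have h : min d ((1 / 2 : ℝ) ^ K) ≤ min d ((1 / 2) ^ (K + 1)) +
        (1 / 2 : ℝ) ^ (K + 1) * if (1 / 2 : ℝ) ^ (K + 1) < d then 1 else 0 := by
      have h2 : (1 / 2 : ℝ) ^ K = (1 / 2) ^ (K + 1) + (1 / 2) ^ (K + 1) := by ring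
      split_ifs with hd
      · rw [min_eq_right hd.le, mul_one, ← h2]
        exact min_le_right _ _
      · rw [min_eq_left (not_lt.1 hd), mul_zero, add_zero]
        exact min_le_left _ _
    linarith

/-- If `P` is `ε`-far from `S_m`, then for every nonempty set `A` of at most `m` strings, more
than `ε` is contributed by the distances from `A`, truncated at `2^(-K)`, together with the samples
that are far from `A` at one of the scales below `K`. -/
lemma lt_mean_min_add_sum_farProb {P : PMF (Str n)} {m : ℕ} {ε : ℝ}
    (hP : ε < distToProperty P (boundedSupport n m)) {A : Finset (Str n)} (hA : A.card ≤ m)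
    {near : Str n → Str n} (hnear : ∀ v, near v ∈ A)
    (hmin : ∀ v, ∀ x ∈ A, strDist v (near v) ≤ strDist v x) (K : ℕ) :
    ε < mean P (fun v => min (strDist v (near v)) ((1 / 2) ^ K)) +
      ∑ a ∈ Finset.range K, (1 / 2 : ℝ) ^ (a + 1) * farProb P a A := by
  refine (lt_mean_of_far hP hA hnear).trans_le ?_
  refine (mean_mono P fun v => le_min_add_sum_layers (strDist_le_one v (near v)) K).trans_eq ?_
  rw [mean_add, mean_sum]
  congr 1
  refine Finset.sum_congr rfl fun a _ => ?_
  rw [mean_const_mul, farProb]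
  congr! 4 with v
  exact ⟨fun h x hx => h.trans_le (hmin v x hx), fun h => h _ (hnear v)⟩

end Distance

/-! ### Independent choices -/

section IID

variable {n : ℕ} {α : Type}

/-- A list of `N` independent elements, each distributed as `p`. -/
def iid (p : PMF α) : ℕ → PMF (List α)
  | 0 => PMF.pure []
  | N + 1 => p.bind fun x => (iid p N).map (x :: ·)

lemma length_of_mem_support_iid {p : PMF α} {N : ℕ} {l : List α} (h : l ∈ (iid p N).support) :
    l.length = N := by
  induction N generalizing l with
  | zero => simp_all [iid]
  | succ N ih =>
    simp only [iid, PMF.mem_support_bind_iff, PMF.mem_support_map_iff] at h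
    obtain ⟨x, -, l', hl', rfl⟩ := h
    simp [ih hl']

/-- The first `k` of `N` independent choices all satisfy `Q` with the `k`-th power of the
probability of `Q`. -/
lemma ex_iid_forall_take (p : PMF α) (Q : α → Prop) {k N : ℕ} (h : k ≤ N) :
    ex (iid p N) (fun l => ind (∀ x ∈ l.take k, Q x)) =
      (ex p fun x => ind (Q x)) ^ k := by
  induction N generalizing k with
  | zero =>
    obtain rfl : k = 0 := by omega
    simp [ex_const, ind_of, iid]
  | succ N ih =>
    cases k with
    | zero => simp [ex_const, ind_of, iid]
    | succ k =>
      have h1 : ∀ x, ex ((iid p N).map (x :: ·))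
          (fun l => ind (∀ y ∈ l.take (k + 1), Q y)) =
          (ex p fun x => ind (Q x)) ^ k * ind (Q x) := by
        intro x
        rw [ex_map, ← ih (by omega : k ≤ N)]
        by_cases hx : Q x <;> simp [hx, ex_const, ind_of, ind_of_not]
      rw [iid, ex_bind]
      simp only [h1]
      rw [ex_const_mul, pow_succ]

/-- A uniform index does not separate two strings with probability `1 - strDist x y`. -/
lemma ex_uniform_eq [NeZero n] (x y : Str n) :
    ex (PMF.uniformOfFintype (Fin n)) (fun j => ind (x j = y j)) =
      ENNReal.ofReal (1 - strDist x y) := by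
  have hn : (0 : ℝ) < n := by exact_mod_cast NeZero.pos n
  have hle : hammingDist x y ≤ n := by
    simpa using hammingDist_le_card_fintype (x := x) (y := y)
  have hcard : (Finset.univ.filter fun j => x j = y j).card = n - hammingDist x y := by
    have := Finset.card_filter_add_card_filter_not (s := (Finset.univ : Finset (Fin n)))
      (fun j => x j = y j)
    simp only [Finset.card_univ, Fintype.card_fin] at this
    have h2 : hammingDist x y = (Finset.univ.filter fun j => ¬ x j = y j).card := rfl
    omega
  have h1 : 1 - strDist x y = ((n - hammingDist x y : ℕ) : ℝ) / n := by
    rw [strDist, Nat.cast_sub hle]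
    field_simp
  rw [ex, tsum_fintype, h1, ENNReal.ofReal_div_of_pos hn, ENNReal.ofReal_natCast,
    ENNReal.ofReal_natCast]
  simp only [ind, PMF.uniformOfFintype_apply, Fintype.card_fin, mul_ite, mul_one, mul_zero]
  rw [← Finset.sum_filter, Finset.sum_const, hcard, nsmul_eq_mul, div_eq_mul_inv]

lemma ofReal_one_sub_pow_le {d : ℝ} (hd : d ≤ 1) (k : ℕ) :
    ENNReal.ofReal (1 - d) ^ k ≤ ENNReal.ofReal (Real.exp (-(d * k))) := by
  rw [← ENNReal.ofReal_pow (by linarith)]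
  refine ENNReal.ofReal_le_ofReal ?_
  calc (1 - d) ^ k ≤ Real.exp (-d) ^ k := by
        refine pow_le_pow_left₀ (by linarith) ?_ k
        have := Real.add_one_le_exp (-d)
        linarith
    _ = Real.exp (-(d * k)) := by rw [← Real.exp_nat_mul]; congr 1; ring

/-- Among `N` uniform indices, the first `k` do not separate two strings at distance more than
`δ` with probability at most `exp (-δ k)`. -/
lemma ex_iid_agree_le [NeZero n] {x y : Str n} {δ : ℝ} (hδ : δ ≤ strDist x y) {k N : ℕ}
    (h : k ≤ N) :
    ex (iid (PMF.uniformOfFintype (Fin n)) N)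
      (fun J => ind (∀ j ∈ J.take k, x j = y j)) ≤
      ENNReal.ofReal (Real.exp (-(δ * k))) := by
  rw [ex_iid_forall_take _ (fun j => x j = y j) h]
  rw [ex_uniform_eq]
  refine (ofReal_one_sub_pow_le (strDist_le_one x y) k).trans (ENNReal.ofReal_le_ofReal ?_)
  exact Real.exp_le_exp.2 (neg_le_neg (mul_le_mul_of_nonneg_right hδ (Nat.cast_nonneg k)))

end IID

open Alg

/-! ### Elementary subroutines -/

section Subroutines

variable {n : ℕ} {P : PMF (Str n)}

/-- The string of the sample with handle `i`. -/
def str (S : List (Str n)) (i : ℕ) : Str n := S.getD i fun _ => false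

/-- The restriction of a string to a sequence of indices. -/
def restr (J : List (Fin n)) (x : Str n) : List (Fin n × Bool) := J.map fun j => (j, x j)

/-- The elements that result from querying the samples `xs` at `J`, the first handle being
`k`. -/
def sampleElems (J : List (Fin n)) : ℕ → List (Str n) → List (Elem n)
  | _, [] => []
  | k, x :: xs => ⟨k, restr J x⟩ :: sampleElems J (k + 1) xs

lemma str_append_left {S : List (Str n)} {i : ℕ} (h : i < S.length) (xs : List (Str n)) :
    str (S ++ xs) i = str S i := List.getD_append _ _ _ _ h

lemma str_append_length (S : List (Str n)) (x : Str n) : str (S ++ [x]) S.length = x := by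
  simp [str]

lemma mem_restr {J : List (Fin n)} {x : Str n} {jb : Fin n × Bool} :
    jb ∈ restr J x ↔ jb.1 ∈ J ∧ jb.2 = x jb.1 := by
  simp only [restr, List.mem_map]
  constructor
  · rintro ⟨j, hj, rfl⟩
    exact ⟨hj, rfl⟩
  · rintro ⟨h1, h2⟩
    exact ⟨jb.1, h1, by rw [← h2]⟩

lemma restr_eq_iff {J : List (Fin n)} {x y : Str n} :
    restr J x = restr J y ↔ ∀ j ∈ J, x j = y j := by
  simp [restr, List.map_inj_left]

lemma map_view_sampleElems (J : List (Fin n)) (k : ℕ) (xs : List (Str n)) :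
    (sampleElems J k xs).map Elem.view = xs.map (restr J) := by
  induction xs generalizing k with
  | nil => rfl
  | cons x xs ih => simp [sampleElems, ih]

lemma of_mem_sampleElems {J : List (Fin n)} (S : List (Str n)) {xs : List (Str n)} {Y : Elem n}
    (h : Y ∈ sampleElems J S.length xs) :
    Y.handle < (S ++ xs).length ∧ Y.view = restr J (str (S ++ xs) Y.handle) := by
  induction xs generalizing S with
  | nil => simp [sampleElems] at h
  | cons x xs ih =>
    simp only [sampleElems, List.mem_cons] at h
    rcases h with rfl | h
    · simp [str]
    · have := ih (S ++ [x]) (by simpa using h)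
      simpa using this

lemma wp_draw (f : ℕ → List (Str n) → ℝ≥0∞) (S : List (Str n)) :
    wp P (draw done) f S = ex P fun x => f S.length (S ++ [x]) := rfl

lemma always_draw {Q : ℕ → List (Str n) → ℕ → Prop} {S : List (Str n)} :
    Always P (draw done) Q S ↔ ∀ x ∈ P.support, Q S.length (S ++ [x]) 0 := Iff.rfl

lemma wp_chooseIndices [NeZero n] (N : ℕ) (f : List (Fin n) → List (Str n) → ℝ≥0∞)
    (S : List (Str n)) :
    wp P (chooseIndices n N) f S =
      ex (iid (PMF.uniformOfFintype (Fin n)) N) fun J => f J S := by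
  induction N generalizing f with
  | zero => simp [chooseIndices, iid, ex_pure]
  | succ N ih => simp only [chooseIndices, wp_bind, wp, ih, iid, ex_bind, ex_map, wp_pure]

lemma always_chooseIndices [NeZero n] {N : ℕ} {Q : List (Fin n) → List (Str n) → ℕ → Prop}
    {S : List (Str n)} (h : ∀ J : List (Fin n), J.length = N → Q J S 0) :
    Always P (chooseIndices n N) Q S := by
  induction N generalizing Q with
  | zero => exact h [] rfl
  | succ N ih =>
    simp only [chooseIndices, always_bind, Always, always_pure]
    exact fun j _ => ih fun J hJ => h (j :: J) (by simp [hJ])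

lemma wp_queryAt (i : ℕ) (J : List (Fin n)) (f : List (Fin n × Bool) → List (Str n) → ℝ≥0∞)
    (S : List (Str n)) : wp P (queryAt i J) f S = f (restr J (str S i)) S := by
  induction J generalizing f with
  | nil => rfl
  | cons j J ih => simp only [queryAt, wp_bind, wp, ih, wp_pure]; rfl

lemma always_queryAt {i : ℕ} {J : List (Fin n)}
    {Q : List (Fin n × Bool) → List (Str n) → ℕ → Prop} {S : List (Str n)} :
    Always P (queryAt i J) Q S ↔ Q (restr J (str S i)) S J.length := by
  induction J generalizing Q with
  | nil => rfl
  | cons j J ih =>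
    simp only [queryAt, always_bind, Always, ih, always_pure]
    simp only [List.length_cons, restr, List.map_cons, str, zero_add, add_zero,
      Nat.add_comm 1 J.length]

lemma wp_takeSamples (J : List (Fin n)) (N : ℕ) (f : List (Elem n) → List (Str n) → ℝ≥0∞)
    (S : List (Str n)) :
    wp P (takeSamples J N) f S =
      ex (iid P N) fun xs => f (sampleElems J S.length xs) (S ++ xs) := by
  induction N generalizing f S with
  | zero => simp [takeSamples, iid, ex_pure, sampleElems]
  | succ N ih =>
    simp only [takeSamples, wp_bind, wp_draw, wp_queryAt, ih, iid, ex_bind, ex_map, wp_pure,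
      sampleElems, str_append_length, List.append_assoc, List.cons_append, List.nil_append,
      List.length_append, List.length_cons, List.length_nil, zero_add]

lemma always_takeSamples {J : List (Fin n)} {N : ℕ}
    {Q : List (Elem n) → List (Str n) → ℕ → Prop} {S : List (Str n)}
    (h : ∀ xs : List (Str n), xs.length = N → (∀ x ∈ xs, x ∈ P.support) →
      Q (sampleElems J S.length xs) (S ++ xs) (N * J.length)) :
    Always P (takeSamples J N) Q S := by
  induction N generalizing Q S with
  | zero =>
    rw [takeSamples, always_pure]
    simpa [sampleElems] using h [] rfl (by simp)
  | succ N ih =>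
    simp only [takeSamples, always_bind, always_draw, always_queryAt, always_pure]
    refine fun x hx => ih fun xs hl hxs => ?_
    have := h (x :: xs) (by simp [hl]) (List.forall_mem_cons.2 ⟨hx, hxs⟩)
    rw [sampleElems] at this
    simp only [str_append_length, List.append_assoc, List.cons_append,
      List.nil_append, List.length_append, List.length_cons, List.length_nil, zero_add]
    convert this using 1
    rw [Nat.add_zero, Nat.add_mul, one_mul, Nat.add_comm]

lemma wp_queryEach (J : List (Fin n)) (A : List (Elem n))
    (f : List (List (Fin n × Bool)) → List (Str n) → ℝ≥0∞) (S : List (Str n)) :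
    wp P (queryEach J A) f S = f (A.map fun X => restr J (str S X.handle)) S := by
  induction A generalizing f with
  | nil => rfl
  | cons X A ih => simp only [queryEach, wp_bind, wp_queryAt, ih, wp_pure, List.map_cons]

lemma always_queryEach {J : List (Fin n)} {A : List (Elem n)}
    {Q : List (List (Fin n × Bool)) → List (Str n) → ℕ → Prop} {S : List (Str n)} :
    Always P (queryEach J A) Q S ↔
      Q (A.map fun X => restr J (str S X.handle)) S (A.length * J.length) := by
  induction A generalizing Q with
  | nil => simp [queryEach]
  | cons X A ih =>
    simp only [queryEach, always_bind, always_queryAt, ih, always_pure]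
    simp only [List.length_cons, List.map_cons, add_zero, Nat.add_mul, one_mul,
      Nat.add_comm J.length]

end Subroutines

/-! ### Decision trees -/

namespace DTree

variable {n : ℕ} {P : PMF (Str n)}

/-- The member at the leaf that is reached by a string. -/
def eval : DTree n → Str n → Elem n
  | leaf x, _ => x
  | node j l r, s => if s j then eval r s else eval l s

/-- The largest number of queries on a path from the root to a leaf. -/
def depth : DTree n → ℕ
  | leaf _ => 0
  | node _ l r => max (depth l) (depth r) + 1

lemma wp_walk (i : ℕ) (T : DTree n) (f : Elem n → List (Str n) → ℝ≥0∞) (S : List (Str n)) :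
    wp P (walk i T) f S = f (eval T (str S i)) S := by
  induction T with
  | leaf x => rfl
  | node j l r ihl ihr =>
    simp only [walk, wp_bind, wp, eval]
    cases h : str S i j <;> simp only [str] at h <;> simp only [h] <;> simp [ihl, ihr]

lemma always_walk {i : ℕ} {T : DTree n} {Q : Elem n → List (Str n) → ℕ → Prop}
    {S : List (Str n)} (h : ∀ c ≤ T.depth, Q (eval T (str S i)) S c) :
    Always P (walk i T) Q S := by
  induction T generalizing Q with
  | leaf x => exact h 0 le_rfl
  | node j l r ihl ihr =>
    simp only [walk, always_bind, Always]
    simp only [eval, depth] at h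
    cases hs : str S i j <;> simp only [hs] at h <;> simp only [str] at hs <;> simp only [hs]
    · exact ihl fun c hc => h _ (by omega)
    · exact ihr fun c hc => h _ (by omega)

lemma eval_insert (x y : Elem n) (j : Fin n) (b : Bool) (T : DTree n) (s : Str n) :
    eval (insert x y j b T) s =
      if (eval T s).handle = x.handle then (if s j = b then y else eval T s) else eval T s := by
  induction T with
  | leaf z =>
    simp only [insert, eval]
    cases b <;> cases h : s j <;> split_ifs <;> simp_all [eval]
  | node i l r ihl ihr =>
    simp only [insert, eval]
    split_ifs <;> simp_all

lemma depth_insert_le (x y : Elem n) (j : Fin n) (b : Bool) (T : DTree n) :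
    depth (insert x y j b T) ≤ depth T + 1 := by
  induction T with
  | leaf z =>
    simp only [insert]
    split_ifs <;> simp [depth]
  | node i l r ihl ihr =>
    simp only [insert, depth]
    omega

end DTree

/-! ### Batches -/

section Batch

variable {n : ℕ} {P : PMF (Str n)}

/-- The strings of the samples in `A`. -/
def strs (S : List (Str n)) (A : List (Elem n)) : List (Str n) := A.map fun X => str S X.handle

/-- The invariant of the first phase: all samples come from `P`, the members of `A` carry correct
answers, and any two of them are distinguished by the answers. -/
structure Inv (P : PMF (Str n)) (S : List (Str n)) (A : List (Elem n)) : Prop where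
  support : ∀ x ∈ S, x ∈ P.support
  handle_lt : ∀ X ∈ A, X.handle < S.length
  view : ∀ X ∈ A, ∀ jb ∈ X.view, jb.2 = str S X.handle jb.1
  distinct : A.Pairwise Elem.Distinguished

lemma str_mem_support {S : List (Str n)} (hS : ∀ x ∈ S, x ∈ P.support) {i : ℕ}
    (hi : i < S.length) : str S i ∈ P.support := by
  rw [str, List.getD_eq_getElem _ _ hi]
  exact hS _ (List.getElem_mem hi)

lemma Elem.Distinguished.symm {X Y : Elem n} (h : X.Distinguished Y) : Y.Distinguished X := by
  obtain ⟨j, b, h1, h2⟩ := h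
  exact ⟨j, !b, h2, by simpa using h1⟩

lemma Inv.nodup_strs {S : List (Str n)} {A : List (Elem n)} (h : Inv P S A) :
    (strs S A).Nodup := by
  rw [strs, List.Nodup, List.pairwise_map]
  refine h.distinct.imp_of_mem fun {X Y} hX hY => ?_
  rintro ⟨j, b, h1, h2⟩ heq
  have h3 := h.view X hX _ h1
  have h4 := h.view Y hY _ h2
  rw [← heq, ← h3] at h4
  simp at h4

lemma Inv.strs_mem_support {S : List (Str n)} {A : List (Elem n)} (h : Inv P S A) :
    ∀ x ∈ strs S A, x ∈ P.support := by
  intro x hx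
  obtain ⟨X, hX, rfl⟩ := List.mem_map.1 hx
  exact str_mem_support h.support (h.handle_lt X hX)

/-- More than `m` different samples refute membership in `S_m`. -/
lemma notMem_boundedSupport {m : ℕ} {l : List (Str n)} (hl : l.Nodup)
    (hP : ∀ x ∈ l, x ∈ P.support) (hm : m + 1 ≤ l.length) : P ∉ boundedSupport n m := by
  intro h
  have h1 : (l.toFinset : Set (Str n)).ncard ≤ P.support.ncard :=
    Set.ncard_le_ncard (fun x hx => hP x (by simpa using hx)) (Set.toFinite _)
  rw [Set.ncard_coe_finset, List.toFinset_card_of_nodup hl] at h1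
  have h2 : P.support.ncard ≤ m := h
  omega

lemma Inv.notMem_boundedSupport {S : List (Str n)} {A : List (Elem n)} (h : Inv P S A) {m : ℕ}
    (hm : m + 1 ≤ A.length) : P ∉ boundedSupport n m :=
  HugeObject.notMem_boundedSupport h.nodup_strs h.strs_mem_support (by simpa [strs] using hm)

/-- The members of `A` after they have been queried at `J`, in addition to earlier queries. -/
def requery (S : List (Str n)) (J : List (Fin n)) (A : List (Elem n)) : List (Elem n) :=
  A.map fun X => ⟨X.handle, X.view ++ restr J (str S X.handle)⟩

lemma zipWith_eq_requery (S : List (Str n)) (J : List (Fin n)) (A : List (Elem n)) :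
    List.zipWith (fun X r => (⟨X.handle, X.view ++ r⟩ : Elem n)) A
      (A.map fun X => restr J (str S X.handle)) = requery S J A := by
  rw [requery, List.zipWith_map_right, List.zipWith_self]

lemma restr_mem_map_iff {S : List (Str n)} {J : List (Fin n)} {A : List (Elem n)} {x : Str n} :
    restr J x ∈ A.map (fun X => restr J (str S X.handle)) ↔
      ∃ y ∈ strs S A, ∀ j ∈ J, x j = y j := by
  simp only [strs, List.mem_map, exists_exists_and_eq_and]
  exact exists_congr fun X => and_congr_right fun _ => by rw [eq_comm, restr_eq_iff]

lemma strs_requery_append {S : List (Str n)} {A : List (Elem n)}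
    (hA : ∀ X ∈ A, X.handle < S.length) (J : List (Fin n)) (xs : List (Str n)) :
    strs (S ++ xs) (requery S J A) = strs S A := by
  rw [strs, requery, strs, List.map_map]
  exact List.map_congr_left fun X hX => str_append_left (hA X hX) xs

lemma Inv.requery_append {S : List (Str n)} {A : List (Elem n)} (h : Inv P S A)
    (J : List (Fin n)) {xs : List (Str n)} (hxs : ∀ x ∈ xs, x ∈ P.support) :
    Inv P (S ++ xs) (requery S J A) where
  support := by
    intro x hx
    rcases List.mem_append.1 hx with hx | hx
    exacts [h.support x hx, hxs x hx]
  handle_lt := by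
    simp only [requery, List.mem_map]
    rintro _ ⟨X, hX, rfl⟩
    have := h.handle_lt X hX
    simp only [List.length_append]
    omega
  view := by
    simp only [requery, List.mem_map]
    rintro _ ⟨X, hX, rfl⟩ jb hjb
    rw [str_append_left (h.handle_lt X hX)]
    rcases List.mem_append.1 hjb with hjb | hjb
    exacts [h.view X hX jb hjb, (mem_restr.1 hjb).2]
  distinct := by
    rw [requery, List.pairwise_map]
    refine h.distinct.imp ?_
    rintro X Y ⟨j, b, h1, h2⟩
    exact ⟨j, b, List.mem_append_left _ h1, List.mem_append_left _ h2⟩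

lemma Inv.append_singleton {S : List (Str n)} {A : List (Elem n)} {Y : Elem n} (h : Inv P S A)
    (h1 : Y.handle < S.length) (h2 : ∀ jb ∈ Y.view, jb.2 = str S Y.handle jb.1)
    (h3 : ∀ X ∈ A, X.Distinguished Y) : Inv P S (A ++ [Y]) where
  support := h.support
  handle_lt := List.forall_mem_append.2 ⟨h.handle_lt, by simpa using h1⟩
  view := List.forall_mem_append.2 ⟨h.view, by simpa using h2⟩
  distinct := List.pairwise_append.2 ⟨h.distinct, List.pairwise_singleton _ _, by simpa using h3⟩

/-- The number of indices in a batch. -/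
def batchIndices (m a : ℕ) : ℕ := ⌈2 ^ (a + 2) * lg m⌉₊

/-- The number of new samples in a batch. -/
def batchSamples (ε : ℝ) (m a : ℕ) : ℕ := ⌈4 / 2 ^ a * ε⁻¹ * lg m⌉₊

lemma always_batch [NeZero n] (ε : ℝ) (m a : ℕ) {S : List (Str n)} {A : List (Elem n)}
    (h : Inv P S A) :
    Always P (batch n ε m a A) (fun o S' c => Inv P S' o.2 ∧
      o.2.length = A.length + (if o.1 then 1 else 0) ∧ strs S A ⊆ strs S' o.2 ∧
      c = batchIndices m a * (A.length + batchSamples ε m a)) S := by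
  unfold batch
  rw [always_bind]
  refine always_chooseIndices fun J hJ => ?_
  rw [always_bind, always_queryEach]
  simp only [zipWith_eq_requery, always_bind]
  refine always_takeSamples fun xs hxs hP => ?_
  have hinv := h.requery_append J hP
  have hstrs := strs_requery_append h.handle_lt J xs
  have hcost : 0 + (A.length * J.length + (batchSamples ε m a * J.length + 0)) =
      batchIndices m a * (A.length + batchSamples ε m a) := by
    rw [hJ, batchIndices]
    ring
  split
  · rename_i Y hY
    rw [always_pure]
    have hmem := List.mem_of_find?_eq_some hY
    have hnew := List.find?_some hY
    obtain ⟨h1, h2⟩ := of_mem_sampleElems S hmem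
    simp only [decide_eq_true_eq] at hnew
    refine ⟨hinv.append_singleton h1 ?_ ?_, ?_, ?_, hcost⟩
    · intro jb hjb
      rw [h2] at hjb
      exact (mem_restr.1 hjb).2
    · simp only [requery, List.mem_map]
      rintro _ ⟨X, hX, rfl⟩
      have hne : ¬ restr J (str S X.handle) = Y.view := fun heq =>
        hnew (List.mem_map.2 ⟨X, hX, heq⟩)
      rw [h2, restr_eq_iff] at hne
      push Not at hne
      obtain ⟨j, hj, hjne⟩ := hne
      refine ⟨j, str S X.handle j, List.mem_append_right _ (mem_restr.2 ⟨hj, rfl⟩), ?_⟩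
      rw [h2]
      refine mem_restr.2 ⟨hj, ?_⟩
      revert hjne
      cases str S X.handle j <;> cases str (S ++ xs) Y.handle j <;> simp
    · simp [requery]
    · rw [← hstrs]
      simp only [strs, List.map_append]
      exact List.subset_append_left _ _
  · rw [always_pure]
    exact ⟨hinv, by simp [requery], hstrs ▸ List.Subset.refl _, hcost⟩

lemma ex_iid_forall {α : Type} (p : PMF α) (Q : α → Prop) (N : ℕ) :
    ex (iid p N) (fun l => ind (∀ x ∈ l, Q x)) = (ex p fun x => ind (Q x)) ^ N := by
  rw [← ex_iid_forall_take p Q le_rfl]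
  refine le_antisymm (ex_mono fun l hl => ?_) (ex_mono fun l hl => ?_) <;>
  rw [List.take_of_length_le (length_of_mem_support_iid hl).le]

lemma ex_ind_not_far (a : ℕ) (B : Finset (Str n)) :
    ex P (fun x => ind (¬ Far a B x)) = ENNReal.ofReal (1 - farProb P a B) := by
  classical
  have h : (1 : ℝ) - farProb P a B = mean P fun x => if Far a B x then 0 else 1 := by
    have h1 := mean_add P (fun x => if Far a B x then (1 : ℝ) else 0)
      (fun x => if Far a B x then (0 : ℝ) else 1)
    have h2 : (mean P fun x => (if Far a B x then (1 : ℝ) else 0) +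
        if Far a B x then (0 : ℝ) else 1) = 1 := by
      refine Eq.trans ?_ (mean_const P 1)
      congr 1
      funext x
      split_ifs <;> simp
    have h3 : farProb P a B = mean P fun x => if Far a B x then (1 : ℝ) else 0 := by
      unfold farProb
      congr!
    linarith
  rw [h, ← ex_ofReal P fun x => by positivity]
  congr 1
  funext x
  by_cases hx : Far a B x <;> simp [hx, ind_of, ind_of_not]

/-- If a batch fails, then there is no far sample among the new ones, or a far sample (which can be
fixed independently of the indices) agrees with a member of `A` on all of them. -/
lemma wp_batch_fail_le [NeZero n] (ε : ℝ) (m a : ℕ) (S : List (Str n)) (A : List (Elem n)) :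
    wp P (batch n ε m a A) (fun o _ => ind (o.1 = false)) S ≤
      ENNReal.ofReal (Real.exp (-(farProb P a (strs S A).toFinset * batchSamples ε m a))) +
      A.length * ENNReal.ofReal (Real.exp (-((1 / 2) ^ (a + 1) * batchIndices m a))) := by
  have h1 : wp P (batch n ε m a A) (fun o _ => ind (o.1 = false)) S ≤
      ex (iid (PMF.uniformOfFintype (Fin n)) (batchIndices m a)) fun J =>
        ex (iid P (batchSamples ε m a)) fun xs =>
          ind (∀ x ∈ xs, ∃ y ∈ strs S A, ∀ j ∈ J, x j = y j) := by
    unfold batch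
    simp only [wp_bind, wp_chooseIndices, wp_queryEach, wp_takeSamples]
    refine ex_mono fun J _ => ex_mono fun xs _ => ?_
    split
    · simp [ind_of_not]
    · rename_i hnone
      refine ind_mono fun _ x hx => ?_
      have hx' : restr J x ∈ (sampleElems J S.length xs).map Elem.view := by
        rw [map_view_sampleElems]
        exact List.mem_map_of_mem hx
      obtain ⟨Y, hY, hYx⟩ := List.mem_map.1 hx'
      have := List.find?_eq_none.1 hnone Y hY
      rw [decide_eq_true_eq, not_not, hYx] at this
      exact restr_mem_map_iff.1 this
  refine h1.trans ?_
  rw [ex_comm]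
  set B := (strs S A).toFinset
  set e := ENNReal.ofReal (Real.exp (-((1 / 2) ^ (a + 1) * batchIndices m a)))
  have h2 : ∀ xs : List (Str n),
      (ex (iid (PMF.uniformOfFintype (Fin n)) (batchIndices m a)) fun J =>
        ind (∀ x ∈ xs, ∃ y ∈ strs S A, ∀ j ∈ J, x j = y j)) ≤
      ind (∀ x ∈ xs, ¬ Far a B x) + A.length * e := by
    intro xs
    by_cases hxs : ∀ x ∈ xs, ¬ Far a B x
    · rw [ind_of hxs]
      refine le_add_right ((ex_mono fun J _ => ind_le_one _).trans_eq (ex_const _ 1))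
    · rw [ind_of_not hxs, zero_add]
      push Not at hxs
      obtain ⟨x, hx, hfar⟩ := hxs
      have h3 : ∀ J : List (Fin n), ind (∀ x ∈ xs, ∃ y ∈ strs S A, ∀ j ∈ J, x j = y j) ≤
          ∑ y ∈ B, ind (∀ j ∈ J.take J.length, x j = y j) := by
        intro J
        refine le_trans (ind_mono fun h => ?_) (ind_exists_mem_le B _)
        obtain ⟨y, hy, hxy⟩ := h x hx
        exact ⟨y, List.mem_toFinset.2 hy, by simpa using hxy⟩
      calc _ ≤ ex (iid (PMF.uniformOfFintype (Fin n)) (batchIndices m a)) fun J =>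
            ∑ y ∈ B, ind (∀ j ∈ J.take (batchIndices m a), x j = y j) := by
              refine ex_mono fun J hJ => ?_
              rw [← length_of_mem_support_iid hJ]
              exact h3 J
        _ = ∑ y ∈ B, ex (iid (PMF.uniformOfFintype (Fin n)) (batchIndices m a)) fun J =>
            ind (∀ j ∈ J.take (batchIndices m a), x j = y j) := by
              induction B using Finset.induction_on with
              | empty => simp [ex_const]
              | insert y B hy ih => simp only [Finset.sum_insert hy, ex_add, ih]
        _ ≤ ∑ y ∈ B, e := Finset.sum_le_sum fun y hy => ex_iid_agree_le (hfar y hy).le le_rfl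
        _ ≤ A.length * e := by
              rw [Finset.sum_const, nsmul_eq_mul]
              gcongr
              exact (List.toFinset_card_le _).trans (by simp [strs])
  refine (ex_mono fun xs _ => h2 xs).trans ?_
  rw [ex_add, ex_const, ex_iid_forall, ex_ind_not_far]
  gcongr
  exact ofReal_one_sub_pow_le (farProb_le_one P a B) _

end Batch

/-! ### The fishing expedition -/

section Fishing

variable {n : ℕ} {P : PMF (Str n)} {σ : Type}

lemma checkpoint_mono {k : ℕ} {p q : ℝ} (hp : 0 ≤ p) : Monotone (checkpoint k p q) := by
  intro s t hst
  unfold checkpoint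
  split_ifs with h1 h2 h2
  · exact le_rfl
  · exact Nat.zero_le _
  · omega
  · refine Nat.ceil_mono (mul_le_mul_of_nonneg_left ?_ (inv_nonneg.2 hp))
    exact max_le_max (pow_le_pow_right₀ (by norm_num) hst) le_rfl

lemma checkpoint_succ_le {k : ℕ} {p q : ℝ} (hp : 0 ≤ p)
    (hB : 0 ≤ lg q⁻¹ + lg (lg k + 1)) {t : ℕ} (ht : 2 ≤ t) :
    checkpoint k p q (t + 1) ≤ 2 * checkpoint k p q t := by
  rw [checkpoint, checkpoint, if_neg (by omega), if_neg (by omega), Nat.ceil_le]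
  push_cast
  have h1 := Nat.le_ceil (p⁻¹ * max (2 ^ t) (5 * (lg q⁻¹ + lg (lg k + 1))))
  have h2 : max ((2 : ℝ) ^ (t + 1)) (5 * (lg q⁻¹ + lg (lg k + 1))) ≤
      2 * max (2 ^ t) (5 * (lg q⁻¹ + lg (lg k + 1))) := by
    refine max_le ?_ ?_
    · rw [pow_succ, mul_comm]
      exact mul_le_mul_of_nonneg_left (le_max_left _ _) (by norm_num)
    · have := le_max_right ((2 : ℝ) ^ t) (5 * (lg q⁻¹ + lg (lg k + 1)))
      linarith
  have h3 := mul_le_mul_of_nonneg_left h2 (inv_nonneg.2 hp)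
  linarith

/-- An invariant `I` of the number of successes, the state and the samples is kept by executions
of the subroutine, each of which makes at most `B` queries. -/
def Keeps (P : PMF (Str n)) (k B : ℕ) (𝒜 : σ → Alg n (Bool × σ))
    (I : ℕ → σ → List (Str n) → Prop) : Prop :=
  ∀ H s S, H < k → I H s S →
    Always P (𝒜 s) (fun o S' c => I (if o.1 then H + 1 else H) o.2 S' ∧ c ≤ B) S

variable {k B : ℕ} {𝒜 : σ → Alg n (Bool × σ)} {I : ℕ → σ → List (Str n) → Prop}

lemma always_fishWhile (hI : Keeps P k B 𝒜 I) (N : ℕ) {H : ℕ} {s : σ} {S : List (Str n)}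
    (hH : H < k) (h : I H s S) :
    Always P (fishWhile k 𝒜 N (H, s)) (fun o S' c => I o.1 o.2 S' ∧ H ≤ o.1 ∧ o.1 ≤ k ∧
      c ≤ B * N) S := by
  induction N generalizing H s S with
  | zero => exact ⟨h, le_rfl, hH.le, Nat.zero_le _⟩
  | succ N ih =>
    rw [fishWhile, always_bind]
    refine (hI H s S hH h).mono ?_
    rintro ⟨x, s'⟩ S' c ⟨h1, h2⟩
    dsimp only at h1 ⊢
    set H' := if x then H + 1 else H with hH'
    have hle : H ≤ H' := by rw [hH']; split_ifs <;> omega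
    have hk : H' ≤ k := by rw [hH']; split_ifs <;> omega
    split_ifs with hHk
    · refine ⟨h1, hle, hk, ?_⟩
      nlinarith
    · refine (ih (by omega) h1).mono ?_
      rintro o S'' d ⟨h3, h4, h5, h6⟩
      exact ⟨h3, hle.trans h4, h5, by nlinarith⟩

/-- An expedition that has passed its last checkpoint with many successes is charged to these
successes. Here `R` bounds the number of executions per success at a checkpoint that is
passed. -/
lemma always_fishRounds (hI : Keeps P k B 𝒜 I) {p q : ℝ} {R : ℕ} (hp : 0 ≤ p)
    (hB : 0 ≤ lg q⁻¹ + lg (lg k + 1))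
    (hR : ∀ t H : ℕ, ¬ (H : ℝ) < 1 / 2 * p * checkpoint k p q t → checkpoint k p q t ≤ R * H)
    (len t : ℕ) (ht : 2 ≤ t) {H : ℕ} {s : σ} {S : List (Str n)} (hH : H < k) (h : I H s S)
    (hpass : checkpoint k p q t ≤ R * H) :
    Always P (fishRounds k p q 𝒜 (List.range' (t + 1) len) (H, s))
      (fun o S' c => I o.1 o.2 S' ∧ H ≤ o.1 ∧ o.1 ≤ k ∧
        c + B * checkpoint k p q t ≤ B * (2 * R * o.1)) S := by
  induction len generalizing t H s S with
  | zero =>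
    refine ⟨h, le_rfl, hH.le, ?_⟩
    rw [zero_add]
    exact Nat.mul_le_mul_left _ (by nlinarith)
  | succ len ih =>
    rw [List.range'_succ, fishRounds, always_bind]
    refine (always_fishWhile hI _ hH h).mono ?_
    rintro ⟨H', s'⟩ S' c ⟨h1, h2, h3, h4⟩
    dsimp only at h1 h2 h3 h4 ⊢
    rw [Nat.add_sub_cancel] at h4
    have hmono := checkpoint_mono (k := k) (q := q) hp (Nat.le_succ t)
    have hdouble := checkpoint_succ_le (k := k) (q := q) hp hB ht
    have h5 : c + B * checkpoint k p q t ≤ B * checkpoint k p q (t + 1) := by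
      calc c + B * checkpoint k p q t ≤
          B * (checkpoint k p q (t + 1) - checkpoint k p q t) + B * checkpoint k p q t := by
            omega
        _ = B * checkpoint k p q (t + 1) := by
            rw [← Nat.mul_add, Nat.sub_add_cancel hmono]
    have h6 : B * checkpoint k p q (t + 1) ≤ B * (2 * R * H') := by
      refine Nat.mul_le_mul_left _ (hdouble.trans ?_)
      have : R * H ≤ R * H' := Nat.mul_le_mul_left _ h2
      nlinarith
    split_ifs with hHk hlt
    · exact ⟨h1, h2, h3, by simpa using h5.trans h6⟩
    · exact ⟨h1, h2, h3, by simpa using h5.trans h6⟩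
    · refine (ih (t + 1) (by omega) (by omega) h1 (hR _ _ hlt)).mono ?_
      rintro o S'' d ⟨g1, g2, g3, g4⟩
      exact ⟨g1, h2.trans g2, g3, by omega⟩

lemma always_fishing (hI : Keeps P k B 𝒜 I) {p q : ℝ} {R : ℕ} (hp : 0 ≤ p)
    (hB : 0 ≤ lg q⁻¹ + lg (lg k + 1))
    (hR : ∀ t H : ℕ, ¬ (H : ℝ) < 1 / 2 * p * checkpoint k p q t → checkpoint k p q t ≤ R * H)
    {s : σ} {S : List (Str n)} (hk : 0 < k) (h : I 0 s S) :
    Always P (fishing k p q 𝒜 s) (fun o S' c => I o.1 o.2 S' ∧ o.1 ≤ k ∧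
      c ≤ B * (checkpoint k p q 2 + 2 * R * o.1)) S := by
  unfold fishing
  rw [List.Ico]
  cases hlen : ⌊lg k + 2⌋₊ + 1 - 2 with
  | zero => exact ⟨h, Nat.zero_le _, Nat.zero_le _⟩
  | succ len =>
    rw [List.range'_succ, fishRounds, always_bind]
    refine (always_fishWhile hI _ hk h).mono ?_
    rintro ⟨H', s'⟩ S' c ⟨h1, h2, h3, h4⟩
    dsimp only at h1 h2 h3 h4 ⊢
    have h0 : checkpoint k p q (2 - 1) = 0 := by simp [checkpoint]
    rw [h0, Nat.sub_zero] at h4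
    have h5 : c ≤ B * (checkpoint k p q 2 + 2 * R * H') := by
      rw [Nat.mul_add]
      omega
    split_ifs with hHk hlt
    · exact ⟨h1, h3, by simpa using h5⟩
    · exact ⟨h1, h3, by simpa using h5⟩
    · refine (always_fishRounds hI hp hB hR len 2 le_rfl (by omega) h1 (hR _ _ hlt)).mono ?_
      rintro o S'' d ⟨g1, g2, g3, g4⟩
      refine ⟨g1, g3, ?_⟩
      rw [Nat.mul_add]
      omega

/-- The factor `1/2` for a success and `1` for a failure. -/
def successWeight (x : Bool) : ℝ≥0∞ := if x then 2⁻¹ else 1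

/-- Bad states come only from bad states. -/
def Backward (P : PMF (Str n)) (k : ℕ) (𝒜 : σ → Alg n (Bool × σ))
    (I : ℕ → σ → List (Str n) → Prop) (Bad : σ → List (Str n) → Prop) : Prop :=
  ∀ H s S, H < k → I H s S → Always P (𝒜 s) (fun o S' _ => Bad o.2 S' → Bad s S) S

variable {Bad : σ → List (Str n) → Prop} {r : ℝ≥0∞}

lemma wp_fishWhile_eq_zero (hI : Keeps P k B 𝒜 I) (hanti : Backward P k 𝒜 I Bad)
    (g : ℕ × σ → ℝ≥0∞) (N : ℕ) {H : ℕ} {s : σ} {S : List (Str n)} (hH : H < k) (h : I H s S)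
    (hbad : ¬ Bad s S) :
    wp P (fishWhile k 𝒜 N (H, s)) (fun o S' => ind (o.1 ≠ k ∧ Bad o.2 S') * g o) S = 0 := by
  have hI' : Keeps P k B 𝒜 fun H s S => I H s S ∧ ¬ Bad s S := fun H s S hH hs =>
    ((hI H s S hH hs.1).and (hanti H s S hH hs.1)).mono fun o S' c ho =>
      ⟨⟨ho.1.1, fun hb => hs.2 (ho.2 hb)⟩, ho.1.2⟩
  refine le_antisymm ?_ zero_le
  refine le_trans (wp_mono_of_always (g := fun _ _ => 0)
    ((always_fishWhile hI' N hH ⟨h, hbad⟩).mono ?_)) (wp_const _ _ _).le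
  rintro o S' c ⟨hb, -⟩
  rw [ind_of_not fun hc => hb.2 hc.2, zero_mul]

/-- While the state is bad (which here means that the subroutine is likely to succeed), the
expectation of `2^(-H)`, for the number `H` of successes, shrinks by the factor `r` in every
execution. A state that is bad at the end has been bad all the time. -/
lemma wp_fishWhile_le (hI : Keeps P k B 𝒜 I) (hanti : Backward P k 𝒜 I Bad)
    (hr : ∀ H s S, H < k → I H s S → Bad s S →
      wp P (𝒜 s) (fun o _ => successWeight o.1) S ≤ r)
    (N : ℕ) {H : ℕ} {s : σ} {S : List (Str n)} (hH : H < k) (h : I H s S) :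
    wp P (fishWhile k 𝒜 N (H, s)) (fun o S' => ind (o.1 ≠ k ∧ Bad o.2 S') * 2⁻¹ ^ o.1) S ≤
      ind (Bad s S) * (2⁻¹ ^ H * r ^ N) := by
  by_cases hbad : Bad s S
  · rw [ind_of hbad, one_mul]
    induction N generalizing H s S with
    | zero =>
      rw [fishWhile, wp_pure, pow_zero, mul_one]
      exact (mul_le_mul_left (ind_le_one _) _).trans_eq (one_mul _)
    | succ N ih =>
      rw [fishWhile, wp_bind]
      have h1 : wp P (𝒜 s) (fun o _ => 2⁻¹ ^ H * r ^ N * successWeight o.1) S ≤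
          2⁻¹ ^ H * r ^ (N + 1) := by
        rw [wp_const_mul, pow_succ, ← mul_assoc]
        exact mul_le_mul_right (hr H s S hH h hbad) _
      refine le_trans (wp_mono_of_always ((hI H s S hH h).mono ?_)) h1
      rintro ⟨x, s'⟩ S' c ⟨g1, -⟩
      dsimp only at g1 ⊢
      have hw : (2⁻¹ : ℝ≥0∞) ^ (if x then H + 1 else H) * r ^ N =
          2⁻¹ ^ H * r ^ N * successWeight x := by
        cases x <;> simp [successWeight, pow_succ]
        ring
      set H' := if x then H + 1 else H with hH'
      have hk : H' ≤ k := by rw [hH']; split_ifs <;> omega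
      rw [← hw]
      split_ifs with hHk
      · rw [wp_pure, ind_of_not fun hc => hc.1 hHk, zero_mul]
        exact zero_le
      · by_cases hbad' : Bad s' S'
        · exact ih (by omega) g1 hbad'
        · rw [wp_fishWhile_eq_zero hI hanti (fun o => 2⁻¹ ^ o.1) N (by omega) g1 hbad']
          exact zero_le
  · rw [wp_fishWhile_eq_zero hI hanti (fun o => 2⁻¹ ^ o.1) N hH h hbad]
    exact zero_le

/-- A union bound over the checkpoints: an expedition that gives up at the checkpoint `N_t` has
found so few successes that the weight `w t * 2^(-H)` is at least one. -/
lemma wp_fishRounds_le (hI : Keeps P k B 𝒜 I) (hanti : Backward P k 𝒜 I Bad)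
    (hr : ∀ H s S, H < k → I H s S → Bad s S →
      wp P (𝒜 s) (fun o _ => successWeight o.1) S ≤ r) {p q : ℝ} (hp : 0 ≤ p)
    {w : ℕ → ℝ≥0∞}
    (hw : ∀ t H : ℕ, (H : ℝ) < 1 / 2 * p * checkpoint k p q t → 1 ≤ w t * 2⁻¹ ^ H)
    (len t : ℕ) (hlast : ∀ H : ℕ, H < k → (H : ℝ) < 1 / 2 * p * checkpoint k p q (t + len))
    {H : ℕ} {s : σ} {S : List (Str n)} (hH : H < k) (h : I H s S) :
    wp P (fishRounds k p q 𝒜 (List.range' t (len + 1)) (H, s))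
        (fun o S' => ind (o.1 ≠ k ∧ Bad o.2 S')) S ≤
      ind (Bad s S) * (2⁻¹ ^ H * ∑ i ∈ Finset.range (len + 1),
        w (t + i) * r ^ (checkpoint k p q (t + i) - checkpoint k p q (t - 1))) := by
  induction len generalizing t H s S with
  | zero =>
    rw [List.range'_succ, fishRounds, wp_bind]
    have h1 := mul_le_mul_right (wp_fishWhile_le hI hanti hr
      (checkpoint k p q t - checkpoint k p q (t - 1)) hH h) (w t)
    rw [← wp_const_mul] at h1
    refine (wp_mono_of_always ((always_fishWhile hI _ hH h).mono ?_)).trans (h1.trans_eq ?_)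
    · rintro ⟨H', s'⟩ S' c ⟨-, -, hk, -⟩
      dsimp only at hk ⊢
      have hgoal : ind (H' ≠ k ∧ Bad s' S') ≤
          w t * (ind (H' ≠ k ∧ Bad s' S') * 2⁻¹ ^ H') := by
        by_cases hc : H' ≠ k ∧ Bad s' S'
        · rw [ind_of hc, one_mul]
          exact hw t H' (hlast H' (by omega))
        · simp [ind_of_not hc]
      split_ifs with h2 h3
      · simpa using hgoal
      · simpa using hgoal
      · exact hgoal
    · simp only [zero_add, Finset.range_one, Finset.sum_singleton, add_zero]
      ring
  | succ len ih =>
    rw [List.range'_succ, fishRounds, wp_bind]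
    set W := ∑ i ∈ Finset.range (len + 1),
        w (t + 1 + i) * r ^ (checkpoint k p q (t + 1 + i) - checkpoint k p q (t + 1 - 1)) with hW
    have h1 := mul_le_mul_right (wp_fishWhile_le hI hanti hr
      (checkpoint k p q t - checkpoint k p q (t - 1)) hH h) (w t + W)
    rw [← wp_const_mul] at h1
    refine (wp_mono_of_always ((always_fishWhile hI _ hH h).mono ?_)).trans (h1.trans_eq ?_)
    · rintro ⟨H', s'⟩ S' c ⟨hI', -, hk, -⟩
      dsimp only at hk hI' ⊢
      split_ifs with h2 h3
      · rw [wp_pure, ind_of_not fun hc => hc.1 h2]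
        exact zero_le
      · rw [wp_pure]
        by_cases hc : H' ≠ k ∧ Bad s' S'
        · rw [ind_of hc, one_mul]
          refine (hw t H' h3).trans ?_
          gcongr
          exact le_self_add
        · simp [ind_of_not hc]
      · have hlt : H' < k := by omega
        refine (ih (t + 1) (fun H hH => ?_) hlt hI').trans ?_
        · have := hlast H hH
          rwa [show t + (len + 1) = t + 1 + len by omega] at this
        · rw [← hW]
          have : ind (Bad s' S') = ind (H' ≠ k ∧ Bad s' S') := by simp [h2]
          rw [this]
          calc _ = W * (ind (H' ≠ k ∧ Bad s' S') * 2⁻¹ ^ H') := by ring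
            _ ≤ _ := by
              gcongr
              exact le_add_self
    · rw [Finset.sum_range_succ']
      have hsum : ∑ i ∈ Finset.range (len + 1), w (t + (i + 1)) *
          r ^ (checkpoint k p q (t + (i + 1)) - checkpoint k p q (t - 1)) =
          W * r ^ (checkpoint k p q t - checkpoint k p q (t - 1)) := by
        rw [hW, Finset.sum_mul]
        refine Finset.sum_congr rfl fun i _ => ?_
        have hm1 := checkpoint_mono (k := k) (q := q) hp (Nat.sub_le t 1)
        have hm2 := checkpoint_mono (k := k) (q := q) hp (by omega : t ≤ t + (i + 1))
        rw [mul_assoc, ← pow_add, show t + 1 + i = t + (i + 1) by omega, Nat.add_sub_cancel]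
        congr 2
        omega
      rw [hsum, Nat.add_zero]
      ring

lemma wp_fishing_le (hI : Keeps P k B 𝒜 I) (hanti : Backward P k 𝒜 I Bad)
    (hr : ∀ H s S, H < k → I H s S → Bad s S →
      wp P (𝒜 s) (fun o _ => successWeight o.1) S ≤ r) {p q : ℝ} (hp : 0 < p)
    {w : ℕ → ℝ≥0∞}
    (hw : ∀ t H : ℕ, (H : ℝ) < 1 / 2 * p * checkpoint k p q t → 1 ≤ w t * 2⁻¹ ^ H)
    {s : σ} {S : List (Str n)} (hk : 0 < k) (h : I 0 s S) :
    wp P (fishing k p q 𝒜 s) (fun o S' => ind (o.1 ≠ k ∧ Bad o.2 S')) S ≤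
      ∑ i ∈ Finset.range (⌊lg k + 2⌋₊ - 1), w (2 + i) * r ^ checkpoint k p q (2 + i) := by
  have hk1 : (1 : ℝ) ≤ k := by exact_mod_cast hk
  have hlg : 0 ≤ lg k := Real.logb_nonneg (by norm_num) hk1
  have hfl : 2 ≤ ⌊lg k + 2⌋₊ := Nat.le_floor (by push_cast; linarith)
  obtain ⟨len, hlen⟩ : ∃ len, ⌊lg k + 2⌋₊ = len + 2 := ⟨⌊lg k + 2⌋₊ - 2, by omega⟩
  unfold fishing
  rw [List.Ico, hlen, show len + 2 + 1 - 2 = len + 1 by omega,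
    show len + 2 - 1 = len + 1 by omega]
  refine (wp_fishRounds_le hI hanti hr hp.le hw len 2 ?_ hk h).trans ?_
  · intro H hH
    have h1 : (k : ℝ) ≤ 1 / 2 * 2 ^ (2 + len) := by
      have h2 : lg k + 1 < (2 + len : ℕ) := by
        have := Nat.lt_floor_add_one (lg k + 2)
        rw [hlen] at this
        push_cast at this ⊢
        linarith
      have h3 : (2 : ℝ) ^ (lg k + 1) ≤ 2 ^ ((2 + len : ℕ) : ℝ) :=
        Real.rpow_le_rpow_of_exponent_le (by norm_num) h2.le
      rw [Real.rpow_add (by norm_num), lg, Real.rpow_logb (by norm_num) (by norm_num)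
        (by linarith), Real.rpow_one, Real.rpow_natCast] at h3
      linarith
    have h4 : (H : ℝ) < k := by exact_mod_cast hH
    refine (h4.trans_le h1).trans_le ?_
    rw [checkpoint, if_neg (by omega)]
    have h5 := Nat.le_ceil (p⁻¹ * max (2 ^ (2 + len)) (5 * (lg q⁻¹ + lg (lg k + 1))))
    have h6 := mul_le_mul_of_nonneg_left h5 hp.le
    rw [mul_inv_cancel_left₀ hp.ne'] at h6
    have h7 := le_max_left ((2 : ℝ) ^ (2 + len)) (5 * (lg q⁻¹ + lg (lg k + 1)))
    rw [mul_assoc]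
    linarith
  · rw [pow_zero, one_mul, show checkpoint k p q (2 - 1) = 0 by simp [checkpoint]]
    simp only [Nat.sub_zero]
    exact (mul_le_mul_left (ind_le_one _) _).trans_eq (one_mul _)

/-- If the subroutine succeeds with probability at least `1/3` whenever the state is bad, then an
expedition with threshold `1/3` and confidence `q` gives up in a bad state with probability at
most `q`. -/
lemma wp_fishing_third_le (hI : Keeps P k B 𝒜 I) (hanti : Backward P k 𝒜 I Bad)
    (hr : ∀ H s S, H < k → I H s S → Bad s S →
      wp P (𝒜 s) (fun o _ => ind (o.1 = false)) S ≤ 2 / 3) {q : ℝ} (hq : 0 < q)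
    (hq1 : q ≤ 1) {s : σ} {S : List (Str n)} (hk : 0 < k) (h : I 0 s S) :
    wp P (fishing k (1 / 3) q 𝒜 s) (fun o S' => ind (o.1 ≠ k ∧ Bad o.2 S')) S ≤
      ENNReal.ofReal q := by
  have hk1 : (1 : ℝ) ≤ k := by exact_mod_cast hk
  have hlg : 0 ≤ lg k := Real.logb_nonneg (by norm_num) hk1
  set D := lg q⁻¹ + lg (lg k + 1) with hD
  have hD0 : 0 ≤ D := by
    refine add_nonneg ?_ ?_
    · exact Real.logb_nonneg (by norm_num) ((one_le_inv₀ hq).2 hq1)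
    · exact Real.logb_nonneg (by norm_num) (by linarith)
  have hr' : ∀ H s S, H < k → I H s S → Bad s S →
      wp P (𝒜 s) (fun o _ => successWeight o.1) S ≤ ENNReal.ofReal (5 / 6) := by
    intro H s S h1 h2 h3
    have h4 : wp P (𝒜 s) (fun o _ => successWeight o.1) S =
        2⁻¹ + 2⁻¹ * wp P (𝒜 s) (fun o _ => ind (o.1 = false)) S := by
      rw [← wp_const_mul]
      refine Eq.trans ?_ (congrArg (· + _) (wp_const (P := P) (𝒜 s) 2⁻¹ S))
      rw [← wp_add]
      congr 1
      funext o _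
      rcases o with ⟨_ | _, o⟩ <;>
        simp [successWeight, ind_of, ind_of_not, ENNReal.inv_two_add_inv_two]
    rw [h4]
    -- Successes have weight `1/2`, so the bound on the failures gives `1/2 + 1/2 * 2/3`.
    refine (add_le_add_right (mul_le_mul_right (hr H s S h1 h2 h3) _) _).trans ?_
    rw [← ENNReal.toReal_le_toReal (by finiteness) (by finiteness)]
    rw [ENNReal.toReal_add (by finiteness) (by finiteness)]
    simp [ENNReal.toReal_div]
    norm_num
  have hbound := wp_fishing_le hI hanti hr' (p := 1 / 3) (q := q) (by norm_num)
    (w := fun t => ENNReal.ofReal (2 ^ ((checkpoint k (1 / 3) q t : ℝ) / 6))) ?_ hk h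
  · refine hbound.trans ?_
    have hterm : ∀ i ∈ Finset.range (⌊lg k + 2⌋₊ - 1),
        ENNReal.ofReal (2 ^ ((checkpoint k (1 / 3) q (2 + i) : ℝ) / 6)) *
          ENNReal.ofReal (5 / 6) ^ checkpoint k (1 / 3) q (2 + i) ≤
        ENNReal.ofReal (q / (lg k + 1)) := by
      intro i _
      set N := checkpoint k (1 / 3) q (2 + i) with hN
      have hN15 : 15 * D ≤ N := by
        rw [hN, checkpoint, if_neg (by omega)]
        refine le_trans ?_ (Nat.le_ceil _)
        have := le_max_right ((2 : ℝ) ^ (2 + i)) (5 * (lg q⁻¹ + lg (lg k + 1)))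
        norm_num
        linarith
      rw [← ENNReal.ofReal_pow (by norm_num), ← ENNReal.ofReal_mul (by positivity)]
      refine ENNReal.ofReal_le_ofReal ?_
      -- `2^(1/6) * 5/6 < 1`, and its `15`-th power is below `1/2`.
      have h1 : (2 : ℝ) ^ ((N : ℝ) / 6) * (5 / 6) ^ N = (2 ^ (5 / 2 : ℝ) * (5 / 6) ^ 15) ^
          ((N : ℝ) / 15) := by
        rw [Real.mul_rpow (by positivity) (by positivity), ← Real.rpow_mul (by norm_num),
          ← Real.rpow_natCast (5 / 6) N, ← Real.rpow_natCast (5 / 6) 15,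
          ← Real.rpow_mul (by norm_num)]
        congr 2 <;> push_cast <;> ring
      have h2 : (2 : ℝ) ^ (5 / 2 : ℝ) * (5 / 6) ^ 15 ≤ 1 / 2 := by
        have h3 : (2 : ℝ) ^ (5 / 2 : ℝ) ≤ 6 := by
          have h4 : ((2 : ℝ) ^ (5 / 2 : ℝ)) ^ 2 = 32 := by
            rw [← Real.rpow_natCast, ← Real.rpow_mul (by norm_num)]
            norm_num
          nlinarith [show (0 : ℝ) ≤ (2 : ℝ) ^ (5 / 2 : ℝ) by positivity]
        nlinarith [show ((5 : ℝ) / 6) ^ 15 ≤ 1 / 12 by norm_num,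
          show (0 : ℝ) ≤ (5 / 6) ^ 15 by positivity]
      rw [h1]
      calc (2 ^ (5 / 2 : ℝ) * (5 / 6) ^ 15 : ℝ) ^ ((N : ℝ) / 15) ≤ (1 / 2) ^ ((N : ℝ) / 15) :=
            Real.rpow_le_rpow (by positivity) h2 (by positivity)
        _ ≤ (1 / 2) ^ D := Real.rpow_le_rpow_of_exponent_ge (by norm_num) (by norm_num)
            (by linarith)
        _ = q / (lg k + 1) := by
            rw [one_div, Real.inv_rpow (by norm_num), hD, Real.rpow_add (by norm_num), lg, lg,
              Real.rpow_logb (by norm_num) (by norm_num) (by positivity),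
              Real.rpow_logb (by norm_num) (by norm_num) (by positivity), mul_inv, inv_inv]
            rfl
    refine (Finset.sum_le_card_nsmul _ _ _ hterm).trans ?_
    rw [Finset.card_range, nsmul_eq_mul, ← ENNReal.ofReal_natCast,
      ← ENNReal.ofReal_mul (Nat.cast_nonneg _)]
    refine ENNReal.ofReal_le_ofReal ?_
    have hfl := Nat.floor_le (by linarith : 0 ≤ lg k + 2)
    have h2 : 1 ≤ ⌊lg k + 2⌋₊ := Nat.le_floor (by push_cast; linarith)
    rw [mul_div_assoc', div_le_iff₀ (by linarith), mul_comm]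
    refine mul_le_mul_of_nonneg_left ?_ hq.le
    rw [Nat.cast_sub h2]
    push_cast
    linarith
  · intro t H hH
    rw [← ENNReal.ofReal_ofNat 2, ← ENNReal.ofReal_inv_of_pos (by norm_num),
      ← ENNReal.ofReal_pow (by positivity), ← ENNReal.ofReal_mul (by positivity),
      ENNReal.one_le_ofReal, inv_pow, ← Real.rpow_natCast 2 H, ← Real.rpow_neg (by norm_num),
      ← Real.rpow_add (by norm_num)]
    refine Real.one_le_rpow (by norm_num) ?_
    linarith

end Fishing

/-! ### The first phase -/

section FirstPhase

variable {n : ℕ} {P : PMF (Str n)}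

lemma one_le_lg {x : ℝ} (hx : 2 ≤ x) : 1 ≤ lg x := by
  rw [lg, Real.le_logb_iff_rpow_le (by norm_num) (by linarith)]
  simpa using hx

/-- The bound `x ^ j * exp (-2 * lg x) ≤ 2 ^ j * exp (-2)` for `j ≤ 2`. -/
lemma pow_mul_exp_neg_lg_le {x : ℝ} (hx : 2 ≤ x) {j : ℕ} (hj : j ≤ 2) :
    x ^ j * Real.exp (-(2 * lg x)) ≤ 2 ^ j * Real.exp (-2) := by
  have h1 := one_le_lg hx
  have hx2 : x = Real.exp (Real.log 2 * lg x) := by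
    rw [lg, Real.logb, mul_div_cancel₀ _ (Real.log_pos (by norm_num)).ne', Real.exp_log]
    linarith
  have h2 : (2 : ℝ) = Real.exp (Real.log 2) := (Real.exp_log (by norm_num)).symm
  have hlog : Real.log 2 ≤ 1 := by
    have := Real.log_two_lt_d9
    linarith
  calc x ^ j * Real.exp (-(2 * lg x)) = Real.exp ((j * Real.log 2 - 2) * lg x) := by
        nth_rewrite 1 [hx2]
        rw [← Real.exp_nat_mul, ← Real.exp_add]
        congr 1
        ring
    _ ≤ Real.exp (j * Real.log 2 - 2) := by
        refine Real.exp_le_exp.2 ?_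
        have h3 : (j : ℝ) * Real.log 2 ≤ 2 := by
          have : (j : ℝ) ≤ 2 := by exact_mod_cast hj
          nlinarith [Real.log_pos (by norm_num : (1 : ℝ) < 2)]
        nlinarith
    _ = 2 ^ j * Real.exp (-2) := by
        have h4 : (2 : ℝ) ^ j = Real.exp (j * Real.log 2) := by
          rw [Real.exp_nat_mul, ← h2]
        rw [h4, ← Real.exp_add, sub_eq_add_neg]

lemma exp_neg_two_le : Real.exp (-2) ≤ 0.136 := by
  rw [Real.exp_neg, show (2 : ℝ) = ((2 : ℕ) : ℝ) * 1 by norm_num, Real.exp_nat_mul]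
  have := Real.exp_one_gt_d9
  rw [inv_le_comm₀ (by positivity) (by norm_num)]
  nlinarith

/-- The threshold for the probability of samples that are far at scale `a`. It is chosen such that
at the threshold a batch of scale `a` contains at least `6/5` far samples in expectation, so that
the batch is likely to succeed. -/
def threshold (ε : ℝ) (m a : ℕ) : ℝ := 3 / 10 * 2 ^ a * ε / lg m

/-- The set of strings of `A` leaves samples that are far at scale `a` with a probability that is
above the threshold. -/
def Uncovered (P : PMF (Str n)) (ε : ℝ) (m a : ℕ) (A : List (Elem n)) (S : List (Str n)) :
    Prop :=
  threshold ε m a ≤ farProb P a (strs S A).toFinset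

lemma Uncovered.anti {ε : ℝ} {m a : ℕ} {A A' : List (Elem n)} {S S' : List (Str n)}
    (h : Uncovered P ε m a A' S') (hsub : strs S A ⊆ strs S' A') : Uncovered P ε m a A S :=
  le_trans h (farProb_anti P a fun x hx => by
    rw [List.mem_toFinset] at hx ⊢
    exact hsub hx)

lemma wp_batch_fail_le_of_uncovered [NeZero n] {ε : ℝ} (hε : 0 < ε) {m a : ℕ} (hm : 2 ≤ m)
    {S : List (Str n)} {A : List (Elem n)} (hA : A.length ≤ m) (h : Uncovered P ε m a A S) :
    wp P (batch n ε m a A) (fun o _ => ind (o.1 = false)) S ≤ 2 / 3 := by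
  have hm' : (2 : ℝ) ≤ m := by exact_mod_cast hm
  have hlg := one_le_lg hm'
  refine (wp_batch_fail_le ε m a S A).trans ?_
  have h1 : Real.exp (-(farProb P a (strs S A).toFinset * batchSamples ε m a)) ≤ 0.37 := by
    have h2 : (1 : ℝ) ≤ farProb P a (strs S A).toFinset * batchSamples ε m a := by
      calc (1 : ℝ) ≤ threshold ε m a * (4 / 2 ^ a * ε⁻¹ * lg m) := by
            rw [threshold]
            field_simp
            norm_num
        _ ≤ _ := mul_le_mul h (Nat.le_ceil _) (by positivity) (farProb_nonneg _ _ _)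
    refine (Real.exp_le_exp.2 (neg_le_neg h2)).trans ?_
    have := Real.exp_neg_one_lt_d9
    linarith
  have h3 : (A.length : ℝ) * Real.exp (-((1 / 2) ^ (a + 1) * batchIndices m a)) ≤ 0.272 := by
    have h4 : 2 * lg m ≤ (1 / 2 : ℝ) ^ (a + 1) * batchIndices m a := by
      calc 2 * lg m = (1 / 2 : ℝ) ^ (a + 1) * (2 ^ (a + 2) * lg m) := by
            rw [one_div, inv_pow]
            field_simp
            ring
        _ ≤ _ := mul_le_mul_of_nonneg_left (Nat.le_ceil _) (by positivity)
    calc _ ≤ (m : ℝ) * Real.exp (-(2 * lg m)) :=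
          mul_le_mul (by exact_mod_cast hA) (Real.exp_le_exp.2 (neg_le_neg h4))
            (Real.exp_pos _).le (by positivity)
      _ ≤ 2 * Real.exp (-2) := by
          simpa using pow_mul_exp_neg_lg_le hm' (j := 1) (by norm_num)
      _ ≤ 0.272 := by linarith [exp_neg_two_le]
  rw [← ENNReal.ofReal_natCast, ← ENNReal.ofReal_mul (by positivity),
    ← ENNReal.ofReal_add (Real.exp_pos _).le (by positivity)]
  refine ENNReal.ofReal_le_of_le_toReal ?_
  rw [ENNReal.toReal_div, ENNReal.toReal_ofNat, ENNReal.toReal_ofNat]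
  linarith

/-- The confidence parameter of the expeditions. -/
def confidence (m : ℕ) : ℝ := 1 / (4 * ⌈lg m + 1⌉₊)

lemma confidence_pos {m : ℕ} (hm : 2 ≤ m) : 0 < confidence m := by
  have := one_le_lg (x := m) (by exact_mod_cast hm)
  have : 0 < ⌈lg m + 1⌉₊ := Nat.ceil_pos.2 (by linarith)
  unfold confidence
  positivity

lemma confidence_le_one {m : ℕ} (hm : 2 ≤ m) : confidence m ≤ 1 := by
  have := one_le_lg (x := m) (by exact_mod_cast hm)
  have h : 0 < ⌈lg m + 1⌉₊ := Nat.ceil_pos.2 (by linarith)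
  have h1 : (1 : ℝ) ≤ ⌈lg m + 1⌉₊ := by exact_mod_cast h
  unfold confidence
  rw [div_le_one (by positivity)]
  linarith

/-- The invariant of an expedition that starts with the set `A₀` and the samples `S₀`. -/
def Expedition (P : PMF (Str n)) (S₀ : List (Str n)) (A₀ : List (Elem n)) (H : ℕ)
    (A : List (Elem n)) (S : List (Str n)) : Prop :=
  Inv P S A ∧ A.length = A₀.length + H ∧ strs S₀ A₀ ⊆ strs S A

lemma keeps_batch [NeZero n] {ε : ℝ} {m a B : ℕ}
    (hB : batchIndices m a * (m + batchSamples ε m a) ≤ B) (S₀ : List (Str n))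
    (A₀ : List (Elem n)) :
    Keeps P (m + 1 - A₀.length) B (batch n ε m a) (Expedition P S₀ A₀) := by
  rintro H A S hH ⟨h1, h2, h3⟩
  refine (always_batch ε m a h1).mono ?_
  rintro ⟨x, A'⟩ S' c ⟨g1, g2, g3, rfl⟩
  refine ⟨⟨g1, ?_, List.Subset.trans h3 g3⟩, le_trans ?_ hB⟩
  · dsimp only at g2 ⊢
    rw [g2, h2]
    split_ifs <;> omega
  · gcongr
    omega

lemma backward_batch [NeZero n] (ε : ℝ) (m a : ℕ) (S₀ : List (Str n)) (A₀ : List (Elem n)) :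
    Backward P (m + 1 - A₀.length) (batch n ε m a) (Expedition P S₀ A₀)
      (Uncovered P ε m a) := by
  rintro H A S hH ⟨h1, h2, h3⟩
  refine (always_batch ε m a h1).mono ?_
  rintro ⟨x, A'⟩ S' c ⟨-, -, g3, -⟩ hbad
  exact hbad.anti g3

lemma lg_confidence_nonneg {m k : ℕ} (hm : 2 ≤ m) (hk : 0 < k) :
    0 ≤ lg (confidence m)⁻¹ + lg (lg k + 1) := by
  refine add_nonneg ?_ ?_
  · exact Real.logb_nonneg (by norm_num)
      ((one_le_inv₀ (confidence_pos hm)).2 (confidence_le_one hm))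
  · have : 0 ≤ lg k := Real.logb_nonneg (by norm_num) (by exact_mod_cast hk)
    exact Real.logb_nonneg (by norm_num) (by linarith)

lemma always_fishing_batch [NeZero n] {ε : ℝ} {m a B : ℕ} (hm : 2 ≤ m)
    (hB : batchIndices m a * (m + batchSamples ε m a) ≤ B) {S : List (Str n)}
    {A : List (Elem n)} (hA : A.length ≤ m) (h : Inv P S A) :
    Always P (fishing (m + 1 - A.length) (1 / 3) (confidence m) (batch n ε m a) A)
      (fun o S' c => Expedition P S A o.1 o.2 S' ∧ o.1 ≤ m + 1 - A.length ∧
        c ≤ B * (checkpoint (m + 1 - A.length) (1 / 3) (confidence m) 2 + 2 * 6 * o.1)) S := by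
  refine always_fishing (keeps_batch hB S A) (by norm_num)
    (lg_confidence_nonneg hm (by omega)) ?_ (by omega) ⟨h, by simp, List.Subset.refl _⟩
  intro t H hH
  have h1 : (checkpoint (m + 1 - A.length) (1 / 3) (confidence m) t : ℝ) ≤ 6 * H := by
    rw [not_lt] at hH
    linarith
  exact_mod_cast h1

/-- The costs of all batches of the first phase are charged to its scales, with `K` executions
each, and to the members that are added to `A`, with `12` executions each. -/
lemma always_firstPhaseRounds [NeZero n] {ε : ℝ} {m B K : ℕ} (hm : 2 ≤ m)
    (hK : ∀ k, 0 < k → k ≤ m → checkpoint k (1 / 3) (confidence m) 2 ≤ K)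
    (as : List ℕ) (hB : ∀ a ∈ as, batchIndices m a * (m + batchSamples ε m a) ≤ B)
    {S : List (Str n)} {A : List (Elem n)} (hA0 : 0 < A.length) (hA : A.length ≤ m)
    (h : Inv P S A) :
    Always P (firstPhaseRounds n ε m as A) (fun o S' c =>
      (o = none → P ∉ boundedSupport n m ∧
        c + B * (12 * A.length) ≤ B * (as.length * K + 12 * (m + 1))) ∧
      ∀ A', o = some A' → Inv P S' A' ∧ A.length ≤ A'.length ∧ A'.length ≤ m ∧
        strs S A ⊆ strs S' A' ∧
        c + B * (12 * A.length) ≤ B * (as.length * K + 12 * A'.length)) S := by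
  induction as generalizing S A with
  | nil =>
    refine ⟨fun hc => by simp at hc, ?_⟩
    rintro _ ⟨⟩
    exact ⟨h, le_rfl, hA, List.Subset.refl _, by simp⟩
  | cons a as ih =>
    rw [firstPhaseRounds, always_bind]
    refine (always_fishing_batch hm (hB a (by simp)) hA h).mono ?_
    rintro ⟨H, A'⟩ S' c ⟨⟨h1, h2, h3⟩, h4, h5⟩
    dsimp only at h1 h2 h3 h4 h5 ⊢
    have hK' := hK (m + 1 - A.length) (by omega) (by omega)
    have h6 : c ≤ B * (K + 12 * H) := h5.trans (Nat.mul_le_mul_left _ (by omega))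
    split_ifs with hfull
    · refine ⟨fun _ => ⟨h1.notMem_boundedSupport hfull, ?_⟩, fun A'' hc => by simp at hc⟩
      refine (Nat.add_le_add_right h6 _).trans ?_
      rw [← Nat.mul_add]
      refine Nat.mul_le_mul_left _ ?_
      have : 0 ≤ as.length * K := Nat.zero_le _
      rw [List.length_cons, Nat.add_mul]
      omega
    · refine (ih (fun a ha => hB a (by simp [ha])) (by omega) (by omega) h1).mono ?_
      rintro o S'' d ⟨g1, g2⟩
      constructor
      · intro ho
        obtain ⟨g3, g4⟩ := g1 ho
        refine ⟨g3, ?_⟩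
        rw [h2] at g4
        rw [List.length_cons]
        nlinarith
      · intro A'' ho
        obtain ⟨g3, g4, g5, g6, g7⟩ := g2 A'' ho
        refine ⟨g3, by omega, g5, List.Subset.trans h3 g6, ?_⟩
        rw [h2] at g7
        rw [List.length_cons]
        nlinarith

/-- At the end of the first phase, every scale has been covered, unless one of the expeditions has
failed or the set `A` is full. -/
lemma wp_firstPhaseRounds_le [NeZero n] {ε : ℝ} (hε : 0 < ε) {m B K : ℕ} (hm : 2 ≤ m)
    (hK : ∀ k, 0 < k → k ≤ m → checkpoint k (1 / 3) (confidence m) 2 ≤ K)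
    (as : List ℕ) (hB : ∀ a ∈ as, batchIndices m a * (m + batchSamples ε m a) ≤ B)
    {S : List (Str n)} {A : List (Elem n)} (hA0 : 0 < A.length)
    (hA : A.length ≤ m) (h : Inv P S A) :
    wp P (firstPhaseRounds n ε m as A)
      (fun o S' => ind (∃ A', o = some A' ∧ ∃ a ∈ as, Uncovered P ε m a A' S')) S ≤
      as.length * ENNReal.ofReal (confidence m) := by
  induction as generalizing S A with
  | nil =>
    rw [firstPhaseRounds, wp_pure, ind_of_not (by simp)]
    exact zero_le
  | cons a as ih =>
    rw [firstPhaseRounds, wp_bind]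
    have hfish := wp_fishing_third_le (keeps_batch le_rfl S A) (backward_batch ε m a S A)
      (fun H s S' hH hs hbad => wp_batch_fail_le_of_uncovered hε hm
        (by have := hs.2.1; omega) hbad)
      (confidence_pos hm) (confidence_le_one hm) (k := m + 1 - A.length) (s := A) (S := S)
      (by omega) ⟨h, by simp, List.Subset.refl _⟩
    rw [List.length_cons, Nat.cast_add, Nat.cast_one, add_mul, one_mul,
      add_comm (_ * _) (ENNReal.ofReal _)]
    refine le_trans ?_ (add_le_add_left hfish _)
    refine wp_le_wp_add_const ((always_fishing_batch (ε := ε) (a := a) hm le_rfl hA h).mono ?_)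
    rintro ⟨H, A'⟩ S' c ⟨⟨h1, h2, h3⟩, h4, -⟩
    dsimp only at h1 h2 h3 h4 ⊢
    split_ifs with hfull
    · rw [wp_pure, ind_of_not (by simp)]
      exact zero_le
    · have hne : H ≠ m + 1 - A.length := by omega
      have hB' : ∀ a ∈ as, batchIndices m a * (m + batchSamples ε m a) ≤ B :=
        fun a ha => hB a (by simp [ha])
      rw [add_comm]
      refine le_trans ?_ (add_le_add_left (ih hB' (by omega) (by omega) h1) _)
      refine wp_le_wp_add_const ((always_firstPhaseRounds (ε := ε) hm hK as hB'
        (by omega) (by omega) h1).mono ?_)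
      rintro o S'' d ⟨-, g⟩
      refine le_trans (ind_mono ?_) (ind_or_le _ _)
      rintro ⟨A'', ho, a', ha', hu⟩
      rcases List.mem_cons.1 ha' with rfl | ha'
      · exact Or.inr ⟨hne, hu.anti (g A'' ho).2.2.2.1⟩
      · exact Or.inl ⟨A'', ho, a', ha', hu⟩

end FirstPhase

/-! ### The second phase -/

section SecondPhase

variable {n : ℕ} {P : PMF (Str n)}

/-- The invariant of the second phase: the members of `A` are different samples from `P`, every
member reaches its own leaf of the decision tree `T`, and there are no other leaves to reach. -/
structure TreeInv (P : PMF (Str n)) (S : List (Str n)) (A : List (Elem n)) (T : DTree n) :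
    Prop where
  support : ∀ x ∈ S, x ∈ P.support
  handle_lt : ∀ X ∈ A, X.handle < S.length
  nodup : (strs S A).Nodup
  eval_mem : ∀ s, T.eval s ∈ A
  eval_self : ∀ X ∈ A, T.eval (str S X.handle) = X
  depth_le : T.depth ≤ A.length

lemma strs_append_right {S : List (Str n)} {A : List (Elem n)} (hA : ∀ X ∈ A, X.handle < S.length)
    (xs : List (Str n)) : strs (S ++ xs) A = strs S A :=
  List.map_congr_left fun X hX => str_append_left (hA X hX) xs

lemma TreeInv.append_sample {S : List (Str n)} {A : List (Elem n)} {T : DTree n}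
    (h : TreeInv P S A T) {x : Str n} (hx : x ∈ P.support) : TreeInv P (S ++ [x]) A T where
  support := List.forall_mem_append.2 ⟨h.support, by simpa using hx⟩
  handle_lt X hX := by
    have := h.handle_lt X hX
    rw [List.length_append]
    omega
  nodup := by rw [strs_append_right h.handle_lt]; exact h.nodup
  eval_mem := h.eval_mem
  eval_self X hX := by rw [str_append_left (h.handle_lt X hX)]; exact h.eval_self X hX
  depth_le := h.depth_le

lemma TreeInv.notMem_boundedSupport {S : List (Str n)} {A : List (Elem n)} {T : DTree n}
    (h : TreeInv P S A T) {m : ℕ} (hm : m + 1 ≤ A.length) : P ∉ boundedSupport n m := by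
  refine HugeObject.notMem_boundedSupport h.nodup (fun x hx => ?_) (by simpa [strs] using hm)
  obtain ⟨X, hX, rfl⟩ := List.mem_map.1 hx
  exact str_mem_support h.support (h.handle_lt X hX)

/-- A sample that differs from the member at its leaf differs from all members, since the others
reach other leaves. -/
lemma TreeInv.insert {S : List (Str n)} {A : List (Elem n)} {T : DTree n}
    (h : TreeInv P S A T) {Y : Elem n} (hY : Y.handle < S.length) {j : Fin n} {b : Bool}
    (hb : str S Y.handle j = b) (hX : str S (T.eval (str S Y.handle)).handle j ≠ b) :
    TreeInv P S (A ++ [Y]) (T.insert (T.eval (str S Y.handle)) Y j b) where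
  support := h.support
  handle_lt := List.forall_mem_append.2 ⟨h.handle_lt, by simpa using hY⟩
  nodup := by
    rw [strs, List.map_append, List.nodup_append]
    refine ⟨h.nodup, by simp, ?_⟩
    rintro x hx y hy rfl
    obtain ⟨Z, hZ, hZx⟩ := List.mem_map.1 hx
    simp only [List.map_cons, List.map_nil, List.mem_singleton] at hy
    have h1 := h.eval_self Z hZ
    rw [hZx, hy] at h1
    rw [h1, hZx, hy] at hX
    exact hX hb
  eval_mem s := by
    have := h.eval_mem s
    rw [DTree.eval_insert]
    split_ifs <;> simp [this]
  eval_self Z hZ := by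
    rw [DTree.eval_insert]
    rcases List.mem_append.1 hZ with hZ | hZ
    · rw [h.eval_self Z hZ]
      split_ifs with h1 h2
      · rw [← h1] at hX
        exact absurd h2 hX
      · rfl
      · rfl
    · obtain rfl := List.mem_singleton.1 hZ
      rw [if_pos rfl, if_pos hb]
  depth_le := by
    have := DTree.depth_insert_le (T.eval (str S Y.handle)) Y j b T
    have := h.depth_le
    rw [List.length_append, List.length_singleton]
    omega

/-- For a list of distinguished members, the construction of the decision tree never fails to find
an index. -/
lemma always_extend {S : List (Str n)} (ys D : List (Elem n)) {T : DTree n}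
    (h : TreeInv P S D T) (hD : Inv P S (D ++ ys)) :
    Always P (DTree.extend ys T) (fun T' S' c => S' = S ∧ TreeInv P S (D ++ ys) T' ∧
      c ≤ ys.length * (D ++ ys).length) S := by
  induction ys generalizing D T with
  | nil => exact ⟨rfl, by simpa using h, Nat.zero_le _⟩
  | cons y ys ih =>
    rw [DTree.extend, always_bind]
    refine DTree.always_walk fun c hc => ?_
    set X := T.eval (str S y.handle) with hX
    have hXD : X ∈ D := h.eval_mem _
    have hy : y ∈ D ++ y :: ys := by simp
    have hc' : c ≤ (D ++ y :: ys).length := by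
      have := h.depth_le
      rw [List.length_append]
      omega
    split
    · rename_i jb hjb
      have h1 := List.mem_of_find?_eq_some hjb
      have h2 := List.find?_some hjb
      rw [decide_eq_true_eq] at h2
      have h3 := hD.view y hy jb h1
      have h4 := hD.view X (List.mem_append_left _ hXD) _ h2
      have hins := h.insert (Y := y) (hD.handle_lt y hy) (j := jb.1) (b := jb.2) h3.symm
        (by rw [← hX, ← h4]; simp)
      have hD' : Inv P S ((D ++ [y]) ++ ys) := by simpa using hD
      refine (ih (D ++ [y]) hins hD').mono ?_
      rintro T' S' d ⟨g1, g2, g3⟩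
      refine ⟨g1, by simpa using g2, ?_⟩
      rw [List.append_assoc, List.singleton_append] at g3
      rw [List.length_cons, Nat.add_mul]
      omega
    · rename_i hnone
      exfalso
      obtain ⟨j, b, h1, h2⟩ := (List.pairwise_append.1 hD.distinct).2.2 X hXD y (by simp)
      have := List.find?_eq_none.1 hnone _ h2
      simp [h1] at this

lemma find?_differ_eq_none {J : List (Fin n)} {x y : Str n} :
    (restr J y).find? (fun jb => decide ((jb.1, !jb.2) ∈ restr J x)) = none ↔
      ∀ j ∈ J, y j = x j := by
  rw [List.find?_eq_none]
  constructor
  · intro h j hj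
    by_contra hne
    refine h (j, y j) (mem_restr.2 ⟨hj, rfl⟩) ?_
    rw [decide_eq_true_eq, mem_restr]
    refine ⟨hj, ?_⟩
    revert hne
    dsimp only
    cases x j <;> cases y j <;> simp
  · rintro h ⟨j, b⟩ hjb hc
    rw [decide_eq_true_eq, mem_restr] at hc
    rw [mem_restr] at hjb
    have h1 := h j hjb.1
    rw [← h1, ← hjb.2] at hc
    simp at hc

lemma always_secondPhaseIteration [NeZero n] (m : ℕ) {i : ℕ} {S : List (Str n)}
    {A : List (Elem n)} {T : DTree n} (h : TreeInv P S A T) (hi : i < S.length) :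
    Always P (secondPhaseIteration n m i A T) (fun o S' c => S' = S ∧ TreeInv P S o.1 o.2 ∧
      (∃ B, o.1 = A ++ B ∧ B.length ≤ 1) ∧ c ≤ A.length + 2 * m) S := by
  unfold secondPhaseIteration
  rw [always_bind]
  refine always_chooseIndices fun J hJ => ?_
  rw [always_bind]
  refine DTree.always_walk fun c hc => ?_
  simp only [always_bind, always_queryAt]
  have hc' : 0 + (c + (J.length + (J.length + 0))) ≤ A.length + 2 * m := by
    have := h.depth_le
    omega
  split
  · rename_i jb hjb
    have h1 := mem_restr.1 (List.mem_of_find?_eq_some hjb)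
    have h2 := List.find?_some hjb
    rw [decide_eq_true_eq, mem_restr] at h2
    refine ⟨rfl, ?_, ⟨_, rfl, le_rfl⟩, hc'⟩
    exact h.insert (Y := ⟨i, restr J (str S i)⟩) hi h1.2.symm (by rw [← h2.2]; simp)
  · exact ⟨rfl, h, ⟨[], by simp, by simp⟩, hc'⟩

lemma always_secondPhase [NeZero n] (m N : ℕ) {S : List (Str n)} {A : List (Elem n)}
    {T : DTree n} (h : TreeInv P S A T) (hA : A.length ≤ m) :
    Always P (secondPhase n m N A T) (fun b _ c => (b = false → P ∉ boundedSupport n m) ∧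
      c ≤ N * (3 * m)) S := by
  induction N generalizing S A T with
  | zero => exact ⟨fun hc => by simp at hc, Nat.zero_le _⟩
  | succ N ih =>
    rw [secondPhase, always_bind, always_draw]
    intro x hx
    rw [always_bind]
    refine (always_secondPhaseIteration m (h.append_sample hx) (by simp)).mono ?_
    rintro ⟨A', T'⟩ S' c ⟨rfl, h1, -, h2⟩
    dsimp only at h1 ⊢
    split_ifs with hfull
    · refine ⟨fun _ => h1.notMem_boundedSupport hfull, ?_⟩
      rw [Nat.add_mul]
      omega
    · refine (ih h1 (by omega)).mono ?_
      rintro b S'' d ⟨g1, g2⟩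
      refine ⟨g1, ?_⟩
      rw [Nat.add_mul]
      omega

/-- Once no scale is uncovered, the mean distance from `A` still exceeds `ε / 2` when all distances
are truncated at `2^(-⌈lg m⌉-1)`, which is at most `1 / (2 * m)`. -/
lemma lt_mean_min_of_covered {ε : ℝ} {m : ℕ} (hm : 2 ≤ m) (hε : 0 < ε)
    (hP : ε < distToProperty P (boundedSupport n m)) {S : List (Str n)} {A : List (Elem n)}
    (hA : A.length ≤ m) (hcov : ∀ a ∈ List.range (⌈lg m⌉₊ + 1), ¬ Uncovered P ε m a A S)
    {near : Str n → Str n} (hnear : ∀ v, near v ∈ (strs S A).toFinset)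
    (hmin : ∀ v, ∀ x ∈ (strs S A).toFinset, strDist v (near v) ≤ strDist v x) :
    11 / 20 * ε ≤ mean P (fun v => min (strDist v (near v)) ((1 / 2) ^ (⌈lg m⌉₊ + 1))) := by
  have hlg := one_le_lg (x := m) (by exact_mod_cast hm)
  have h1 := lt_mean_min_add_sum_farProb hP ((List.toFinset_card_le _).trans
    (by simpa [strs] using hA)) hnear hmin (⌈lg m⌉₊ + 1)
  have h2 : ∑ a ∈ Finset.range (⌈lg m⌉₊ + 1), (1 / 2 : ℝ) ^ (a + 1) *
      farProb P a (strs S A).toFinset ≤ 9 / 20 * ε := by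
    have h3 : ∀ a ∈ Finset.range (⌈lg m⌉₊ + 1), (1 / 2 : ℝ) ^ (a + 1) *
        farProb P a (strs S A).toFinset ≤ 3 / 20 * ε / lg m := by
      intro a ha
      have h4 : farProb P a (strs S A).toFinset ≤ threshold ε m a :=
        (not_le.1 (hcov a (by simpa using ha))).le
      calc _ ≤ (1 / 2 : ℝ) ^ (a + 1) * threshold ε m a :=
            mul_le_mul_of_nonneg_left h4 (by positivity)
        _ = 3 / 20 * ε / lg m := by
            rw [threshold, one_div, inv_pow]
            field_simp
            ring
    refine (Finset.sum_le_card_nsmul _ _ _ h3).trans ?_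
    rw [Finset.card_range, nsmul_eq_mul]
    have h5 := Nat.ceil_lt_add_one (by linarith : 0 ≤ lg m)
    push_cast
    calc ((⌈lg m⌉₊ : ℝ) + 1) * (3 / 20 * ε / lg m) ≤ (3 * lg m) * (3 / 20 * ε / lg m) := by
          refine mul_le_mul_of_nonneg_right (by linarith) (by positivity)
      _ = 9 / 20 * ε := by
          field_simp
          norm_num
  linarith

lemma exp_neg_le {x : ℝ} (h0 : 0 ≤ x) (h1 : x ≤ 1) : Real.exp (-x) ≤ 1 - x / 2 := by
  rw [Real.exp_neg]
  have h2 := Real.add_one_le_exp x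
  rw [inv_le_comm₀ (Real.exp_pos x) (by linarith)]
  refine le_trans ?_ h2
  rw [inv_le_iff_one_le_mul₀ (by linarith)]
  nlinarith

lemma mul_half_pow_le_one {m : ℕ} (hm : 2 ≤ m) : (m : ℝ) * (1 / 2) ^ (⌈lg m⌉₊ + 1) ≤ 1 := by
  have hm0 : (0 : ℝ) < m := by positivity
  have h1 : (m : ℝ) ≤ 2 ^ ⌈lg m⌉₊ := by
    calc (m : ℝ) = 2 ^ lg m := by
          rw [lg, Real.rpow_logb (by norm_num) (by norm_num) hm0]
      _ ≤ 2 ^ (⌈lg m⌉₊ : ℝ) :=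
          Real.rpow_le_rpow_of_exponent_le (by norm_num) (Nat.le_ceil _)
      _ = 2 ^ ⌈lg m⌉₊ := Real.rpow_natCast _ _
  rw [one_div, inv_pow, ← div_eq_mul_inv, div_le_one (by positivity), pow_succ]
  have : (0 : ℝ) < 2 ^ ⌈lg m⌉₊ := by positivity
  linarith

/-- One iteration of the second phase adds a member to `A` with probability of order `m * ε`. -/
lemma ex_secondPhaseIteration_le [NeZero n] {ε : ℝ} {m : ℕ} (hm : 2 ≤ m) (hε : 0 < ε)
    (hP : ε < distToProperty P (boundedSupport n m)) {S : List (Str n)} {A : List (Elem n)}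
    {T : DTree n} (h : TreeInv P S A T) (hA : A.length ≤ m)
    (hcov : ∀ a ∈ List.range (⌈lg m⌉₊ + 1), ¬ Uncovered P ε m a A S) :
    (ex P fun y => wp P (secondPhaseIteration n m S.length A T) (fun o _ => 2⁻¹ ^ o.1.length)
      (S ++ [y])) ≤ 2⁻¹ ^ A.length * ENNReal.ofReal (1 - 11 / 80 * (m * ε)) := by
  have hmem : ∀ s, str S (T.eval s).handle ∈ (strs S A).toFinset := fun s =>
    List.mem_toFinset.2 (List.mem_map.2 ⟨_, h.eval_mem s, rfl⟩)
  obtain ⟨near, hnear, hmin⟩ := exists_near ⟨_, hmem fun _ => false⟩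
  have hmean := lt_mean_min_of_covered hm hε hP hA hcov hnear hmin
  set δ := (1 / 2 : ℝ) ^ (⌈lg m⌉₊ + 1)
  have hδ : m * δ ≤ 1 := mul_half_pow_le_one hm
  have hδ0 : 0 < δ := by positivity
  have hd0 : ∀ y, 0 ≤ min (strDist y (near y)) δ := fun y =>
    le_min (strDist_nonneg _ _) hδ0.le
  have hd1 : ∀ y, m * min (strDist y (near y)) δ ≤ 1 := fun y =>
    (mul_le_mul_of_nonneg_left (min_le_right _ _) (Nat.cast_nonneg m)).trans hδ
  have hiter : ∀ y, wp P (secondPhaseIteration n m S.length A T)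
      (fun o _ => 2⁻¹ ^ o.1.length) (S ++ [y]) ≤
      2⁻¹ ^ A.length * ENNReal.ofReal (1 - m * min (strDist y (near y)) δ / 4) := by
    intro y
    set X := T.eval y with hX
    have hXlt := h.handle_lt X (h.eval_mem y)
    have h1 : wp P (secondPhaseIteration n m S.length A T)
        (fun o _ => 2⁻¹ ^ o.1.length) (S ++ [y]) ≤
        ex (iid (PMF.uniformOfFintype (Fin n)) m) fun J =>
          2⁻¹ ^ A.length * (2⁻¹ + 2⁻¹ * ind (∀ j ∈ J.take m, y j = str S X.handle j)) := by
      unfold secondPhaseIteration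
      simp only [wp_bind, wp_chooseIndices, DTree.wp_walk, wp_queryAt, str_append_length,
        ← hX, str_append_left hXlt]
      refine ex_mono fun J hJ => ?_
      split
      · rw [wp_pure, List.length_append, List.length_singleton, pow_succ]
        gcongr
        exact le_self_add
      · rename_i hnone
        rw [wp_pure, List.take_of_length_le (length_of_mem_support_iid hJ).le,
          ind_of (find?_differ_eq_none.1 hnone), mul_one, ENNReal.inv_two_add_inv_two, mul_one]
    refine h1.trans ?_
    rw [ex_const_mul, ex_add, ex_const, ex_const_mul]
    gcongr
    have h2 : strDist y (near y) ≤ strDist y (str S X.handle) := hmin y _ (hmem y)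
    have h3 := ex_iid_agree_le ((min_le_left _ δ).trans h2) (le_refl m)
    refine (add_le_add_right (mul_le_mul_right h3 _) _).trans ?_
    rw [← ENNReal.ofReal_ofNat 2, ← ENNReal.ofReal_inv_of_pos (by norm_num),
      ← ENNReal.ofReal_mul (by norm_num), ← ENNReal.ofReal_add (by norm_num) (by positivity)]
    refine ENNReal.ofReal_le_ofReal ?_
    have h4 := exp_neg_le (mul_nonneg (Nat.cast_nonneg m) (hd0 y)) (hd1 y)
    rw [mul_comm (min _ _)]
    linarith
  refine (ex_mono fun y _ => hiter y).trans ?_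
  rw [ex_const_mul, ex_ofReal P fun y => by linarith [hd1 y]]
  gcongr
  have h5 : mean P (fun y => 1 - m * min (strDist y (near y)) δ / 4) =
      1 + -(m / 4) * mean P fun y => min (strDist y (near y)) δ := by
    rw [← mean_const_mul, ← mean_const P 1, ← mean_add]
    refine congrArg (mean P) (funext fun y => ?_)
    rw [mean_const]
    ring
  rw [h5]
  have hm0 : (0 : ℝ) ≤ m := Nat.cast_nonneg m
  nlinarith [mul_le_mul_of_nonneg_left hmean hm0]

/-- The expectation of `2^(-|A|)` shrinks in every iteration, but never below `2^(-m)` in an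
accepting run. -/
lemma wp_secondPhase_le [NeZero n] {ε : ℝ} {m : ℕ} (hm : 2 ≤ m) (hε : 0 < ε)
    (hP : ε < distToProperty P (boundedSupport n m)) (N : ℕ) {S : List (Str n)}
    {A : List (Elem n)} {T : DTree n} (h : TreeInv P S A T) (hA : A.length ≤ m)
    (hcov : ∀ a ∈ List.range (⌈lg m⌉₊ + 1), ¬ Uncovered P ε m a A S) :
    wp P (secondPhase n m N A T) (fun b _ => ind (b = true)) S ≤
      2 ^ m * ENNReal.ofReal (1 - 11 / 80 * (m * ε)) ^ N * 2⁻¹ ^ A.length := by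
  induction N generalizing S A T with
  | zero =>
    rw [secondPhase, wp_pure, ind_of rfl, pow_zero, mul_one]
    obtain ⟨d, rfl⟩ := Nat.exists_eq_add_of_le hA
    rw [pow_add, mul_right_comm, ← mul_pow, ENNReal.mul_inv_cancel (by simp) (by simp), one_pow,
      one_mul]
    exact one_le_pow₀ (by norm_num)
  | succ N ih =>
    rw [secondPhase, wp_bind, wp_draw]
    simp only [wp_bind]
    set r := ENNReal.ofReal (1 - 11 / 80 * (m * ε))
    have h1 := mul_le_mul_right (ex_secondPhaseIteration_le hm hε hP h hA hcov) (2 ^ m * r ^ N)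
    rw [← ex_const_mul] at h1
    simp only [← wp_const_mul] at h1
    refine le_trans (ex_mono fun y hy => ?_) (h1.trans_eq (by rw [pow_succ]; ring))
    have hinv := h.append_sample hy
    refine wp_mono_of_always ((always_secondPhaseIteration m hinv (by simp)).mono ?_)
    rintro ⟨A', T'⟩ S' c ⟨rfl, g1, ⟨B, g2, -⟩, -⟩
    dsimp only at g1 g2 ⊢
    split_ifs with hfull
    · rw [wp_pure, ind_of_not (by simp)]
      exact zero_le
    · refine ih g1 (by omega) fun a ha hu => hcov a ha (hu.anti ?_)
      rw [← strs_append_right h.handle_lt [y], g2, strs, strs, List.map_append]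
      exact List.subset_append_left _ _

end SecondPhase

/-! ### The adaptive test for small distances -/

section Adaptive

variable {n : ℕ} {P : PMF (Str n)}

lemma inv_singleton {x : Str n} (hx : x ∈ P.support) :
    Inv P [x] [(⟨([] : List (Str n)).length, []⟩ : Elem n)] where
  support := by simpa using hx
  handle_lt := by simp
  view := by simp
  distinct := List.pairwise_singleton _ _

lemma treeInv_leaf {S : List (Str n)} {X : Elem n} {A : List (Elem n)} (h : Inv P S (X :: A)) :
    TreeInv P S [X] (DTree.leaf X) where
  support := h.support
  handle_lt := by simpa using h.handle_lt X (by simp)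
  nodup := by simp [strs]
  eval_mem s := by simp [DTree.eval]
  eval_self := by simp [DTree.eval]
  depth_le := Nat.zero_le _

lemma always_adaptiveTest [NeZero n] {ε : ℝ} {m B K : ℕ} (hm : 2 ≤ m)
    (hε : ε < 1 / (m : ℝ) ^ 2)
    (hK : ∀ k, 0 < k → k ≤ m → checkpoint k (1 / 3) (confidence m) 2 ≤ K)
    (hB : ∀ a ∈ List.range (⌈lg m⌉₊ + 1),
      batchIndices m a * (m + batchSamples ε m a) ≤ B) :
    Always P (adaptiveTest n ε m) (fun b _ c => (b = false → P ∉ boundedSupport n m) ∧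
      c ≤ B * ((⌈lg m⌉₊ + 1) * K + 12 * (m + 1)) + m * m + ⌈48 * ε⁻¹⌉₊ * (3 * m)) [] := by
  rw [adaptiveTest, if_neg (not_le.2 hε), always_bind, always_draw]
  intro x hx
  rw [firstPhase, always_bind]
  refine (always_firstPhaseRounds hm hK _ hB (by simp) (by simp; omega)
    (inv_singleton hx)).mono ?_
  rintro o S c ⟨h1, h2⟩
  rw [List.length_range] at h1 h2
  match o, h1, h2 with
  | none, h1, h2 =>
    obtain ⟨h3, h4⟩ := h1 rfl
    exact ⟨fun _ => h3, by omega⟩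
  | some [], h1, h2 =>
    have := (h2 [] rfl).2.1
    simp at this
  | some (X :: A), h1, h2 =>
    obtain ⟨h3, -, h4, -, h5⟩ := h2 _ rfl
    have h6 : B * ((⌈lg m⌉₊ + 1) * K + 12 * (X :: A).length) ≤
        B * ((⌈lg m⌉₊ + 1) * K + 12 * (m + 1)) := Nat.mul_le_mul_left _ (by omega)
    dsimp only
    rw [always_bind]
    refine (always_extend A [X] (treeInv_leaf h3) h3).mono ?_
    rintro T S' d ⟨rfl, g1, g2⟩
    have g3 : d ≤ m * m := by
      refine g2.trans (Nat.mul_le_mul ?_ h4)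
      rw [List.length_cons] at h4
      omega
    refine (always_secondPhase m _ g1 h4).mono ?_
    rintro b S'' e ⟨k1, k2⟩
    exact ⟨k1, by omega⟩

lemma wp_adaptiveTest_lt [NeZero n] {ε : ℝ} {m : ℕ} (hm : 2 ≤ m) (hε0 : 0 < ε)
    (hε : ε < 1 / (m : ℝ) ^ 2) (hP : ε < distToProperty P (boundedSupport n m)) {B K : ℕ}
    (hK : ∀ k, 0 < k → k ≤ m → checkpoint k (1 / 3) (confidence m) 2 ≤ K)
    (hB : ∀ a ∈ List.range (⌈lg m⌉₊ + 1),
      batchIndices m a * (m + batchSamples ε m a) ≤ B) :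
    wp P (adaptiveTest n ε m) (fun b _ => ind (b = true)) [] < 1 / 3 := by
  have hm' : (2 : ℝ) ≤ m := by exact_mod_cast hm
  have hlg := one_le_lg hm'
  set r := ENNReal.ofReal (1 - 11 / 80 * (m * ε)) with hr
  set e : ℝ≥0∞ := 2 ^ m * r ^ ⌈48 * ε⁻¹⌉₊ with he
  have hmain : wp P (adaptiveTest n ε m) (fun b _ => ind (b = true)) [] ≤
      ENNReal.ofReal (1 / 4) + e := by
    rw [adaptiveTest, if_neg (not_le.2 hε), wp_bind, wp_draw]
    refine (ex_mono fun x hx => ?_).trans_eq (ex_const P _)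
    rw [firstPhase, wp_bind]
    have h1 := wp_firstPhaseRounds_le hε0 hm hK _ hB (by simp) (by simp; omega)
      (inv_singleton hx)
    have h2 : ((List.range (⌈lg m⌉₊ + 1)).length : ℝ≥0∞) * ENNReal.ofReal (confidence m) =
        ENNReal.ofReal (1 / 4) := by
      have h3 : ⌈lg m + 1⌉₊ = ⌈lg m⌉₊ + 1 := Nat.ceil_add_one (by linarith)
      rw [List.length_range, confidence, h3, ← ENNReal.ofReal_natCast,
        ← ENNReal.ofReal_mul (Nat.cast_nonneg _)]
      congr 1
      field_simp
    rw [h2] at h1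
    refine le_trans ?_ (add_le_add_left h1 e)
    refine wp_le_wp_add_const ((always_firstPhaseRounds hm hK _ hB (by simp) (by simp; omega)
      (inv_singleton hx)).mono ?_)
    rintro o S c ⟨-, h2⟩
    match o, h2 with
    | none, h2 =>
      rw [wp_pure, ind_of_not (by simp)]
      exact zero_le
    | some [], h2 =>
      have := (h2 [] rfl).2.1
      simp at this
    | some (X :: A), h2 =>
      obtain ⟨h3, -, h4, -, -⟩ := h2 _ rfl
      dsimp only
      by_cases hu : ∃ a ∈ List.range (⌈lg m⌉₊ + 1), Uncovered P ε m a (X :: A) S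
      · rw [ind_of ⟨_, rfl, hu⟩]
        refine le_add_right ?_
        exact (wp_mono _ fun _ _ => ind_le_one _).trans_eq (wp_const _ _ _)
      · push Not at hu
        refine le_add_left ?_
        rw [wp_bind]
        refine le_trans (wp_mono_of_always (g := fun _ _ => e) ?_) (wp_const _ _ _).le
        refine (always_extend A [X] (treeInv_leaf h3) h3).mono ?_
        rintro T S' d ⟨rfl, g1, -⟩
        refine (wp_secondPhase_le hm hε0 hP _ g1 h4 hu).trans ?_
        refine (mul_le_mul_right (pow_le_one₀ zero_le ?_) _).trans_eq (mul_one _)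
        exact ENNReal.inv_le_one.2 (by norm_num)
  refine hmain.trans_lt ?_
  have hmε : (m : ℝ) * ε ≤ 1 := by
    have h1 : (m : ℝ) ^ 2 * ε ≤ 1 := by
      rw [lt_div_iff₀ (by positivity)] at hε
      linarith
    nlinarith
  have h1 : e ≤ ENNReal.ofReal (Real.exp (-2) * Real.exp (-2)) := by
    have h2 := ofReal_one_sub_pow_le (d := 11 / 80 * (m * ε)) (by linarith) ⌈48 * ε⁻¹⌉₊
    rw [he]
    refine (mul_le_mul_right h2 _).trans ?_
    rw [← ENNReal.ofReal_ofNat 2, ← ENNReal.ofReal_pow (by norm_num),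
      ← ENNReal.ofReal_mul (by positivity)]
    refine ENNReal.ofReal_le_ofReal ?_
    have h3 : (2 : ℝ) ^ m ≤ Real.exp m := by
      rw [← mul_one (m : ℝ), Real.exp_nat_mul]
      exact pow_le_pow_left₀ (by norm_num) (by linarith [Real.add_one_le_exp 1]) m
    have h4 : 6 * (m : ℝ) ≤ 11 / 80 * (m * ε) * ⌈48 * ε⁻¹⌉₊ := by
      calc 6 * (m : ℝ) ≤ 11 / 80 * (m * ε) * (48 * ε⁻¹) := by
            field_simp
            norm_num
        _ ≤ _ := mul_le_mul_of_nonneg_left (Nat.le_ceil _) (by positivity)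
    calc (2 : ℝ) ^ m * Real.exp (-(11 / 80 * (m * ε) * ⌈48 * ε⁻¹⌉₊)) ≤
          Real.exp m * Real.exp (-(6 * m)) :=
          mul_le_mul h3 (Real.exp_le_exp.2 (neg_le_neg h4)) (Real.exp_pos _).le
            (Real.exp_pos _).le
      _ ≤ Real.exp (-2) * Real.exp (-2) := by
          rw [← Real.exp_add, ← Real.exp_add]
          exact Real.exp_le_exp.2 (by linarith)
  refine (add_le_add_right h1 _).trans_lt ?_
  have h5 := exp_neg_two_le
  rw [← ENNReal.ofReal_add (by norm_num) (by positivity)]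
  refine (ENNReal.ofReal_lt_iff_lt_toReal (by positivity) (by finiteness)).2 ?_
  rw [ENNReal.toReal_div, ENNReal.toReal_one, ENNReal.toReal_ofNat]
  nlinarith [Real.exp_pos (-2)]

/-! ### The number of queries of the adaptive test -/

lemma lg_le_two_mul {x : ℝ} (hx : 0 < x) : lg x ≤ 2 * x := by
  have h1 := Real.log_le_sub_one_of_pos hx
  have h2 := Real.log_two_gt_d9
  rw [lg, Real.logb, div_le_iff₀ (by linarith)]
  nlinarith

lemma lg_sq_le {x : ℝ} (hx : 1 ≤ x) : lg x ^ 2 ≤ 16 * x := by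
  have h0 : 0 ≤ lg x := Real.logb_nonneg (by norm_num) hx
  have h1 : lg x = 2 * lg (√x) := by
    rw [lg, lg, Real.logb, Real.logb, Real.log_sqrt (by linarith)]
    ring
  have h2 := lg_le_two_mul (Real.sqrt_pos.2 (by linarith : 0 < x))
  have h3 : lg x ≤ 4 * √x := by linarith
  calc lg x ^ 2 ≤ (4 * √x) ^ 2 := pow_le_pow_left₀ h0 h3 2
    _ = 16 * x := by
        rw [mul_pow, Real.sq_sqrt (by linarith)]
        norm_num

lemma checkpoint_two_le {m k : ℕ} (hm : 2 ≤ m) (hk : 0 < k) (hkm : k ≤ m) :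
    checkpoint k (1 / 3) (confidence m) 2 ≤ ⌊421 * lg m⌋₊ := by
  have hlg := one_le_lg (x := m) (by exact_mod_cast hm)
  have hk1 : (1 : ℝ) ≤ k := by exact_mod_cast hk
  have hlgk : 0 ≤ lg k := Real.logb_nonneg (by norm_num) hk1
  have hlgkm : lg k ≤ lg m :=
    Real.logb_le_logb_of_le (by norm_num) (by linarith) (by exact_mod_cast hkm)
  refine Nat.le_floor ?_
  rw [checkpoint, if_neg (by norm_num)]
  have h1 : lg (confidence m)⁻¹ ≤ 24 * lg m := by
    have h2 := Nat.ceil_lt_add_one (by linarith : 0 ≤ lg m + 1)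
    rw [confidence, one_div, inv_inv]
    refine (lg_le_two_mul ?_).trans ?_
    · have : 0 < ⌈lg m + 1⌉₊ := Nat.ceil_pos.2 (by linarith)
      positivity
    · linarith
  have h3 : lg (lg k + 1) ≤ 4 * lg m := (lg_le_two_mul (by linarith)).trans (by linarith)
  have h4 : max ((2 : ℝ) ^ 2) (5 * (lg (confidence m)⁻¹ + lg (lg k + 1))) ≤ 140 * lg m :=
    max_le (by linarith) (by linarith)
  have h5 : (0 : ℝ) ≤ max ((2 : ℝ) ^ 2) (5 * (lg (confidence m)⁻¹ + lg (lg k + 1))) :=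
    le_max_of_le_left (by norm_num)
  refine (Nat.ceil_lt_add_one (by positivity)).le.trans ?_
  rw [show ((1 : ℝ) / 3)⁻¹ = 3 by norm_num]
  linarith

lemma sq_lt_inv {ε : ℝ} {m : ℕ} (hε0 : 0 < ε) (hε : ε < 1 / (m : ℝ) ^ 2) :
    (m : ℝ) ^ 2 < ε⁻¹ := by
  rw [one_div] at hε
  exact (lt_inv_comm₀ hε0 (inv_pos.1 (hε0.trans hε))).1 hε

lemma batch_cost_le {ε : ℝ} {m a : ℕ} (hm : 2 ≤ m) (hε0 : 0 < ε) (hε : ε < 1 / (m : ℝ) ^ 2)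
    (ha : a ∈ List.range (⌈lg m⌉₊ + 1)) :
    batchIndices m a * (m + batchSamples ε m a) ≤ ⌊35 * ε⁻¹ * lg m ^ 2⌋₊ := by
  have hm' : (2 : ℝ) ≤ m := by exact_mod_cast hm
  have hlg := one_le_lg hm'
  have hεm := sq_lt_inv hε0 hε
  have hscale : (2 : ℝ) ^ a ≤ 2 * m := by
    have h1 : a ≤ ⌈lg m⌉₊ := by
      rw [List.mem_range] at ha
      omega
    have h2 : (a : ℝ) ≤ lg m + 1 := by
      have h3 := Nat.ceil_lt_add_one (by linarith : 0 ≤ lg m)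
      have h4 : (a : ℝ) ≤ ⌈lg m⌉₊ := by exact_mod_cast h1
      linarith
    calc (2 : ℝ) ^ a = 2 ^ (a : ℝ) := (Real.rpow_natCast _ _).symm
      _ ≤ 2 ^ (lg m + 1) := Real.rpow_le_rpow_of_exponent_le (by norm_num) h2
      _ = 2 * m := by
          rw [Real.rpow_add (by norm_num), lg, Real.rpow_logb (by norm_num) (by norm_num)
            (by linarith), Real.rpow_one, mul_comm]
  have ha1 : (1 : ℝ) ≤ 2 ^ a := one_le_pow₀ (by norm_num)
  refine Nat.le_floor ?_
  push_cast
  have h1 : (batchIndices m a : ℝ) ≤ 5 * 2 ^ a * lg m := by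
    refine (Nat.ceil_lt_add_one (by positivity)).le.trans ?_
    rw [pow_add]
    nlinarith
  have h2 : (batchSamples ε m a : ℝ) ≤ 5 / 2 ^ a * ε⁻¹ * lg m := by
    refine (Nat.ceil_lt_add_one (by positivity)).le.trans ?_
    have h3 : 1 ≤ 1 / 2 ^ a * ε⁻¹ * lg m := by
      have h4 : 1 ≤ 1 / 2 ^ a * ε⁻¹ := by
        rw [one_div, ← div_eq_inv_mul, one_le_div (by positivity)]
        nlinarith
      nlinarith
    have h5 : 5 / 2 ^ a * ε⁻¹ * lg m =
      4 / 2 ^ a * ε⁻¹ * lg m + 1 / 2 ^ a * ε⁻¹ * lg m := by ring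
    linarith
  calc (batchIndices m a : ℝ) * (m + batchSamples ε m a) ≤
        (5 * 2 ^ a * lg m) * (m + 5 / 2 ^ a * ε⁻¹ * lg m) := by gcongr
    _ = 5 * 2 ^ a * lg m * m + 25 * ε⁻¹ * lg m ^ 2 := by
        field_simp
        ring
    _ ≤ 5 * (2 * m) * lg m * m + 25 * ε⁻¹ * lg m ^ 2 := by gcongr
    _ ≤ 35 * ε⁻¹ * lg m ^ 2 := by
        have h6 : (m : ℝ) ^ 2 * lg m ≤ ε⁻¹ * lg m ^ 2 := by
          rw [pow_two (lg m), ← mul_assoc]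
          nlinarith [mul_le_mul_of_nonneg_right hεm.le (by linarith : 0 ≤ lg m),
            mul_nonneg (sq_nonneg (m : ℝ)) (by linarith : 0 ≤ lg m)]
        nlinarith

lemma adaptive_cost_le {ε : ℝ} {m : ℕ} (hm : 2 ≤ m) (hε0 : 0 < ε)
    (hε : ε < 1 / (m : ℝ) ^ 2) :
    ((⌊35 * ε⁻¹ * lg m ^ 2⌋₊ * ((⌈lg m⌉₊ + 1) * ⌊421 * lg m⌋₊ + 12 * (m + 1)) + m * m +
      ⌈48 * ε⁻¹⌉₊ * (3 * m) : ℕ) : ℝ) ≤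
      1000000 * (ε⁻¹ * m * lg m * min (max 1 (lg ε⁻¹)) (lg m)) := by
  have hm' : (2 : ℝ) ≤ m := by exact_mod_cast hm
  have hlg := one_le_lg hm'
  have hεm := sq_lt_inv hε0 hε
  have hmin : min (max 1 (lg ε⁻¹)) (lg m) = lg m := by
    refine min_eq_right (le_max_of_le_right ?_)
    refine Real.logb_le_logb_of_le (by norm_num) (by linarith) ?_
    nlinarith
  rw [hmin]
  have hL : ((⌈lg m⌉₊ : ℝ) + 1) ≤ 3 * lg m := by
    have := Nat.ceil_lt_add_one (by linarith : 0 ≤ lg m)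
    linarith
  have hK := Nat.floor_le (by linarith : 0 ≤ 421 * lg m)
  have hB := Nat.floor_le (by positivity : 0 ≤ 35 * ε⁻¹ * lg m ^ 2)
  have hN := (Nat.ceil_lt_add_one (by positivity : 0 ≤ 48 * ε⁻¹)).le
  have hsq := lg_sq_le (by linarith : (1 : ℝ) ≤ m)
  push_cast
  have h1 : ((⌈lg m⌉₊ : ℝ) + 1) * ⌊421 * lg m⌋₊ + 12 * (m + 1) ≤ 20230 * m := by
    have h2 : ((⌈lg m⌉₊ : ℝ) + 1) * ⌊421 * lg m⌋₊ ≤ (3 * lg m) * (421 * lg m) := by gcongr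
    nlinarith
  have h3 : (⌊35 * ε⁻¹ * lg m ^ 2⌋₊ : ℝ) *
      (((⌈lg m⌉₊ : ℝ) + 1) * ⌊421 * lg m⌋₊ + 12 * (m + 1)) ≤
      (35 * ε⁻¹ * lg m ^ 2) * (20230 * m) := by gcongr
  set M := ε⁻¹ * m with hM
  have hM1 : (m : ℝ) ≤ M := by nlinarith
  have hM0 : 0 ≤ M := by linarith
  have hlg2 : 1 ≤ lg m ^ 2 := one_le_pow₀ hlg
  have h4 : (m : ℝ) * m ≤ M := by nlinarith
  have h5 : (⌈48 * ε⁻¹⌉₊ : ℝ) * (3 * m) ≤ 147 * M := by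
    have : (⌈48 * ε⁻¹⌉₊ : ℝ) * (3 * m) ≤ (48 * ε⁻¹ + 1) * (3 * m) := by gcongr
    nlinarith
  have h6 : M ≤ M * lg m ^ 2 := by nlinarith
  calc _ ≤ (35 * ε⁻¹ * lg m ^ 2) * (20230 * m) + M + 147 * M := by linarith
    _ = 708050 * (M * lg m ^ 2) + 148 * M := by rw [hM]; ring
    _ ≤ 1000000 * (M * lg m ^ 2) := by nlinarith
    _ = _ := by ring

end Adaptive

/-! ### Samples of several scales -/

section Tagged

variable {n : ℕ} {P : PMF (Str n)}

/-- Independent samples of `P`, one for every scale in a list, together with their scales. -/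
def tagged (P : PMF (Str n)) : List ℕ → PMF (List (ℕ × Str n))
  | [] => PMF.pure []
  | a :: l => P.bind fun x => (tagged P l).map ((a, x) :: ·)

lemma ex_tagged_nil (f : List (ℕ × Str n) → ℝ≥0∞) : ex (tagged P []) f = f [] := ex_pure _ _

lemma ex_tagged_cons (a : ℕ) (l : List ℕ) (f : List (ℕ × Str n) → ℝ≥0∞) :
    ex (tagged P (a :: l)) f = ex P fun x => ex (tagged P l) fun xs => f ((a, x) :: xs) := by
  simp only [tagged, ex_bind, ex_map]

lemma ex_tagged_append (l₁ l₂ : List ℕ) (f : List (ℕ × Str n) → ℝ≥0∞) :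
    ex (tagged P (l₁ ++ l₂)) f =
      ex (tagged P l₁) fun xs => ex (tagged P l₂) fun ys => f (xs ++ ys) := by
  induction l₁ generalizing f with
  | nil => simp [ex_tagged_nil]
  | cons a l ih => simp only [List.cons_append, ex_tagged_cons, ih]

lemma ex_tagged_replicate (a N : ℕ) (f : List (ℕ × Str n) → ℝ≥0∞) :
    ex (tagged P (List.replicate N a)) f = ex (iid P N) fun xs => f (xs.map (Prod.mk a)) := by
  induction N generalizing f with
  | zero => simp [ex_tagged_nil, iid, ex_pure]
  | succ N ih => simp only [List.replicate_succ, ex_tagged_cons, ih, iid, ex_bind, ex_map,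
      List.map_cons]

lemma map_fst_of_mem_support_tagged {l : List ℕ} {xs : List (ℕ × Str n)}
    (h : xs ∈ (tagged P l).support) : xs.map Prod.fst = l := by
  induction l generalizing xs with
  | nil => simp_all [tagged]
  | cons a l ih =>
    simp only [tagged, PMF.mem_support_bind_iff, PMF.mem_support_map_iff] at h
    obtain ⟨x, -, xs', h', rfl⟩ := h
    simp [ih h']

/-- The order in which independent samples are drawn is irrelevant. -/
lemma ex_tagged_perm {l l' : List ℕ} (h : l.Perm l') {f : List (ℕ × Str n) → ℝ≥0∞}
    (hf : ∀ xs ys, xs.Perm ys → f xs = f ys) : ex (tagged P l) f = ex (tagged P l') f := by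
  induction h generalizing f with
  | nil => rfl
  | cons a _ ih =>
    simp only [ex_tagged_cons]
    congr 1
    funext x
    exact ih fun xs ys hxy => hf _ _ (hxy.cons _)
  | swap a b l =>
    simp only [ex_tagged_cons]
    rw [ex_comm]
    congr! 6
    exact hf _ _ (List.Perm.swap _ _ _)
  | trans _ _ ih₁ ih₂ => exact (ih₁ hf).trans (ih₂ hf)

/-- The views of the elements that are collected are those of samples of the given scales, where
the samples of scale `a` are queried at `I a`. -/
def Collects (P : PMF (Str n)) (I : ℕ → List (Fin n)) (𝒜 : Alg n (List (Elem n)))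
    (l : List ℕ) : Prop :=
  ∀ (g : List (List (Fin n × Bool)) → ℝ≥0∞) (S : List (Str n)),
    wp P 𝒜 (fun E _ => g (E.map Elem.view)) S =
      ex (tagged P l) fun xs => g (xs.map fun p => restr (I p.1) p.2)

lemma collects_takeSamples (I : ℕ → List (Fin n)) (a N : ℕ) :
    Collects P I (takeSamples (I a) N) (List.replicate N a) := by
  intro g S
  simp only [wp_takeSamples, ex_tagged_replicate, map_view_sampleElems, List.map_map]
  rfl

lemma collects_collect {ι : Type} {I : ℕ → List (Fin n)} {f : ι → Alg n (List (Elem n))}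
    {l : ι → List ℕ} (h : ∀ i, Collects P I (f i) (l i)) (is : List ι) :
    Collects P I (collect f is) (is.flatMap l) := by
  induction is with
  | nil => exact fun g S => by simp [collect, ex_tagged_nil]
  | cons i is ih =>
    intro g S
    simp only [collect, wp_bind, wp_pure, List.map_append, List.flatMap_cons, ex_tagged_append]
    have h1 : ∀ v : List (List (Fin n × Bool)), ∀ S,
        wp P (collect f is) (fun E _ => g (v ++ E.map Elem.view)) S =
        ex (tagged P (is.flatMap l)) fun xs => g (v ++ xs.map fun p => restr (I p.1) p.2) :=
      fun v S => ih (fun w => g (v ++ w)) S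
    simp only [h1]
    exact h i (fun v => ex (tagged P (is.flatMap l)) fun xs =>
      g (v ++ xs.map fun p => restr (I p.1) p.2)) S

end Tagged

/-! ### Greedy choice of distant samples -/

section Greedy

variable {n : ℕ} {P : PMF (Str n)}

/-- The set of strings in a list of tagged samples. -/
def strings (A : List (ℕ × Str n)) : Finset (Str n) := (A.map Prod.snd).toFinset

open Classical in
/-- Go through a list of tagged samples and add a sample to `A` if it is far, at its own scale,
from all strings that are already there. -/
def greedy : List (ℕ × Str n) → List (ℕ × Str n) → List (ℕ × Str n)
  | A, [] => A
  | A, (a, x) :: xs => if Far a (strings A) x then greedy (A ++ [(a, x)]) xs else greedy A xs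

lemma exists_greedy_eq_append (A xs : List (ℕ × Str n)) :
    ∃ B, greedy A xs = A ++ B ∧ ∀ p ∈ B, p ∈ xs := by
  induction xs generalizing A with
  | nil => exact ⟨[], by simp [greedy], by simp⟩
  | cons p xs ih =>
    obtain ⟨a, x⟩ := p
    rw [greedy]
    split_ifs
    · obtain ⟨B, h1, h2⟩ := ih (A ++ [(a, x)])
      refine ⟨(a, x) :: B, by simp [h1], ?_⟩
      intro p hp
      rcases List.mem_cons.1 hp with rfl | hp
      · simp
      · exact List.mem_cons_of_mem _ (h2 p hp)
    · obtain ⟨B, h1, h2⟩ := ih A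
      exact ⟨B, h1, fun p hp => List.mem_cons_of_mem _ (h2 p hp)⟩

lemma strings_subset_greedy (A xs : List (ℕ × Str n)) : strings A ⊆ strings (greedy A xs) := by
  obtain ⟨B, h, -⟩ := exists_greedy_eq_append A xs
  intro x hx
  rw [strings, List.mem_toFinset] at *
  rw [h, List.map_append]
  exact List.mem_append_left _ hx

/-- The later sample has the coarser scale, and is far at this scale from the earlier one. -/
def Separated (p q : ℕ × Str n) : Prop := q.1 ≤ p.1 ∧ (1 / 2 : ℝ) ^ (q.1 + 1) < strDist q.2 p.2

lemma pairwise_greedy {A xs : List (ℕ × Str n)} (hA : A.Pairwise Separated)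
    (hxs : (xs.map Prod.fst).Pairwise (· ≥ ·)) (hAx : ∀ p ∈ A, ∀ q ∈ xs, q.1 ≤ p.1) :
    (greedy A xs).Pairwise Separated := by
  induction xs generalizing A with
  | nil => exact hA
  | cons q xs ih =>
    obtain ⟨a, x⟩ := q
    rw [List.map_cons, List.pairwise_cons] at hxs
    rw [greedy]
    split_ifs with hfar
    · refine ih ?_ hxs.2 ?_
      · refine List.pairwise_append.2 ⟨hA, List.pairwise_singleton _ _, ?_⟩
        intro p hp q hq
        rw [List.mem_singleton] at hq
        subst hq
        exact ⟨hAx p hp _ (by simp), hfar _ (List.mem_toFinset.2 (List.mem_map_of_mem hp))⟩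
      · intro p hp q hq
        rcases List.mem_append.1 hp with hp | hp
        · exact hAx p hp q (List.mem_cons_of_mem _ hq)
        · rw [List.mem_singleton] at hp
          subst hp
          exact hxs.1 _ (List.mem_map_of_mem hq)
    · exact ih hA hxs.2 fun p hp q hq => hAx p hp q (List.mem_cons_of_mem _ hq)

lemma ex_far_weight (a : ℕ) (A : Finset (Str n)) :
    (ex P fun x => 2⁻¹ + 2⁻¹ * ind (¬ Far a A x)) ≤
      ENNReal.ofReal (Real.exp (-(1 / 2 * farProb P a A))) := by
  rw [ex_add, ex_const, ex_const_mul, ex_ind_not_far, ← ENNReal.ofReal_ofNat 2,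
    ← ENNReal.ofReal_inv_of_pos (by norm_num), ← ENNReal.ofReal_mul (by norm_num),
    ← ENNReal.ofReal_add (by norm_num) (by linarith [farProb_le_one P a A])]
  refine ENNReal.ofReal_le_ofReal ?_
  have := Real.add_one_le_exp (-(1 / 2 * farProb P a A))
  linarith

/-- As long as the final set leaves samples far with large probability, so do all earlier sets, and
the greedy choice is likely to have succeeded more often. -/
lemma ex_greedy_le (m : ℕ) (l : List ℕ) (A : List (ℕ × Str n)) :
    (ex (tagged P l) fun xs => ind ((greedy A xs).length ≤ m) *
      ENNReal.ofReal (Real.exp (1 / 2 * (l.map fun a =>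
        farProb P a (strings (greedy A xs))).sum))) ≤ 2 ^ m * 2⁻¹ ^ A.length := by
  induction l generalizing A with
  | nil =>
    rw [ex_tagged_nil, greedy]
    simp only [List.map_nil, List.sum_nil, mul_zero, Real.exp_zero, ENNReal.ofReal_one, mul_one]
    by_cases hA : A.length ≤ m
    · obtain ⟨d, rfl⟩ := Nat.exists_eq_add_of_le hA
      rw [ind_of hA, pow_add, mul_right_comm, ← mul_pow, ENNReal.mul_inv_cancel (by simp)
        (by simp), one_pow, one_mul]
      exact one_le_pow₀ (by norm_num)
    · rw [ind_of_not hA]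
      exact zero_le
  | cons a l ih =>
    rw [ex_tagged_cons]
    set e := ENNReal.ofReal (Real.exp (1 / 2 * farProb P a (strings A))) with he
    have h1 : ∀ x, (ex (tagged P l) fun xs => ind ((greedy A ((a, x) :: xs)).length ≤ m) *
        ENNReal.ofReal (Real.exp (1 / 2 * ((a :: l).map fun i =>
          farProb P i (strings (greedy A ((a, x) :: xs)))).sum))) ≤
        e * (2 ^ m * 2⁻¹ ^ A.length) * (2⁻¹ + 2⁻¹ * ind (¬ Far a (strings A) x)) := by
      intro x
      classical
      set A' := if Far a (strings A) x then A ++ [(a, x)] else A with hA'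
      have hgreedy : ∀ xs, greedy A ((a, x) :: xs) = greedy A' xs := by
        intro xs
        rw [greedy, hA']
        split_ifs <;> rfl
      have hsub : ∀ xs, strings A ⊆ strings (greedy A' xs) := fun xs =>
        hgreedy xs ▸ strings_subset_greedy A _
      have hlen : (2⁻¹ : ℝ≥0∞) ^ A'.length =
          2⁻¹ ^ A.length * (2⁻¹ + 2⁻¹ * ind (¬ Far a (strings A) x)) := by
        rw [hA']
        by_cases hfar : Far a (strings A) x
        · simp [hfar, ind_of_not, pow_succ]
        · simp [hfar, ind_of, ENNReal.inv_two_add_inv_two]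
      rw [mul_assoc, mul_assoc, ← hlen]
      refine le_trans ?_ (mul_le_mul_right (ih A') e)
      rw [← ex_const_mul]
      refine ex_mono fun xs _ => ?_
      rw [hgreedy, mul_left_comm]
      refine mul_le_mul_right ?_ _
      rw [he, ← ENNReal.ofReal_mul (Real.exp_pos _).le, ← Real.exp_add, List.map_cons,
        List.sum_cons, ← mul_add]
      refine ENNReal.ofReal_le_ofReal (Real.exp_le_exp.2 ?_)
      have := farProb_anti P a (hsub xs)
      linarith
    refine (ex_mono fun x _ => h1 x).trans ?_
    rw [ex_const_mul]
    refine (mul_le_mul_right (ex_far_weight a _) _).trans_eq ?_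
    rw [mul_right_comm, he, ← ENNReal.ofReal_mul (Real.exp_pos _).le, ← Real.exp_add,
      add_neg_cancel, Real.exp_zero, ENNReal.ofReal_one, one_mul]

end Greedy

/-! ### Distinguished families in the non-adaptive test -/

section NonAdaptive

variable {n : ℕ} {P : PMF (Str n)}

/-- The scales of the samples in the non-adaptive test, in the order in which these are drawn. -/
def testScales (m L : ℕ) : List ℕ :=
  (List.range (2 * m)).flatMap fun _ =>
    (List.range (L + 1)).flatMap fun a => List.replicate (2 ^ (3 + L - a)) a

lemma sum_map_flatMap {ι : Type} (is : List ι) (l : ι → List ℕ) (f : ℕ → ℝ) :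
    ((is.flatMap l).map f).sum = (is.map fun i => ((l i).map f).sum).sum := by
  induction is with
  | nil => rfl
  | cons i is ih => simp [ih]

lemma sum_map_testScales (m L : ℕ) (f : ℕ → ℝ) :
    ((testScales m L).map f).sum =
      2 * m * ∑ a ∈ Finset.range (L + 1), (2 : ℝ) ^ (3 + L - a) * f a := by
  have hrange : ∀ (k : ℕ) (g : ℕ → ℝ),
      ((List.range k).map g).sum = ∑ a ∈ Finset.range k, g a := by
    intro k g
    induction k with
    | zero => rfl
    | succ k ih => rw [List.range_succ, List.map_append, List.sum_append, ih,
        Finset.sum_range_succ, List.map_singleton, List.sum_singleton]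
  rw [testScales, sum_map_flatMap, List.map_const', List.sum_replicate, List.length_range,
    sum_map_flatMap, nsmul_eq_mul, hrange]
  push_cast
  congr 1
  refine Finset.sum_congr rfl fun a _ => ?_
  rw [List.map_replicate, List.sum_replicate, nsmul_eq_mul]
  push_cast
  rfl

lemma le_of_mem_testScales {m L a : ℕ} (h : a ∈ testScales m L) : a ≤ L := by
  simp only [testScales, List.mem_flatMap, List.mem_range, List.mem_replicate] at h
  obtain ⟨_, -, b, hb, -, rfl⟩ := h
  omega

/-- An index has been queried in both samples, with different answers. -/
def ViewDistinguished (v w : List (Fin n × Bool)) : Prop :=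
  ∃ (j : Fin n) (b : Bool), (j, b) ∈ v ∧ (j, !b) ∈ w

/-- The views `V` contain `m` views that form, together with `v`, a family of pairwise
distinguished views. -/
def Refutes (m : ℕ) (v : List (Fin n × Bool)) (V : List (List (Fin n × Bool))) : Prop :=
  ∃ c : List (List (Fin n × Bool)), c.length = m ∧ (∀ w ∈ c, w ∈ V) ∧
    (v :: c).Pairwise ViewDistinguished

lemma exists_elems_of_refutes {m : ℕ} {x : Elem n} {E : List (Elem n)}
    (h : Refutes m x.view (E.map Elem.view)) :
    ∃ c : List (Elem n), c.length = m ∧ (∀ y ∈ c, y ∈ E) ∧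
      (x :: c).Pairwise Elem.Distinguished := by
  obtain ⟨c, h1, h2, h3⟩ := h
  have h4 : ∃ c' : List (Elem n), c'.map Elem.view = c ∧ ∀ y ∈ c', y ∈ E := by
    clear h1 h3
    induction c with
    | nil => exact ⟨[], rfl, by simp⟩
    | cons w c ih =>
      obtain ⟨y, hy, hyw⟩ := List.mem_map.1 (h2 w (by simp))
      obtain ⟨c', h5, h6⟩ := ih fun w hw => h2 w (by simp [hw])
      exact ⟨y :: c', by simp [hyw, h5], List.forall_mem_cons.2 ⟨hy, h6⟩⟩
  obtain ⟨c', rfl, h6⟩ := h4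
  refine ⟨c', by simpa using h1, h6, ?_⟩
  rw [← List.map_cons, List.pairwise_map] at h3
  exact h3

/-- The number of indices at which the samples of scale `a` are queried. -/
def scaleIndices (m a : ℕ) : ℕ := ⌈2 ^ (a + 2) * lg (m + 1)⌉₊

lemma scaleIndices_mono (m : ℕ) : Monotone (scaleIndices m) := by
  intro a b hab
  refine Nat.ceil_mono (mul_le_mul_of_nonneg_right ?_ ?_)
  · exact pow_le_pow_right₀ (by norm_num) (by omega)
  · exact Real.logb_nonneg (by norm_num) (by simp)

/-- The view of a tagged sample. -/
def taggedView (m : ℕ) (J : List (Fin n)) (p : ℕ × Str n) : List (Fin n × Bool) :=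
  restr (J.take (scaleIndices m p.1)) p.2

/-- Separated samples are distinguished, except with probability at most `exp (-2 lg (m+1))`. -/
lemma ex_not_distinguished_le [NeZero n] {m L : ℕ} {p q : ℕ × Str n} (h : Separated p q)
    (hp : p.1 ≤ L) :
    (ex (iid (PMF.uniformOfFintype (Fin n)) (scaleIndices m L)) fun J =>
      ind (¬ ViewDistinguished (taggedView m J p) (taggedView m J q))) ≤
      ENNReal.ofReal (Real.exp (-(2 * lg (m + 1)))) := by
  have h1 := ex_iid_agree_le (x := q.2) (y := p.2) h.2.le
    (scaleIndices_mono m (h.1.trans hp))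
  refine (ex_mono fun J _ => ind_mono ?_).trans (h1.trans (ENNReal.ofReal_le_ofReal
    (Real.exp_le_exp.2 (neg_le_neg ?_))))
  · intro hnot j hj
    by_contra hne
    refine hnot ⟨j, p.2 j, mem_restr.2 ⟨?_, rfl⟩, mem_restr.2 ⟨hj, ?_⟩⟩
    · exact (List.take_prefix_take_left (scaleIndices_mono m h.1)).subset hj
    · revert hne
      dsimp only
      cases p.2 j <;> cases q.2 j <;> simp
  · calc 2 * lg (m + 1) = (1 / 2 : ℝ) ^ (q.1 + 1) * (2 ^ (q.1 + 2) * lg (m + 1)) := by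
          rw [one_div, inv_pow]
          field_simp
          ring
      _ ≤ _ := mul_le_mul_of_nonneg_left (Nat.le_ceil _) (by positivity)

/-- A union bound over the pairs of a list of separated samples. -/
lemma two_mul_ex_not_pairwise_le [NeZero n] {m L : ℕ} {C : List (ℕ × Str n)}
    (h : C.Pairwise Separated) (hL : ∀ p ∈ C, p.1 ≤ L) :
    2 * (ex (iid (PMF.uniformOfFintype (Fin n)) (scaleIndices m L)) fun J =>
      ind (¬ (C.map (taggedView m J)).Pairwise ViewDistinguished)) ≤
      C.length ^ 2 * ENNReal.ofReal (Real.exp (-(2 * lg (m + 1)))) := by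
  set e := ENNReal.ofReal (Real.exp (-(2 * lg (m + 1))))
  induction C with
  | nil => simp [ind_of_not, ex_const]
  | cons p C ih =>
    rw [List.pairwise_cons] at h
    have h1 : ∀ D : List (ℕ × Str n), (∀ q ∈ D, Separated p q) →
        (ex (iid (PMF.uniformOfFintype (Fin n)) (scaleIndices m L)) fun J =>
          ind (∃ q ∈ D, ¬ ViewDistinguished (taggedView m J p) (taggedView m J q))) ≤
        D.length * e := by
      intro D hD
      induction D with
      | nil => simp [ind_of_not, ex_const]
      | cons q D ih' =>
        rw [List.length_cons, Nat.cast_add, Nat.cast_one, add_mul, one_mul]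
        refine le_trans ?_ (add_le_add (ih' fun q hq => hD q (by simp [hq]))
          (ex_not_distinguished_le (m := m) (hD q (by simp)) (hL p (by simp))))
        rw [← ex_add]
        refine ex_mono fun J _ => le_trans (ind_mono ?_) (ind_or_le _ _)
        rintro ⟨q', hq', hn⟩
        rcases List.mem_cons.1 hq' with rfl | hq'
        · exact Or.inr hn
        · exact Or.inl ⟨q', hq', hn⟩
    have h2 := ih h.2 fun q hq => hL q (by simp [hq])
    have h3 := h1 C h.1
    calc _ ≤ 2 * (ex (iid (PMF.uniformOfFintype (Fin n)) (scaleIndices m L)) fun J =>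
            ind (∃ q ∈ C, ¬ ViewDistinguished (taggedView m J p) (taggedView m J q)) +
            ind (¬ (C.map (taggedView m J)).Pairwise ViewDistinguished)) := by
          refine mul_le_mul_right (ex_mono fun J _ => le_trans (ind_mono fun hn => ?_)
            (ind_or_le _ _)) _
          rw [List.map_cons, List.pairwise_cons, not_and_or] at hn
          refine hn.imp_left fun hn => ?_
          push Not at hn
          obtain ⟨w, hw, hn⟩ := hn
          obtain ⟨q, hq, rfl⟩ := List.mem_map.1 hw
          exact ⟨q, hq, hn⟩
      _ ≤ 2 * (C.length * e) + C.length ^ 2 * e := by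
          rw [ex_add, mul_add]
          exact add_le_add (mul_le_mul_right h3 _) h2
      _ ≤ (p :: C).length ^ 2 * e := by
          rw [List.length_cons]
          push_cast
          rw [← mul_assoc, ← add_mul]
          refine mul_le_mul_left ?_ _
          rw [add_sq, one_pow, mul_one]
          refine le_add_right ?_
          rw [add_comm]

/-- The greedy choice among the samples, in the order of decreasing scales, is unlikely to stop
with at most `m` elements if the input is far from `S_m`. -/
lemma ex_greedy_short_le {ε : ℝ} {m L : ℕ} (hm : 2 ≤ m) (hε0 : 0 < ε) (hL : ε⁻¹ ≤ 2 ^ L)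
    (hP : ε < distToProperty P (boundedSupport n m)) {l : List ℕ}
    (hl : l.Perm (testScales m L)) (u : Str n) :
    (ex (tagged P l) fun xs => ind ((greedy [(L, u)] xs).length ≤ m)) ≤
      ENNReal.ofReal (Real.exp (-2) * Real.exp (-2)) := by
  have h1 := ex_greedy_le (P := P) m l [(L, u)]
  have h2 : ∀ A : List (ℕ × Str n), A ≠ [] → A.length ≤ m →
      8 * (m : ℝ) ≤ 1 / 2 * (l.map fun a => farProb P a (strings A)).sum := by
    intro A hA0 hA
    have hne : (strings A).Nonempty := by
      obtain ⟨p, hp⟩ := List.exists_mem_of_ne_nil A hA0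
      exact ⟨p.2, List.mem_toFinset.2 (List.mem_map_of_mem hp)⟩
    obtain ⟨near, hnear, hmin⟩ := exists_near hne
    have h3 := lt_mean_min_add_sum_farProb (A := strings A) hP ((List.toFinset_card_le _).trans
      (by simpa using hA)) hnear hmin (L + 1)
    have h4 : mean P (fun v => min (strDist v (near v)) ((1 / 2) ^ (L + 1))) ≤
        (1 / 2) ^ (L + 1) :=
      (mean_mono P fun v => min_le_right _ _).trans_eq (mean_const P _)
    have h5 : (1 / 2 : ℝ) ^ L ≤ ε := by
      rw [one_div, inv_pow]
      exact inv_le_of_inv_le₀ hε0 hL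
    have h6 : (1 / 2 : ℝ) ^ (L + 1) ≤
        ∑ a ∈ Finset.range (L + 1), (1 / 2 : ℝ) ^ (a + 1) * farProb P a (strings A) := by
      have : (1 / 2 : ℝ) ^ L = 2 * (1 / 2) ^ (L + 1) := by ring
      linarith
    have h7 : ∑ a ∈ Finset.range (L + 1), (2 : ℝ) ^ (3 + L - a) * farProb P a (strings A) =
        2 ^ (L + 4) * ∑ a ∈ Finset.range (L + 1), (1 / 2 : ℝ) ^ (a + 1) *
          farProb P a (strings A) := by
      rw [Finset.mul_sum]
      refine Finset.sum_congr rfl fun a ha => ?_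
      have ha' : a ≤ L := by
        rw [Finset.mem_range] at ha
        omega
      rw [← mul_assoc, show L + 4 = (3 + L - a) + (a + 1) by omega, pow_add, mul_assoc _ _
        ((1 / 2 : ℝ) ^ (a + 1)), ← mul_pow]
      norm_num
    rw [(hl.map _).sum_eq, sum_map_testScales, h7]
    have h8 : (8 : ℝ) ≤ 2 ^ (L + 4) * ∑ a ∈ Finset.range (L + 1), (1 / 2 : ℝ) ^ (a + 1) *
          farProb P a (strings A) := by
      calc (8 : ℝ) = 2 ^ (L + 4) * (1 / 2) ^ (L + 1) := by
            rw [show L + 4 = L + 1 + 3 by omega, pow_add _ (L + 1) 3, mul_right_comm, ← mul_pow]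
            norm_num
        _ ≤ _ := mul_le_mul_of_nonneg_left h6 (by positivity)
    nlinarith [show (0 : ℝ) ≤ m from Nat.cast_nonneg m]
  have h3 : ENNReal.ofReal (Real.exp (8 * m)) *
      (ex (tagged P l) fun xs => ind ((greedy [(L, u)] xs).length ≤ m)) ≤
      ENNReal.ofReal (Real.exp m) := by
    rw [← ex_const_mul]
    refine le_trans (ex_mono fun xs _ => ?_) (h1.trans ?_)
    · by_cases hxs : (greedy [(L, u)] xs).length ≤ m
      · rw [ind_of hxs, one_mul, mul_one]
        refine ENNReal.ofReal_le_ofReal (Real.exp_le_exp.2 (h2 _ ?_ hxs))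
        obtain ⟨B, hB, -⟩ := exists_greedy_eq_append [(L, u)] xs
        simp [hB]
      · simp [ind_of_not hxs]
    · refine (mul_le_mul_right (pow_le_one₀ zero_le
        (ENNReal.inv_le_one.2 (by norm_num))) _).trans ?_
      rw [mul_one, ← ENNReal.ofReal_ofNat 2, ← ENNReal.ofReal_pow (by norm_num)]
      refine ENNReal.ofReal_le_ofReal ?_
      rw [← mul_one (m : ℝ), Real.exp_nat_mul]
      exact pow_le_pow_left₀ (by norm_num) (by linarith [Real.add_one_le_exp 1]) m
  have hm' : (2 : ℝ) ≤ m := by exact_mod_cast hm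
  calc _ = ENNReal.ofReal (Real.exp (-(8 * m))) * (ENNReal.ofReal (Real.exp (8 * m)) *
        (ex (tagged P l) fun xs => ind ((greedy [(L, u)] xs).length ≤ m))) := by
        rw [← mul_assoc, ← ENNReal.ofReal_mul (Real.exp_pos _).le, ← Real.exp_add,
          neg_add_cancel, Real.exp_zero, ENNReal.ofReal_one, one_mul]
    _ ≤ ENNReal.ofReal (Real.exp (-(8 * m))) * ENNReal.ofReal (Real.exp m) :=
        mul_le_mul_right h3 _
    _ ≤ _ := by
        rw [← ENNReal.ofReal_mul (Real.exp_pos _).le, ← Real.exp_add, ← Real.exp_add]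
        exact ENNReal.ofReal_le_ofReal (Real.exp_le_exp.2 (by linarith))

/-- For fixed samples, in the order of decreasing scales, the random indices refute membership in
`S_m` if the greedy choice has found more than `m` samples. -/
lemma ex_not_refutes_le [NeZero n] {m L : ℕ} (hm : 2 ≤ m) (u : Str n)
    {xs : List (ℕ × Str n)} (hxs : (xs.map Prod.fst).Pairwise (· ≥ ·))
    (hL : ∀ p ∈ xs, p.1 ≤ L) :
    (ex (iid (PMF.uniformOfFintype (Fin n)) (scaleIndices m L)) fun J =>
      ind (¬ Refutes m (taggedView m J (L, u)) (xs.map (taggedView m J)))) ≤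
      ind ((greedy [(L, u)] xs).length ≤ m) + ENNReal.ofReal (2 * Real.exp (-2)) := by
  by_cases hlen : (greedy [(L, u)] xs).length ≤ m
  · rw [ind_of hlen]
    exact le_add_right ((ex_mono fun J _ => ind_le_one _).trans_eq (ex_const _ 1))
  refine le_add_left ?_
  obtain ⟨B, hB, hBmem⟩ := exists_greedy_eq_append [(L, u)] xs
  have hpair := pairwise_greedy (A := [(L, u)]) (List.pairwise_singleton _ _) hxs
    (by simpa using hL)
  rw [hB, List.singleton_append] at hpair hlen
  rw [List.length_cons] at hlen
  have hC : ((L, u) :: B.take m).Pairwise Separated :=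
    hpair.sublist ((List.take_sublist m B).cons_cons _)
  have hCL : ∀ p ∈ (L, u) :: B.take m, p.1 ≤ L := by
    refine List.forall_mem_cons.2 ⟨le_rfl, fun p hp => hL p (hBmem p (List.mem_of_mem_take hp))⟩
  have hClen : ((L, u) :: B.take m).length = m + 1 := by
    rw [List.length_cons, List.length_take]
    omega
  have h1 := two_mul_ex_not_pairwise_le (m := m) hC hCL
  rw [hClen] at h1
  have h2 : (ex (iid (PMF.uniformOfFintype (Fin n)) (scaleIndices m L)) fun J =>
      ind (¬ Refutes m (taggedView m J (L, u)) (xs.map (taggedView m J)))) ≤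
      ex (iid (PMF.uniformOfFintype (Fin n)) (scaleIndices m L)) fun J =>
        ind (¬ (((L, u) :: B.take m).map (taggedView m J)).Pairwise ViewDistinguished) := by
    refine ex_mono fun J _ => ind_mono (mt fun hp => ?_)
    refine ⟨(B.take m).map (taggedView m J), ?_, ?_, by simpa using hp⟩
    · rw [List.length_map, List.length_take]
      omega
    · intro w hw
      obtain ⟨p, hp, rfl⟩ := List.mem_map.1 hw
      exact List.mem_map_of_mem (hBmem p (List.mem_of_mem_take hp))
  refine h2.trans ?_
  refine (ENNReal.mul_le_mul_iff_right (a := 2) (by norm_num) (by norm_num)).1 (h1.trans ?_)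
  have hm' : (2 : ℝ) ≤ m := by exact_mod_cast hm
  have h3 := pow_mul_exp_neg_lg_le (x := m + 1) (by linarith) (le_refl 2)
  have h4 : ((m + 1 : ℕ) : ℝ≥0∞) ^ 2 = ENNReal.ofReal ((m + 1 : ℝ) ^ 2) := by
    rw [ENNReal.ofReal_pow (by positivity)]
    congr 1
    rw [← ENNReal.ofReal_natCast]
    push_cast
    rfl
  rw [h4, ← ENNReal.ofReal_mul (by positivity), ← ENNReal.ofReal_ofNat 2,
    ← ENNReal.ofReal_mul (by norm_num)]
  refine ENNReal.ofReal_le_ofReal (h3.trans_eq ?_)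
  ring

end NonAdaptive

/-! ### Error probability and number of queries of the non-adaptive test -/

section NonAdaptiveTest

variable {n : ℕ} {P : PMF (Str n)}

lemma inv_le_two_pow_ceil {ε : ℝ} (hε : 0 < ε) : ε⁻¹ ≤ 2 ^ ⌈lg ε⁻¹⌉₊ := by
  calc ε⁻¹ = 2 ^ lg ε⁻¹ := by
        rw [lg, Real.rpow_logb (by norm_num) (by norm_num) (inv_pos.2 hε)]
    _ ≤ 2 ^ (⌈lg ε⁻¹⌉₊ : ℝ) :=
        Real.rpow_le_rpow_of_exponent_le (by norm_num) (Nat.le_ceil _)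
    _ = 2 ^ ⌈lg ε⁻¹⌉₊ := Real.rpow_natCast _ _

lemma numIndices_eq (m L : ℕ) : ⌈4 * 2 ^ L * lg (m + 1)⌉₊ = scaleIndices m L := by
  rw [scaleIndices, pow_add]
  norm_num [mul_comm]

lemma wp_nonAdaptiveTest_lt [NeZero n] {ε : ℝ} {m : ℕ} (hm : 2 ≤ m) (hε : 0 < ε)
    (hP : ε < distToProperty P (boundedSupport n m)) :
    wp P (nonAdaptiveTest n ε m) (fun b _ => ind (b = true)) [] < 1 / 3 := by
  set L := ⌈lg ε⁻¹⌉₊ with hL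
  set I : List (Fin n) → ℕ → List (Fin n) := fun J a => J.take (scaleIndices m a)
  have h1 : wp P (nonAdaptiveTest n ε m) (fun b _ => ind (b = true)) [] ≤
      ex (iid (PMF.uniformOfFintype (Fin n)) (scaleIndices m L)) fun J => ex P fun u =>
        ex (tagged P (testScales m L)) fun xs =>
          ind (¬ Refutes m (taggedView m J (L, u)) (xs.map (taggedView m J))) := by
    unfold nonAdaptiveTest
    simp only [wp_bind, wp_chooseIndices, wp_draw, wp_queryAt, str_append_length, numIndices_eq,
      ← hL]
    refine ex_mono fun J _ => ex_mono fun u _ => ?_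
    have hcol : Collects P (I J) (collect
        (fun _ : ℕ => collect (fun a => takeSamples (I J a) (2 ^ (3 + L - a)))
          (List.range (L + 1))) (List.range (2 * m))) (testScales m L) :=
      collects_collect (fun _ => collects_collect (fun a => collects_takeSamples _ a _) _) _
    refine le_trans (wp_mono _ fun E S => ?_) (hcol (fun V =>
      ind (¬ Refutes m (taggedView m J (L, u)) V)) _).le
    split_ifs with hc
    · rw [wp_pure, ind_of_not (by simp)]
      exact zero_le
    · refine ind_mono fun _ href => hc ?_
      exact exists_elems_of_refutes href
  refine h1.trans_lt ?_
  -- Examine the samples in the order of decreasing scales, before the indices are chosen.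
  set l := (testScales m L).insertionSort (· ≥ ·)
  have hperm : l.Perm (testScales m L) := List.perm_insertionSort _ _
  have h2 : (ex (iid (PMF.uniformOfFintype (Fin n)) (scaleIndices m L)) fun J => ex P fun u =>
        ex (tagged P (testScales m L)) fun xs =>
          ind (¬ Refutes m (taggedView m J (L, u)) (xs.map (taggedView m J)))) =
      ex P fun u => ex (tagged P l) fun xs =>
        ex (iid (PMF.uniformOfFintype (Fin n)) (scaleIndices m L)) fun J =>
          ind (¬ Refutes m (taggedView m J (L, u)) (xs.map (taggedView m J))) := by
    rw [ex_comm]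
    congr 1
    funext u
    rw [ex_comm (tagged P l)]
    congr 1
    funext J
    refine (ex_tagged_perm hperm fun xs ys hxy => ?_).symm
    congr 2
    simp only [Refutes, (hxy.map (taggedView m J)).mem_iff]
  rw [h2]
  have h3 : ∀ u, (ex (tagged P l) fun xs =>
      ex (iid (PMF.uniformOfFintype (Fin n)) (scaleIndices m L)) fun J =>
        ind (¬ Refutes m (taggedView m J (L, u)) (xs.map (taggedView m J)))) ≤
      ENNReal.ofReal (Real.exp (-2) * Real.exp (-2)) + ENNReal.ofReal (2 * Real.exp (-2)) := by
    intro u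
    refine le_trans (ex_mono fun xs hxs => ex_not_refutes_le hm u ?_ ?_) ?_
    · rw [map_fst_of_mem_support_tagged hxs]
      exact List.pairwise_insertionSort _ _
    · intro p hp
      have hp' : p.1 ∈ xs.map Prod.fst := List.mem_map_of_mem hp
      rw [map_fst_of_mem_support_tagged hxs] at hp'
      exact le_of_mem_testScales (hperm.mem_iff.1 hp')
    · rw [ex_add, ex_const]
      gcongr
      exact ex_greedy_short_le hm hε (inv_le_two_pow_ceil hε) hP hperm u
  refine ((ex_mono fun u _ => h3 u).trans_eq (ex_const P _)).trans_lt ?_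
  have h5 := exp_neg_two_le
  rw [← ENNReal.ofReal_add (by positivity) (by positivity)]
  refine (ENNReal.ofReal_lt_iff_lt_toReal (by positivity) (by finiteness)).2 ?_
  rw [ENNReal.toReal_div, ENNReal.toReal_one, ENNReal.toReal_ofNat]
  nlinarith [Real.exp_pos (-2)]

/-- The answers in a view come from a string in the support of `P`. -/
def Genuine (P : PMF (Str n)) (v : List (Fin n × Bool)) : Prop :=
  ∃ x ∈ P.support, ∀ jb ∈ v, jb.2 = x jb.1

lemma genuine_restr {x : Str n} (hx : x ∈ P.support) (J : List (Fin n)) :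
    Genuine P (restr J x) := ⟨x, hx, fun _ hjb => (mem_restr.1 hjb).2⟩

lemma notMem_boundedSupport_of_distinguished {m : ℕ} {c : List (Elem n)}
    (hc : c.Pairwise Elem.Distinguished) (hgen : ∀ x ∈ c, Genuine P x.view)
    (hm : m + 1 ≤ c.length) : P ∉ boundedSupport n m := by
  choose! f hf hfv using hgen
  refine notMem_boundedSupport (l := c.map f) ?_ ?_ (by simpa using hm)
  · rw [List.Nodup, List.pairwise_map]
    refine hc.imp_of_mem fun {x y} hx hy => ?_
    rintro ⟨j, b, h1, h2⟩ heq
    have h3 := hfv x hx _ h1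
    have h4 := hfv y hy _ h2
    rw [← heq, ← h3] at h4
    simp at h4
  · intro y hy
    obtain ⟨x, hx, rfl⟩ := List.mem_map.1 hy
    exact hf x hx

/-- All elements in the output carry genuine answers, and there are at most `q` queries. -/
def CollectsGenuine (P : PMF (Str n)) (𝒜 : Alg n (List (Elem n))) (q : ℕ) : Prop :=
  ∀ S, Always P 𝒜 (fun E _ c => (∀ x ∈ E, Genuine P x.view) ∧ c ≤ q) S

lemma collectsGenuine_takeSamples {J : List (Fin n)} {k : ℕ} (hJ : J.length ≤ k) (N : ℕ) :
    CollectsGenuine P (takeSamples J N) (N * k) := by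
  refine fun S => always_takeSamples fun xs _ hP => ⟨fun Y hY => ?_, Nat.mul_le_mul_left _ hJ⟩
  have h : Y.view ∈ (sampleElems J S.length xs).map Elem.view := List.mem_map_of_mem hY
  rw [map_view_sampleElems] at h
  obtain ⟨x, hx, h⟩ := List.mem_map.1 h
  exact h ▸ genuine_restr (hP x hx) J

lemma collectsGenuine_collect {ι : Type} {f : ι → Alg n (List (Elem n))} {q : ℕ} (is : List ι)
    (h : ∀ i ∈ is, CollectsGenuine P (f i) q) :
    CollectsGenuine P (collect f is) (is.length * q) := by
  induction is with
  | nil => exact fun S => ⟨by simp, Nat.zero_le _⟩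
  | cons i is ih =>
    intro S
    rw [collect, always_bind]
    refine (h i (by simp) S).mono ?_
    rintro E S' c ⟨h1, h2⟩
    rw [always_bind]
    refine (ih (fun i hi => h i (by simp [hi])) S').mono ?_
    rintro E' S'' d ⟨h3, h4⟩
    refine ⟨List.forall_mem_append.2 ⟨h1, h3⟩, ?_⟩
    rw [List.length_cons, Nat.add_mul]
    omega

lemma always_nonAdaptiveTest [NeZero n] {ε : ℝ} {m q : ℕ}
    (hq : ∀ a ≤ ⌈lg ε⁻¹⌉₊, 2 ^ (3 + ⌈lg ε⁻¹⌉₊ - a) * scaleIndices m a ≤ q) :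
    Always P (nonAdaptiveTest n ε m) (fun b _ c => (b = false → P ∉ boundedSupport n m) ∧
      c ≤ scaleIndices m ⌈lg ε⁻¹⌉₊ + 2 * m * ((⌈lg ε⁻¹⌉₊ + 1) * q)) [] := by
  unfold nonAdaptiveTest
  rw [always_bind]
  refine always_chooseIndices fun J hJ => ?_
  rw [always_bind, always_draw]
  intro u hu
  rw [always_bind, always_queryAt, always_bind]
  have hcol : CollectsGenuine P (collect (fun _ : ℕ => collect (fun a =>
      takeSamples (J.take (scaleIndices m a)) (2 ^ (3 + ⌈lg ε⁻¹⌉₊ - a)))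
      (List.range (⌈lg ε⁻¹⌉₊ + 1))) (List.range (2 * m))) (2 * m * ((⌈lg ε⁻¹⌉₊ + 1) * q)) := by
    have h1 := collectsGenuine_collect (P := P) (f := fun a =>
      takeSamples (J.take (scaleIndices m a)) (2 ^ (3 + ⌈lg ε⁻¹⌉₊ - a)))
      (List.range (⌈lg ε⁻¹⌉₊ + 1)) (q := q) fun a ha S =>
        (collectsGenuine_takeSamples (List.length_take_le _ _) _ S).mono fun E S' c hc =>
          ⟨hc.1, hc.2.trans (hq a (by rw [List.mem_range] at ha; omega))⟩
    have h2 := collectsGenuine_collect (P := P) (List.range (2 * m)) fun _ _ => h1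
    simpa only [List.length_range] using h2
  refine (hcol _).mono ?_
  rintro E S c ⟨h1, h2⟩
  have hcost : ∀ k, k ≤ scaleIndices m ⌈lg ε⁻¹⌉₊ →
      0 + (0 + (k + (c + 0))) ≤ scaleIndices m ⌈lg ε⁻¹⌉₊ +
        2 * m * ((⌈lg ε⁻¹⌉₊ + 1) * q) := fun k hk => by omega
  split_ifs with hrej
  · refine ⟨fun _ => ?_, hcost _ (List.length_take_le _ _)⟩
    obtain ⟨c', g1, g2, g3⟩ := hrej
    refine notMem_boundedSupport_of_distinguished g3 ?_ (by simp [g1])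
    refine List.forall_mem_cons.2 ⟨?_, fun x hx => h1 x (g2 x hx)⟩
    rw [str_append_length]
    exact genuine_restr hu _
  · exact ⟨fun hc => by simp at hc, hcost _ (List.length_take_le _ _)⟩

lemma scale_cost_le (ε : ℝ) {m : ℕ} (hm : 2 ≤ m) {a : ℕ} (ha : a ≤ ⌈lg ε⁻¹⌉₊) :
    2 ^ (3 + ⌈lg ε⁻¹⌉₊ - a) * scaleIndices m a ≤ ⌊80 * 2 ^ ⌈lg ε⁻¹⌉₊ * lg m⌋₊ := by
  set L := ⌈lg ε⁻¹⌉₊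
  have hm' : (2 : ℝ) ≤ m := by exact_mod_cast hm
  have hlg := one_le_lg hm'
  have hlg1 := one_le_lg (x := m + 1) (by linarith)
  have hlg2 : lg (m + 1) ≤ 2 * lg m := by
    have h1 : lg ((m : ℝ) ^ 2) = 2 * lg m := by
      rw [lg, lg, Real.logb_pow]
      norm_num
    rw [← h1]
    exact Real.logb_le_logb_of_le (by norm_num) (by linarith) (by nlinarith)
  have h1 : (scaleIndices m a : ℝ) ≤ 10 * 2 ^ a * lg m := by
    have ha1 : (1 : ℝ) ≤ 2 ^ a := one_le_pow₀ (by norm_num)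
    refine (Nat.ceil_lt_add_one (by positivity)).le.trans ?_
    rw [pow_add]
    nlinarith
  refine Nat.le_floor ?_
  push_cast
  calc (2 : ℝ) ^ (3 + L - a) * scaleIndices m a ≤ 2 ^ (3 + L - a) * (10 * 2 ^ a * lg m) := by
        gcongr
    _ = 10 * 2 ^ (3 + L - a + a) * lg m := by rw [pow_add _ _ a]; ring
    _ = 80 * 2 ^ L * lg m := by
        rw [show 3 + L - a + a = 3 + L by omega, pow_add]
        ring

lemma nonAdaptive_cost_le {ε : ℝ} {m : ℕ} (hm : 2 ≤ m) (hε0 : 0 < ε) (hε1 : ε ≤ 1)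
    (hε : 1 / (m : ℝ) ^ 2 ≤ ε) :
    ((scaleIndices m ⌈lg ε⁻¹⌉₊ + 2 * m * ((⌈lg ε⁻¹⌉₊ + 1) *
      ⌊80 * 2 ^ ⌈lg ε⁻¹⌉₊ * lg m⌋₊) : ℕ) : ℝ) ≤
      1000000 * (ε⁻¹ * m * lg m * min (max 1 (lg ε⁻¹)) (lg m)) := by
  have hm' : (2 : ℝ) ≤ m := by exact_mod_cast hm
  have hlg := one_le_lg hm'
  have hε2 : 1 ≤ ε⁻¹ := (one_le_inv₀ hε0).2 hε1
  have hlgε : 0 ≤ lg ε⁻¹ := Real.logb_nonneg (by norm_num) hε2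
  have hL := (Nat.ceil_lt_add_one hlgε).le
  have hlgε2 : lg ε⁻¹ ≤ 2 * lg m := by
    have h1 : lg ((m : ℝ) ^ 2) = 2 * lg m := by
      rw [lg, lg, Real.logb_pow]
      norm_num
    rw [← h1]
    refine Real.logb_le_logb_of_le (by norm_num) (by linarith) ?_
    rw [one_div] at hε
    exact inv_le_of_inv_le₀ (by positivity) hε
  set X := max 1 (lg ε⁻¹) with hX
  have hX1 : 1 ≤ X := le_max_left _ _
  have hX2 : lg ε⁻¹ ≤ X := le_max_right _ _
  have hmin : X ≤ 2 * min X (lg m) := by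
    rcases min_cases X (lg m) with ⟨h, -⟩ | ⟨h, -⟩ <;> rw [h]
    · linarith
    · exact max_le (by linarith) hlgε2
  have hpow : (2 : ℝ) ^ ⌈lg ε⁻¹⌉₊ ≤ 2 * ε⁻¹ := by
    calc (2 : ℝ) ^ ⌈lg ε⁻¹⌉₊ = 2 ^ (⌈lg ε⁻¹⌉₊ : ℝ) := (Real.rpow_natCast _ _).symm
      _ ≤ 2 ^ (lg ε⁻¹ + 1) := Real.rpow_le_rpow_of_exponent_le (by norm_num) hL
      _ = 2 * ε⁻¹ := by
          rw [Real.rpow_add (by norm_num), lg, Real.rpow_logb (by norm_num) (by norm_num)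
            (by linarith), Real.rpow_one, mul_comm]
  have hq : (⌊80 * 2 ^ ⌈lg ε⁻¹⌉₊ * lg m⌋₊ : ℝ) ≤ 160 * (ε⁻¹ * lg m) := by
    refine (Nat.floor_le (by positivity)).trans ?_
    nlinarith
  have hu : (scaleIndices m ⌈lg ε⁻¹⌉₊ : ℝ) ≤ 160 * (ε⁻¹ * lg m) := by
    refine le_trans ?_ hq
    have h1 := scale_cost_le ε hm le_rfl
    rw [Nat.add_sub_cancel] at h1
    exact_mod_cast (by omega : scaleIndices m ⌈lg ε⁻¹⌉₊ ≤ ⌊80 * 2 ^ ⌈lg ε⁻¹⌉₊ * lg m⌋₊)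
  push_cast
  set Y := ε⁻¹ * lg m with hY
  have hY0 : 0 ≤ Y := by positivity
  have h2 : ((⌈lg ε⁻¹⌉₊ : ℝ) + 1) * ⌊80 * 2 ^ ⌈lg ε⁻¹⌉₊ * lg m⌋₊ ≤ (3 * X) * (160 * Y) := by
    gcongr
    linarith
  have h3 : 2 * (m : ℝ) * (((⌈lg ε⁻¹⌉₊ : ℝ) + 1) * ⌊80 * 2 ^ ⌈lg ε⁻¹⌉₊ * lg m⌋₊) ≤
      2 * m * ((3 * X) * (160 * Y)) := by gcongr
  have h4 : Y ≤ m * Y * X := by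
    have h5 : 1 ≤ m * X := by nlinarith
    nlinarith
  have h6 : (m : ℝ) * Y * X ≤ m * Y * (2 * min X (lg m)) := by gcongr
  have h7 : ε⁻¹ * m * lg m * min X (lg m) = m * Y * min X (lg m) := by rw [hY]; ring
  rw [h7]
  have h8 : 0 ≤ (m : ℝ) * Y * min X (lg m) := by positivity
  nlinarith

end NonAdaptiveTest

lemma always_adaptiveTest_cost {n : ℕ} [NeZero n] {P : PMF (Str n)} {ε : ℝ} {m : ℕ} (hm : 2 ≤ m)
    (hε0 : 0 < ε) (hε1 : ε ≤ 1) :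
    Always P (adaptiveTest n ε m) (fun b _ c => (b = false → P ∉ boundedSupport n m) ∧
      (c : ℝ) ≤ 1000000 * (ε⁻¹ * m * lg m * min (max 1 (lg ε⁻¹)) (lg m))) [] := by
  by_cases hε : 1 / (m : ℝ) ^ 2 ≤ ε
  · rw [adaptiveTest, if_pos hε]
    refine (always_nonAdaptiveTest fun a ha => scale_cost_le ε hm ha).mono ?_
    rintro b S c ⟨h1, h2⟩
    exact ⟨h1, (Nat.cast_le.2 h2).trans (nonAdaptive_cost_le hm hε0 hε1 hε)⟩
  · rw [not_le] at hε
    refine (always_adaptiveTest hm hε (fun k hk hkm => checkpoint_two_le hm hk hkm)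
      fun a ha => batch_cost_le hm hε0 hε ha).mono ?_
    rintro b S c ⟨h1, h2⟩
    exact ⟨h1, (Nat.cast_le.2 h2).trans (adaptive_cost_le hm hε0 hε)⟩

end HugeObject

end

theorem mainTheorem2 :
    ∃ C : ℝ, 0 < C ∧
      ∀ (n m : ℕ) [NeZero n] (ε : ℝ), 2 ≤ m → 0 < ε → ε ≤ 1 →
        (HugeObject.adaptiveTest n ε m).IsOneSidedTest ε (HugeObject.boundedSupport n m) ∧
        (HugeObject.adaptiveTest n ε m).MakesAtMost
          (C * (ε⁻¹ * m * Real.logb 2 m *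
            min (max 1 (Real.logb 2 ε⁻¹)) (Real.logb 2 m))) := by
  refine ⟨1000000, by norm_num, fun n m _ ε hm hε0 hε1 => ⟨?_, fun P o ho => ?_⟩⟩
  · refine HugeObject.Alg.isOneSidedTest_of_wp (fun P hP => ?_) fun P hP => ?_
    · refine (HugeObject.always_adaptiveTest_cost hm hε0 hε1).mono fun b S c h => ?_
      by_contra hb
      exact h.1 (by simpa using hb) hP
    · by_cases hε : 1 / (m : ℝ) ^ 2 ≤ ε
      · rw [HugeObject.adaptiveTest, if_pos hε]
        exact HugeObject.wp_nonAdaptiveTest_lt hm hε0 hP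
      · exact HugeObject.wp_adaptiveTest_lt hm hε0 (not_le.1 hε) hP
          (fun k hk hkm => HugeObject.checkpoint_two_le hm hk hkm)
          fun a ha => HugeObject.batch_cost_le hm hε0 (not_le.1 hε) ha
  · exact HugeObject.Alg.always_run
      ((HugeObject.always_adaptiveTest_cost hm hε0 hε1).mono fun b S c h => h.2) o ho
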